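/- Manifolds are smooth, finite-dimensional, Hausdorff and second countable. A degenerate metric on a manifold is a smooth symmetric covariant $2$-tensor field $h$, and $\ker h$ denotes the module of smooth vector fields $X$ with $h(X,-)=0$. An $(n+1)$-dimensional pair $(N,h)$ is a simple Carrollian manifold if there is a surjective submersion $\pi:N\to M$ onto an $n$-dimensional manifold $M$ (the leaf space) with connected, non-compact fibres (the leaves), such that $\ker h$ is the module of sections of $\ker \mathrm{d}\pi$. A transversal slice is an embedded $n$-dimensional submanifold $\iota:S\hookrightarrow N$ that is transversal to the leaves and meets each leaf in exactly one point. A Carrollian $\mathbb{R}^\times$-bundle $(P,g)$ is a principal $\mathbb{R}^\times$-bundle $P\to S$ with a degenerate metric $g$ on $P$ whose kernel is the module of vertical vector fields. **Theorem.** Every simple Carrollian manifold $(N,h)$ yields, after non-canonical choices of a transversal slice and of a section, a Carrollian $\mathbb{R}^\times$-bundle $(P,g)$. Precisely, let $\pi:N\to M$ be as above. 1. $\pi$ is a smooth fibre bundle with typical fibre $\mathbb{R}$. 2. There is a transversal slice $\iota:M\hookrightarrow N$ with $\pi\circ\iota=\mathrm{id}_M$. 3. For every transversal slice $\iota:S\hookrightarrow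 N$, there is a map $q:N\to S$ with $\pi\circ\iota\circ q=\pi$ (the projection along the leaves), and it is a smooth fibre bundle with typical fibre $\mathbb{R}$ that has a smooth global section. For every smooth global section $s$ of $q$, there are a smooth line bundle $L\to S$ and a fibre-preserving diffeomorphism $\Phi:L\to N$ over $S$ that maps the zero section to $s$, such that $P:=L^\times=L\setminus\{0_S\}$, with the fibrewise action of $\mathbb{R}^\times$ and the pullback $g$ of $h$ along $P\hookrightarrow L\xrightarrow{\Phi}N$, is a Carrollian $\mathbb{R}^\times$-bundle over $S$. If moreover the kernel of the bilinear form $h_x$ equals $\ker\mathrm{d}\pi_x$ at every point $x\in N$, then the kernel of $g_p$ equals the vertical space $\mathsf{V}_pP$ at every point $p\in P$. -/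

import Mathlib

open Bundle Manifold
open scoped Manifold ContDiff Topology

section TensorsAndFields

variable {E : Type*} [NormedAddCommGroup E] [NormedSpace ℝ E]
  {H : Type*} [TopologicalSpace H] (I : ModelWithCorners ℝ E H)
  (N : Type*) [TopologicalSpace N] [ChartedSpace H N] [IsManifold I ∞ N]

/-- A (possibly degenerate) metric: a smooth symmetric covariant `2`-tensor field. Neither
non-degeneracy nor a signature is required. -/
structure DegenerateMetric where
  /-- the bilinear form on each tangent space -/
  form (x : N) : TangentSpace I x →L[ℝ] TangentSpace I x →L[ℝ] ℝ
  symm (x : N) (v w : TangentSpace I x) : form x v w = form x w v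
  contMDiff : ContMDiff I (I.prod 𝓘(ℝ, E →L[ℝ] E →L[ℝ] ℝ)) ∞
    (fun x ↦ TotalSpace.mk' (E →L[ℝ] E →L[ℝ] ℝ)
      (E := fun x : N ↦ (TangentSpace I x →L[ℝ] TangentSpace I x →L[ℝ] ℝ)) x (form x))

variable {I N}

/-- `X` is a smooth vector field. -/
def IsSmoothVectorField (X : (x : N) → TangentSpace I x) : Prop :=
  ContMDiff I I.tangent ∞ (fun x ↦ (⟨x, X x⟩ : TangentBundle I N))

/-- The kernel `{X ∈ Vect N | g(X, -) = 0}` of a degenerate metric `g` is exactly the module of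
smooth vector fields that are vertical for `ρ` (i.e. sections of `ker dρ`). -/
def DegenerateMetric.KernelEqVertical (g : DegenerateMetric I N)
    {E' : Type*} [NormedAddCommGroup E'] [NormedSpace ℝ E']
    {H' : Type*} [TopologicalSpace H'] (I' : ModelWithCorners ℝ E' H')
    {M : Type*} [TopologicalSpace M] [ChartedSpace H' M] (ρ : N → M) : Prop :=
  ∀ X : (x : N) → TangentSpace I x, IsSmoothVectorField X →
    ((∀ x, g.form x (X x) = 0) ↔ ∀ x, mfderiv I I' ρ x (X x) = 0)

/-- At every point, the kernel of the bilinear form `g x` is the vertical space `ker dρ x`. -/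
def DegenerateMetric.PointwiseKernelEqVertical (g : DegenerateMetric I N)
    {E' : Type*} [NormedAddCommGroup E'] [NormedSpace ℝ E']
    {H' : Type*} [TopologicalSpace H'] (I' : ModelWithCorners ℝ E' H')
    {M : Type*} [TopologicalSpace M] [ChartedSpace H' M] (ρ : N → M) : Prop :=
  ∀ (x : N) (v : TangentSpace I x), g.form x v = 0 ↔ mfderiv I I' ρ x v = 0

end TensorsAndFields

section Bundles

variable {EP : Type*} [NormedAddCommGroup EP] [NormedSpace ℝ EP]
  {HP : Type*} [TopologicalSpace HP] (IP : ModelWithCorners ℝ EP HP)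
  {EM : Type*} [NormedAddCommGroup EM] [NormedSpace ℝ EM]
  {HM : Type*} [TopologicalSpace HM] (IM : ModelWithCorners ℝ EM HM)
  {P : Type*} [TopologicalSpace P] [ChartedSpace HP P]
  {M : Type*} [TopologicalSpace M] [ChartedSpace HM M]

/-- `ρ : P → M` is a smooth fibre bundle with typical fibre `ℝ`: around every point of the base
there is a local trivialisation `ρ ⁻¹' U ≃ U × ℝ` that is smooth in both directions. -/
def IsRealFibreBundle (ρ : P → M) : Prop :=
  ∀ x : M, ∃ e : Trivialization ℝ ρ, x ∈ e.baseSet ∧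
    ContMDiffOn IP (IM.prod 𝓘(ℝ, ℝ)) ∞ e e.source ∧
    ContMDiffOn (IM.prod 𝓘(ℝ, ℝ)) IP ∞ e.toOpenPartialHomeomorph.symm e.target

/-- `ρ : P → M` is a principal `ℝˣ`-bundle, for the given action of the Lie group `ℝˣ` on `P`:
`P` is a (Hausdorff, second countable, smooth) manifold, the action is smooth and preserves the
fibres, and around every point of the base there is a smooth `ℝˣ`-equivariant local trivialisation
`ρ ⁻¹' U ≃ U × ℝˣ`. -/
structure IsPrincipalRxBundle [MulAction ℝˣ P] (ρ : P → M) : Prop where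
  t2 : T2Space P
  secondCountable : SecondCountableTopology P
  isManifold : IsManifold IP ∞ P
  smooth_smul : ContMDiff (𝓘(ℝ, ℝ).prod IP) IP ∞ (fun q : ℝˣ × P ↦ q.1 • q.2)
  proj_smul : ∀ (a : ℝˣ) (p : P), ρ (a • p) = ρ p
  locally_trivial : ∀ x : M, ∃ e : Trivialization ℝˣ ρ, x ∈ e.baseSet ∧
    ContMDiffOn IP (IM.prod 𝓘(ℝ, ℝ)) ∞ e e.source ∧
    ContMDiffOn (IM.prod 𝓘(ℝ, ℝ)) IP ∞ e.toOpenPartialHomeomorph.symm e.target ∧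
    ∀ p ∈ e.source, ∀ a : ℝˣ, e (a • p) = ((e p).1, a * (e p).2)

/-- A Carrollian `ℝˣ`-bundle: a principal `ℝˣ`-bundle `ρ : P → M` with a degenerate metric `g` on
the total space whose kernel is the module of vertical vector fields. -/
structure IsCarrollianRxBundle [IsManifold IP ∞ P] [MulAction ℝˣ P] (ρ : P → M)
    (g : DegenerateMetric IP P) : Prop where
  principal : IsPrincipalRxBundle IP IM ρ
  kernel : g.KernelEqVertical IM ρ

end Bundles

section LineBundles

/-- A smooth real line bundle over an `n`-dimensional manifold `B`. -/
structure SmoothLineBundle (n : ℕ) (B : Type*) [TopologicalSpace B]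
    [ChartedSpace (EuclideanSpace ℝ (Fin n)) B] where
  /-- the fibres -/
  Fiber : B → Type
  [addCommGroup : ∀ x, AddCommGroup (Fiber x)]
  [module : ∀ x, Module ℝ (Fiber x)]
  [fiberTopology : ∀ x, TopologicalSpace (Fiber x)]
  [totalTopology : TopologicalSpace (TotalSpace ℝ Fiber)]
  [fiberBundle : FiberBundle ℝ Fiber]
  [vectorBundle : VectorBundle ℝ ℝ Fiber]
  [smoothVectorBundle : ContMDiffVectorBundle ∞ ℝ Fiber (𝓡 n)]

attribute [instance] SmoothLineBundle.addCommGroup SmoothLineBundle.module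
  SmoothLineBundle.fiberTopology SmoothLineBundle.totalTopology SmoothLineBundle.fiberBundle
  SmoothLineBundle.vectorBundle SmoothLineBundle.smoothVectorBundle

namespace SmoothLineBundle

variable {n : ℕ} {B : Type*} [TopologicalSpace B] [ChartedSpace (EuclideanSpace ℝ (Fin n)) B]

/-- The total space of a line bundle. -/
abbrev Total (L : SmoothLineBundle n B) : Type _ := TotalSpace ℝ L.Fiber

/-- The total space with the zero section removed, as an open subset. -/
def punctured (L : SmoothLineBundle n B) : TopologicalSpace.Opens L.Total where
  carrier := {p | p.2 ≠ 0}
  is_open' := by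
    rw [isOpen_iff_mem_nhds]
    intro p hp
    have e_lin : (trivializationAt ℝ L.Fiber p.1).IsLinear ℝ := inferInstance
    have key : ∀ q ∈ (trivializationAt ℝ L.Fiber p.1).source,
        ((trivializationAt ℝ L.Fiber p.1) q).2 ≠ 0 ↔ q.2 ≠ 0 := by
      intro q hq
      have hb : q.1 ∈ (trivializationAt ℝ L.Fiber p.1).baseSet :=
        (trivializationAt ℝ L.Fiber p.1).mem_source.1 hq
      have := ((trivializationAt ℝ L.Fiber p.1).continuousLinearEquivAt ℝ q.1 hb).map_ne_zero_iff
        (x := q.2)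
      simpa using this
    have hsrc : (trivializationAt ℝ L.Fiber p.1).source ∈ 𝓝 p :=
      (trivializationAt ℝ L.Fiber p.1).open_source.mem_nhds
        (FiberBundle.mem_trivializationAt_proj_source)
    have hcont : ContinuousAt (fun q ↦ ((trivializationAt ℝ L.Fiber p.1) q).2) p :=
      continuous_snd.continuousAt.comp
        ((trivializationAt ℝ L.Fiber p.1).continuousAt
          (FiberBundle.mem_trivializationAt_proj_source))
    have hne : ((trivializationAt ℝ L.Fiber p.1) p).2 ≠ 0 :=
      (key p (FiberBundle.mem_trivializationAt_proj_source)).2 hp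
    filter_upwards [hsrc, hcont.eventually_ne hne] with q h1 h2 using (key q h1).1 h2

/-- The bundle projection of the punctured total space. -/
def puncturedProj (L : SmoothLineBundle n B) (p : L.punctured) : B := p.1.1

/-- Fibrewise multiplication by non-zero reals. -/
instance (L : SmoothLineBundle n B) : MulAction ℝˣ L.punctured where
  smul a p := ⟨⟨p.1.1, a • p.1.2⟩, (smul_ne_zero_iff_ne a).2 p.2⟩
  one_smul p := Subtype.ext (TotalSpace.ext rfl (heq_of_eq (one_smul ℝˣ p.1.2)))
  mul_smul a b p := Subtype.ext (TotalSpace.ext rfl (heq_of_eq (mul_smul a b p.1.2)))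

end SmoothLineBundle

end LineBundles

section Carrollian

variable {n : ℕ} {N : Type*} [TopologicalSpace N]
  [ChartedSpace (EuclideanSpace ℝ (Fin (n + 1))) N]
  {M : Type*} [TopologicalSpace M] [ChartedSpace (EuclideanSpace ℝ (Fin n)) M]

/-- `(N, h)` is a simple Carrollian manifold with leaf space projection `ρ : N → M`: the kernel of
`h` is the (regular, rank one) distribution tangent to the fibres of the surjective submersion `ρ`,
the fibres are connected, so that they are the leaves, and no leaf is compact. -/
structure IsSimpleCarrollianManifold [IsManifold (𝓡 (n + 1)) ∞ N]
    (h : DegenerateMetric (𝓡 (n + 1)) N) (ρ : N → M) : Prop where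
  submersion : IsSubmersion (𝓡 (n + 1)) (𝓡 n) ∞ ρ
  surjective : Function.Surjective ρ
  kernel : h.KernelEqVertical (𝓡 n) ρ
  leaf_connected : ∀ y : M, IsConnected (ρ ⁻¹' {y})
  leaf_noncompact : ∀ y : M, ¬ IsCompact (ρ ⁻¹' {y})

variable (n) in
/-- `ι : S → N` is a transversal slice for the foliation by the fibres of `ρ`: an embedded
submanifold of codimension one, transversal to the leaves, that meets each leaf in exactly one
point. -/
structure IsTransversalSlice {S : Type*} [TopologicalSpace S]
    [ChartedSpace (EuclideanSpace ℝ (Fin n)) S] (ρ : N → M) (ι : S → N) : Prop where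
  embedding : IsSmoothEmbedding (𝓡 n) (𝓡 (n + 1)) ∞ ι
  transversal : ∀ (x : S) (v : TangentSpace (𝓡 n) x),
    mfderiv (𝓡 (n + 1)) (𝓡 n) ρ (ι x) (mfderiv (𝓡 n) (𝓡 (n + 1)) ι x v) = 0 → v = 0
  meets_leaf : ∀ y : M, ∃! x : S, ρ (ι x) = y

/-- The degenerate metric `g` on the punctured line bundle is the pullback of `h` along the
composite of the inclusion into the line bundle and `Φ : L → N`. -/
def IsPullbackToPunctured [IsManifold (𝓡 (n + 1)) ∞ N] {S : Type*} [TopologicalSpace S]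
    [ChartedSpace (EuclideanSpace ℝ (Fin n)) S] [IsManifold (𝓡 n) ∞ S]
    (h : DegenerateMetric (𝓡 (n + 1)) N) (L : SmoothLineBundle n S) (Φ : L.Total → N)
    (g : DegenerateMetric ((𝓡 n).prod 𝓘(ℝ, ℝ)) L.punctured) : Prop :=
  ∀ (p : L.punctured) (v w : TangentSpace ((𝓡 n).prod 𝓘(ℝ, ℝ)) p),
    g.form p v w = h.form (Φ p)
      (mfderiv ((𝓡 n).prod 𝓘(ℝ, ℝ)) (𝓡 (n + 1)) (fun p : L.punctured ↦ Φ p) p v)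
      (mfderiv ((𝓡 n).prod 𝓘(ℝ, ℝ)) (𝓡 (n + 1)) (fun p : L.punctured ↦ Φ p) p w)

end Carrollian

/-! The serious point is local triviality: a submersion with connected, non-compact, one-dimensional
fibres is a bundle with fibre `ℝ`. Nothing is assumed about completeness of vertical vector fields,
so a fibre coordinate is built from an order on the leaves instead of from a flow.

Each leaf is a connected non-compact one-manifold and hence has a linear order that is open in the
square of the leaf (`exists_isOpenOrder_univ`): by Zorn's lemma a maximal ordered open piece is
everything, because a piece with an end can be prolonged through it unless it closes up to a circle.
Over the base of one box the orders can be reversed leaf by leaf until they agree there. Coherence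
then spreads along the leaves through overlapping boxes (`FlowBox.exists_isOrientedLeafOrder`),
which makes the order open in the fibre product (`IsOrientedLeafOrder.rel_nhds`).

Given such an order, every box defines a smooth monotone step function, constant above and below the
box. A weighted sum of these over a locally finite family, normalised to vanish on a local section,
is finite near each point, strictly increasing with nonzero derivative along leaves, and unbounded
in both directions. It is thus a diffeomorphism from each leaf to `ℝ`
(`IsOrientedLeafOrder.exists_isFibreCoordinate`), and the implicit function theorem turns it into a
local trivialisation.

Averaging these trivialisations with a partition of unity, after correcting orientations, gives
fibre coordinates that differ only by signs (`IsLineFibration.exists_linearAtlas`). They are the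
cocycle of a line bundle diffeomorphic to `N`. Its zero section is a global section, and it can be
moved to any other section by a fibrewise translation.

For a slice `ι`, transversality makes `ρ ∘ ι` a bijection with invertible derivatives, hence a
diffeomorphism, so the base may be changed from `M` to `S`. Vertical vectors correspond under `Φ`,
and bump functions localise the kernel hypothesis, which speaks only of global vector fields. This
gives the kernel of the pullback on the open subset where the line bundle is punctured. -/

open Set Filter Function Topology

/-! ### Local normal form of a submersion with one-dimensional fibres. -/

section FlowBoxes

/-- A box adapted to a map `q : N → S` with one-dimensional fibres: an open subset of `N` that is
identified with `base × ℝ` by a diffeomorphism whose first component is `q`. -/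
structure FlowBox (E E' : Type*) [NormedAddCommGroup E] [NormedSpace ℝ E]
    [NormedAddCommGroup E'] [NormedSpace ℝ E']
    {N S : Type*} [TopologicalSpace N] [ChartedSpace E N] [TopologicalSpace S] [ChartedSpace E' S]
    (q : N → S) where
  /-- the base of the box -/
  base : Set S
  isOpen_base : IsOpen base
  /-- the box, as a subset of `N` -/
  source : Set N
  isOpen_source : IsOpen source
  /-- the fibre coordinate -/
  coord : N → ℝ
  /-- the parametrisation of the box -/
  map : S × ℝ → N
  proj_mem : ∀ p ∈ source, q p ∈ base
  map_mem : ∀ x ∈ base, ∀ t, map (x, t) ∈ source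
  proj_map : ∀ x ∈ base, ∀ t, q (map (x, t)) = x
  coord_map : ∀ x ∈ base, ∀ t, coord (map (x, t)) = t
  map_coord : ∀ p ∈ source, map (q p, coord p) = p
  contMDiffOn_coord : ContMDiffOn 𝓘(ℝ, E) 𝓘(ℝ, ℝ) ∞ coord source
  contMDiffOn_map : ContMDiffOn (𝓘(ℝ, E').prod 𝓘(ℝ, ℝ)) 𝓘(ℝ, E) ∞ map (base ×ˢ univ)

variable {E E' : Type*} [NormedAddCommGroup E] [NormedSpace ℝ E]
  [NormedAddCommGroup E'] [NormedSpace ℝ E']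
  {N S : Type*} [TopologicalSpace N] [ChartedSpace E N] [TopologicalSpace S] [ChartedSpace E' S]
  {q : N → S}

namespace FlowBox

/-- Reverse the fibre coordinate of a box. -/
def flip (e : FlowBox E E' q) : FlowBox E E' q where
  base := e.base
  isOpen_base := e.isOpen_base
  source := e.source
  isOpen_source := e.isOpen_source
  coord p := - e.coord p
  map z := e.map (z.1, -z.2)
  proj_mem := e.proj_mem
  map_mem x hx t := e.map_mem x hx _
  proj_map x hx t := e.proj_map x hx _
  coord_map x hx t := by simp [e.coord_map x hx]
  map_coord p hp := by simpa using e.map_coord p hp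
  contMDiffOn_coord := by
    have h : ContMDiff 𝓘(ℝ, ℝ) 𝓘(ℝ, ℝ) ∞ (fun t : ℝ ↦ -t) := contDiff_neg.contMDiff
    exact h.comp_contMDiffOn e.contMDiffOn_coord
  contMDiffOn_map := by
    have h : ContMDiff 𝓘(ℝ, ℝ) 𝓘(ℝ, ℝ) ∞ (fun t : ℝ ↦ -t) := contDiff_neg.contMDiff
    exact e.contMDiffOn_map.comp ((contMDiff_fst.prodMk (h.comp contMDiff_snd)).contMDiffOn)
      (fun z hz ↦ ⟨hz.1, mem_univ _⟩)

/-- Shrink the base of a box. -/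
def restrict (hq : Continuous q) (e : FlowBox E E' q) (V : Set S) (hV : IsOpen V) :
    FlowBox E E' q where
  base := e.base ∩ V
  isOpen_base := e.isOpen_base.inter hV
  source := e.source ∩ q ⁻¹' V
  isOpen_source := e.isOpen_source.inter (hV.preimage hq)
  coord := e.coord
  map := e.map
  proj_mem p hp := ⟨e.proj_mem p hp.1, hp.2⟩
  map_mem x hx t := ⟨e.map_mem x hx.1 t, by simpa [e.proj_map x hx.1] using hx.2⟩
  proj_map x hx t := e.proj_map x hx.1 _
  coord_map x hx t := e.coord_map x hx.1 _
  map_coord p hp := e.map_coord p hp.1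
  contMDiffOn_coord := e.contMDiffOn_coord.mono inter_subset_left
  contMDiffOn_map := e.contMDiffOn_map.mono (prod_mono inter_subset_left subset_rfl)

theorem contMDiffAt_coord (e : FlowBox E E' q) {p : N} (hp : p ∈ e.source) :
    ContMDiffAt 𝓘(ℝ, E) 𝓘(ℝ, ℝ) ∞ e.coord p :=
  e.contMDiffOn_coord.contMDiffAt (e.isOpen_source.mem_nhds hp)

theorem contMDiffAt_map (e : FlowBox E E' q) {x : S} (hx : x ∈ e.base) (t : ℝ) :
    ContMDiffAt (𝓘(ℝ, E').prod 𝓘(ℝ, ℝ)) 𝓘(ℝ, E) ∞ e.map (x, t) :=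
  e.contMDiffOn_map.contMDiffAt ((e.isOpen_base.prod isOpen_univ).mem_nhds ⟨hx, mem_univ _⟩)

theorem continuousAt_coord (e : FlowBox E E' q) {p : N} (hp : p ∈ e.source) :
    ContinuousAt e.coord p :=
  (e.contMDiffAt_coord hp).continuousAt

theorem continuousAt_map (e : FlowBox E E' q) {x : S} (hx : x ∈ e.base) (t : ℝ) :
    ContinuousAt e.map (x, t) :=
  (e.contMDiffAt_map hx t).continuousAt

theorem continuous_plaque (e : FlowBox E E' q) {x : S} (hx : x ∈ e.base) :
    Continuous (fun t ↦ e.map (x, t)) :=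
  continuous_iff_continuousAt.2 fun t ↦
    (e.continuousAt_map hx t).comp (f := fun t ↦ (x, t)) (by fun_prop)

theorem contMDiff_plaque (e : FlowBox E E' q) {x : S} (hx : x ∈ e.base) :
    ContMDiff 𝓘(ℝ, ℝ) 𝓘(ℝ, E) ∞ (fun t ↦ e.map (x, t)) := fun t ↦
  (e.contMDiffAt_map hx t).comp t (f := fun t ↦ (x, t)) (contMDiffAt_const.prodMk contMDiffAt_id)

theorem contMDiffAt_section (e : FlowBox E E' q) {x : S} (hx : x ∈ e.base) (t : ℝ) :
    ContMDiffAt 𝓘(ℝ, E') 𝓘(ℝ, E) ∞ (fun y ↦ e.map (y, t)) x :=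
  (e.contMDiffAt_map hx t).comp x (f := fun y ↦ (y, t)) (contMDiffAt_id.prodMk contMDiffAt_const)

theorem continuousAt_section (e : FlowBox E E' q) {x : S} (hx : x ∈ e.base) (t : ℝ) :
    ContinuousAt (fun y ↦ e.map (y, t)) x :=
  (e.contMDiffAt_section hx t).continuousAt

end FlowBox

variable (E E') in
/-- Every point has arbitrarily small boxes, centred at that point. -/
def HasFlowBoxes (q : N → S) : Prop :=
  ∀ p : N, ∀ W ∈ 𝓝 p, ∃ e : FlowBox E E' q, p ∈ e.source ∧ e.source ⊆ W ∧ e.coord p = 0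

/-- A normal form of `q` in charts gives small boxes. -/
theorem exists_flowBox_of_charts {p : N}
    (hq : ContMDiff 𝓘(ℝ, E) 𝓘(ℝ, E') ∞ q)
    (φ : OpenPartialHomeomorph N E) (hφ : φ ∈ IsManifold.maximalAtlas 𝓘(ℝ, E) ∞ N)
    (ψ : OpenPartialHomeomorph S E') (hψ : ψ ∈ IsManifold.maximalAtlas 𝓘(ℝ, E') ∞ S)
    (A : E ≃L[ℝ] E' × ℝ) (hp : p ∈ φ.source) (hsub : φ.source ⊆ q ⁻¹' ψ.source)
    (h : ∀ p' ∈ φ.source, ψ (q p') = (A (φ p')).1) {W : Set N} (hW : W ∈ 𝓝 p) :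
    ∃ e : FlowBox E E' q, p ∈ e.source ∧ e.source ⊆ W ∧ e.coord p = 0 := by
  set c : N → ℝ := fun p' ↦ (A (φ p')).2 with hc
  set K : S × ℝ → N := fun z ↦ φ.symm (A.symm (ψ z.1, z.2)) with hK
  have hKp : ∀ p' ∈ φ.source, K (q p', c p') = p' := by
    intro p' hp'
    simp only [hK, hc]
    rw [h p' hp', Prod.mk.eta, A.symm_apply_apply, φ.left_inv hp']
  -- the domain where the parametrisation is good
  set T : Set (S × ℝ) := {z | z.1 ∈ ψ.source ∧ A.symm (ψ z.1, z.2) ∈ φ.target} with hT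
  have hTnhds : ∀ z ∈ T, T ∈ 𝓝 z := by
    intro z hz
    have h1 : ContinuousAt (fun z : S × ℝ ↦ A.symm (ψ z.1, z.2)) z := by
      refine A.symm.continuous.continuousAt.comp ?_
      exact ((ψ.continuousAt hz.1).comp continuousAt_fst).prodMk continuousAt_snd
    filter_upwards [continuousAt_fst (ψ.open_source.mem_nhds hz.1),
      h1 (φ.open_target.mem_nhds hz.2)] with w h1 h2 using ⟨h1, h2⟩
  have hpT : (q p, c p) ∈ T := by
    refine ⟨hsub hp, ?_⟩
    simp only [hc]
    rw [h p hp, Prod.mk.eta, A.symm_apply_apply]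
    exact φ.map_source hp
  have hKsm : ContMDiffOn (𝓘(ℝ, E').prod 𝓘(ℝ, ℝ)) 𝓘(ℝ, E) ∞ K T := by
    refine (contMDiffOn_symm_of_mem_maximalAtlas hφ).comp ?_ (fun z hz ↦ hz.2)
    have h2 : ContMDiff (𝓘(ℝ, E' × ℝ)) 𝓘(ℝ, E) ∞ A.symm := A.symm.contDiff.contMDiff
    refine h2.comp_contMDiffOn ?_
    rw [modelWithCornersSelf_prod, ← chartedSpaceSelf_prod]
    refine ContMDiffOn.prodMk ?_ contMDiffOn_snd
    exact (contMDiffOn_of_mem_maximalAtlas hψ).comp contMDiffOn_fst (fun z hz ↦ hz.1)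
  have hcsm : ContMDiffOn 𝓘(ℝ, E) 𝓘(ℝ, ℝ) ∞ c φ.source := by
    have h2 : ContMDiff 𝓘(ℝ, E) 𝓘(ℝ, ℝ) ∞ (fun y ↦ (A y).2) :=
      (contDiff_snd.comp A.contDiff).contMDiff
    exact h2.comp_contMDiffOn (contMDiffOn_of_mem_maximalAtlas hφ)
  have hqK : ∀ z ∈ T, q (K z) = z.1 := by
    intro z hz
    have h1 : K z ∈ φ.source := φ.map_target hz.2
    have h2 := h _ h1
    simp only [hK] at h2
    rw [φ.right_inv hz.2, A.apply_symm_apply] at h2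
    exact ψ.injOn (hsub h1) hz.1 h2
  have hcK : ∀ z ∈ T, c (K z) = z.2 := by
    intro z hz
    simp only [hc, hK]
    rw [φ.right_inv hz.2, A.apply_symm_apply]
  have hKW : T ∩ K ⁻¹' W ∈ 𝓝 (q p, c p) := by
    refine inter_mem (hTnhds _ hpT) ?_
    have := (hKsm.contMDiffAt (hTnhds _ hpT)).continuousAt
    exact this (by rwa [hKp p hp])
  obtain ⟨V₀, hV₀, B, hB, hVB⟩ := mem_nhds_prod_iff.1 hKW
  obtain ⟨V, hVV₀, hVo, hpV⟩ := mem_nhds_iff.1 hV₀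
  obtain ⟨δ, hδ, hδB⟩ := Metric.mem_nhds_iff.1 hB
  have hsubT : ∀ x ∈ V, ∀ t ∈ Metric.ball (c p) δ, (x, t) ∈ T ∩ K ⁻¹' W := fun x hx t ht ↦
    hVB ⟨hVV₀ hx, hδB ht⟩
  -- A diffeomorphism of `ℝ` onto the interval of radius `δ` around `c p`, with `0 ↦ c p`. It
  -- stretches the short fibre intervals to whole lines and centres the box at `p`.
  set u := OpenPartialHomeomorph.univBall (c p) δ with hu
  have hut : u.target = Metric.ball (c p) δ := OpenPartialHomeomorph.univBall_target _ hδ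
  have hus : ∀ t, u t ∈ Metric.ball (c p) δ := fun t ↦ by
    rw [← hut]; exact u.map_source (by simp [hu])
  have hcont : ContinuousOn c φ.source := hcsm.continuousOn
  refine ⟨{ base := V
            isOpen_base := hVo
            source := (φ.source ∩ c ⁻¹' Metric.ball (c p) δ) ∩ q ⁻¹' V
            isOpen_source := (hcont.isOpen_inter_preimage φ.open_source Metric.isOpen_ball).inter
              (hVo.preimage hq.continuous)
            coord := fun p' ↦ u.symm (c p')
            map := fun z ↦ K (z.1, u z.2)
            proj_mem := fun p' hp' ↦ hp'.2
            map_mem := ?_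
            proj_map := fun x hx t ↦ hqK _ (hsubT x hx _ (hus t)).1
            coord_map := ?_
            map_coord := ?_
            contMDiffOn_coord := ?_
            contMDiffOn_map := ?_ }, ⟨⟨hp, ?_⟩, hpV⟩, ?_, ?_⟩
  · intro x hx t
    have h1 := hsubT x hx _ (hus t)
    refine ⟨⟨φ.map_target h1.1.2, ?_⟩, ?_⟩
    · rw [mem_preimage, hcK _ h1.1]; exact hus t
    · rw [mem_preimage, hqK _ h1.1]; exact hx
  · intro x hx t
    have h1 := hsubT x hx _ (hus t)
    simp only [hcK _ h1.1]
    exact u.left_inv (by simp [hu])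
  · intro p' hp'
    simp only
    rw [u.right_inv (by rw [hut]; exact hp'.1.2), hKp p' hp'.1.1]
  · have h1 : ContMDiffOn 𝓘(ℝ, ℝ) 𝓘(ℝ, ℝ) ∞ u.symm (Metric.ball (c p) δ) :=
      OpenPartialHomeomorph.contDiffOn_univBall_symm.contMDiffOn
    exact h1.comp (hcsm.mono (fun p' hp' ↦ hp'.1.1)) (fun p' hp' ↦ hp'.1.2)
  · have h1 : ContMDiff 𝓘(ℝ, ℝ) 𝓘(ℝ, ℝ) ∞ u :=
      OpenPartialHomeomorph.contDiff_univBall.contMDiff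
    refine hKsm.comp (contMDiff_fst.prodMk (h1.comp contMDiff_snd)).contMDiffOn ?_
    intro z hz
    exact (hsubT z.1 hz.1 _ (hus z.2)).1
  · simpa using hδ
  · intro p' hp'
    have := (hsubT (q p') hp'.2 _ hp'.1.2).2
    rwa [mem_preimage, hKp p' hp'.1.1] at this
  · simp [hu]

/-- The complement in the normal form of a submersion from dimension `n + 1` to dimension `n` has
dimension one, so it supplies the single fibre coordinate of a box. -/
theorem hasFlowBoxes_of_isSubmersion {n : ℕ}
    {N : Type*} [TopologicalSpace N] [ChartedSpace (EuclideanSpace ℝ (Fin (n + 1))) N]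
    {S : Type*} [TopologicalSpace S] [ChartedSpace (EuclideanSpace ℝ (Fin n)) S]
    {q : N → S} (hq : IsSubmersion (𝓡 (n + 1)) (𝓡 n) ∞ q) :
    HasFlowBoxes (EuclideanSpace ℝ (Fin (n + 1))) (EuclideanSpace ℝ (Fin n)) q := by
  intro p W hW
  have hs := hq.isSubmersionAt p
  have hfin : FiniteDimensional ℝ (EuclideanSpace ℝ (Fin n) × hs.complement) :=
    LinearEquiv.finiteDimensional hs.equiv.toLinearEquiv
  have hfin2 : FiniteDimensional ℝ hs.complement :=
    Module.Finite.of_surjective (LinearMap.snd ℝ (EuclideanSpace ℝ (Fin n)) hs.complement)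
      LinearMap.snd_surjective
  have hdim : Module.finrank ℝ hs.complement = Module.finrank ℝ ℝ := by
    have := hs.equiv.toLinearEquiv.finrank_eq
    rw [Module.finrank_prod] at this
    simp only [finrank_euclideanSpace, Fintype.card_fin, Module.finrank_self] at this ⊢
    omega
  let B : hs.complement ≃L[ℝ] ℝ := ContinuousLinearEquiv.ofFinrankEq hdim
  refine exists_flowBox_of_charts hq.contMDiff hs.domChart hs.domChart_mem_maximalAtlas
    hs.codChart hs.codChart_mem_maximalAtlas
    (hs.equiv.trans ((ContinuousLinearEquiv.refl ℝ _).prodCongr B)) hs.mem_domChart_source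
    hs.isSubmersionAtOfComplement_complement.source_subset_preimage_source ?_ hW
  intro p' hp'
  have hmem : hs.domChart p' ∈ (hs.domChart.extend (𝓡 (n + 1))).target := by
    simpa using hs.domChart.map_source hp'
  have := hs.writtenInCharts hmem
  simp only [comp_apply, OpenPartialHomeomorph.extend_coe, OpenPartialHomeomorph.extend_coe_symm,
    modelWithCornersSelf_coe, modelWithCornersSelf_coe_symm, id_eq] at this
  rw [hs.domChart.left_inv hp'] at this
  exact this

/-- A box through `p` contains a continuous local section through `p`, which lifts a neighbourhood
of `q p` into any given neighbourhood of `p`. -/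
theorem HasFlowBoxes.isOpenMap (hb : HasFlowBoxes E E' q) : IsOpenMap q := by
  rw [isOpenMap_iff_nhds_le]
  intro p W hW
  obtain ⟨e, hp, -, -⟩ := hb p univ univ_mem
  have h1 : ContinuousAt (fun y ↦ e.map (y, e.coord p)) (q p) :=
    e.continuousAt_section (e.proj_mem p hp) _
  have h3 : ∀ᶠ y in 𝓝 (q p), e.map (y, e.coord p) ∈ q ⁻¹' W := by
    refine h1 ?_
    simp only [e.map_coord p hp]
    exact hW
  filter_upwards [h3, e.isOpen_base.mem_nhds (e.proj_mem p hp)] with y hy hyb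
  rwa [mem_preimage, e.proj_map y hyb] at hy

end FlowBoxes

/-! ### Connected non-compact one-manifolds are linearly ordered. -/

section OneManifolds

variable {X : Type*} [TopologicalSpace X]

/-- `R` is (the graph of) a strict total order on the open connected set `A`, open in `X × X`. -/
structure IsOpenOrder (A : Set X) (R : Set (X × X)) : Prop where
  isOpen_dom : IsOpen A
  isPreconnected : IsPreconnected A
  isOpen_rel : IsOpen R
  subset : R ⊆ A ×ˢ A
  irrefl : ∀ a, (a, a) ∉ R
  trans : ∀ a b c, (a, b) ∈ R → (b, c) ∈ R → (a, c) ∈ R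
  total : ∀ a ∈ A, ∀ b ∈ A, a ≠ b → (a, b) ∈ R ∨ (b, a) ∈ R

namespace IsOpenOrder

variable {A : Set X} {R : Set (X × X)}

theorem swap (h : IsOpenOrder A R) : IsOpenOrder A (Prod.swap ⁻¹' R) where
  isOpen_dom := h.isOpen_dom
  isPreconnected := h.isPreconnected
  isOpen_rel := h.isOpen_rel.preimage continuous_swap
  subset _ hz := ⟨(h.subset hz).2, (h.subset hz).1⟩
  irrefl a := h.irrefl a
  trans a b c h1 h2 := h.trans c b a h2 h1
  total a ha b hb hab := (h.total a ha b hb hab).symm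

theorem asymm (h : IsOpenOrder A R) {a b : X} (hab : (a, b) ∈ R) : (b, a) ∉ R := fun hba ↦
  h.irrefl a (h.trans a b a hab hba)

theorem isOpen_Iio (h : IsOpenOrder A R) (a : X) : IsOpen {x | (x, a) ∈ R} :=
  h.isOpen_rel.preimage (by fun_prop : Continuous fun x ↦ (x, a))

theorem isOpen_Ioi (h : IsOpenOrder A R) (a : X) : IsOpen {x | (a, x) ∈ R} :=
  h.isOpen_rel.preimage (by fun_prop : Continuous fun x ↦ (a, x))

/-- Connected sets are order convex: a point `x` between `u` and `v` but outside `C` would split `C`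
into the two nonempty open parts below and above `x`. -/
theorem mem_of_between (h : IsOpenOrder A R) {C : Set X} (hC : IsPreconnected C) (hCA : C ⊆ A)
    {u v x : X} (hu : u ∈ C) (hv : v ∈ C) (hux : (u, x) ∈ R) (hxv : (x, v) ∈ R) : x ∈ C := by
  by_contra hx
  have hdisj : Disjoint {y | (y, x) ∈ R} {y | (x, y) ∈ R} :=
    Set.disjoint_left.2 fun y h1 h2 ↦ h.asymm h1 h2
  have hcov : C ⊆ {y | (y, x) ∈ R} ∪ {y | (x, y) ∈ R} := fun y hy ↦
    h.total y (hCA hy) x (h.subset hux).2 (fun hyx ↦ hx (hyx ▸ hy))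
  rcases hC.subset_or_subset (h.isOpen_Iio x) (h.isOpen_Ioi x) hdisj hcov with h1 | h1
  · exact h.asymm (h1 hv) hxv
  · exact h.asymm (h1 hu) hux

/-- The triangle `s < t` in `J × J` is convex, hence connected, and its image lies in the union of
the disjoint open sets `R` and its transpose. -/
theorem mono_or_anti (h : IsOpenOrder A R) {γ : ℝ → X} (hγ : Continuous γ) (hinj : Injective γ)
    {J : Set ℝ} (hJ : Convex ℝ J) (hJA : ∀ s ∈ J, γ s ∈ A) :
    (∀ s ∈ J, ∀ t ∈ J, s < t → (γ s, γ t) ∈ R) ∨ (∀ s ∈ J, ∀ t ∈ J, s < t → (γ t, γ s) ∈ R) := by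
  have hconv : Convex ℝ ({z : ℝ × ℝ | z.1 < z.2} ∩ J ×ˢ J) := by
    refine Convex.inter ?_ (hJ.prod hJ)
    intro z hz w hw a b ha hb hab
    simp only [mem_ofPred_eq, Prod.fst_add, Prod.smul_fst, smul_eq_mul, Prod.snd_add,
      Prod.smul_snd] at *
    rcases ha.eq_or_lt with rfl | ha'
    · simp only [zero_add] at hab; subst hab; simpa using hw
    · nlinarith
  have hpre := hconv.isPreconnected.image (fun z : ℝ × ℝ ↦ (γ z.1, γ z.2)) (by fun_prop)
  have hdisj : Disjoint R (Prod.swap ⁻¹' R) := Set.disjoint_left.2 fun y h1 h2 ↦ h.asymm h1 h2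
  have hcov : (fun z : ℝ × ℝ ↦ (γ z.1, γ z.2)) '' ({z : ℝ × ℝ | z.1 < z.2} ∩ J ×ˢ J)
      ⊆ R ∪ Prod.swap ⁻¹' R := by
    rintro _ ⟨z, hz, rfl⟩
    exact h.total _ (hJA _ hz.2.1) _ (hJA _ hz.2.2) (fun he ↦ hz.1.ne (hinj he))
  rcases hpre.subset_or_subset h.isOpen_rel h.swap.isOpen_rel hdisj hcov with h1 | h1
  · exact Or.inl fun s hs t ht hst ↦ h1 ⟨(s, t), ⟨hst, hs, ht⟩, rfl⟩
  · exact Or.inr fun s hs t ht hst ↦ h1 ⟨(s, t), ⟨hst, hs, ht⟩, rfl⟩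

end IsOpenOrder

/-- `ψ` parametrises a neighbourhood of the lower end of the ordered set `(A, R)`. -/
structure IsLowerRay (A : Set X) (R : Set (X × X)) (ψ : ℝ → X) : Prop where
  isOpenEmbedding : IsOpenEmbedding ψ
  zero_notMem : ψ 0 ∉ A
  mem : ∀ s ∈ Ioo (0 : ℝ) 2, ψ s ∈ A
  mono : ∀ s ∈ Ioo (0 : ℝ) 2, ∀ t ∈ Ioo (0 : ℝ) 2, s < t → (ψ s, ψ t) ∈ R

namespace IsLowerRay

variable {A : Set X} {R : Set (X × X)} {ψ : ℝ → X}

/-- The ray exhausts the lower end. The points below `ψ 1` missed by the ray form an open set, since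
`ψ '' Icc 0 1` is compact, hence closed. The rest of `A` is open too and contains `ψ 1`, so
connectedness leaves no missed point. -/
theorem mem_image_of_lt [T2Space X] (hr : IsLowerRay A R ψ) (h : IsOpenOrder A R) {a : X}
    (ha : (a, ψ 1) ∈ R) : a ∈ ψ '' Ioo 0 1 := by
  have h1m : (1 : ℝ) ∈ Ioo (0 : ℝ) 2 := by norm_num
  have hclosed : IsClosed (ψ '' Icc 0 1) :=
    (isCompact_Icc.image hr.isOpenEmbedding.continuous).isClosed
  have hUo : IsOpen (ψ '' Ioo 0 2 ∪ {x | (ψ 1, x) ∈ R}) :=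
    (hr.isOpenEmbedding.isOpenMap _ isOpen_Ioo).union (h.isOpen_Ioi _)
  have hVo : IsOpen ({x | (x, ψ 1) ∈ R} \ ψ '' Icc 0 1) := (h.isOpen_Iio _).sdiff hclosed
  have hdisj : Disjoint (ψ '' Ioo 0 2 ∪ {x | (ψ 1, x) ∈ R})
      ({x | (x, ψ 1) ∈ R} \ ψ '' Icc 0 1) := by
    refine Set.disjoint_left.2 ?_
    rintro x (⟨t, ht, rfl⟩ | hx) ⟨h2, h3⟩
    · have : 1 < t := by
        by_contra hle
        exact h3 ⟨t, ⟨ht.1.le, not_lt.1 hle⟩, rfl⟩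
      exact h.asymm h2 (hr.mono 1 h1m t ht this)
    · exact h.asymm h2 hx
  have hcov : A ⊆ (ψ '' Ioo 0 2 ∪ {x | (ψ 1, x) ∈ R}) ∪ ({x | (x, ψ 1) ∈ R} \ ψ '' Icc 0 1) := by
    intro x hx
    by_cases hx1 : x = ψ 1
    · exact Or.inl (Or.inl ⟨1, h1m, hx1.symm⟩)
    rcases h.total x hx _ (hr.mem 1 h1m) hx1 with h2 | h2
    · by_cases hxi : x ∈ ψ '' Icc 0 1
      · obtain ⟨t, ht, rfl⟩ := hxi
        refine Or.inl (Or.inl ⟨t, ⟨lt_of_le_of_ne ht.1 ?_, by linarith [ht.2]⟩, rfl⟩)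
        rintro rfl
        exact hr.zero_notMem hx
      · exact Or.inr ⟨h2, hxi⟩
    · exact Or.inl (Or.inr h2)
  rcases h.isPreconnected.subset_or_subset hUo hVo hdisj hcov with h1 | h1
  · rcases h1 (h.subset ha).1 with ⟨t, ht, rfl⟩ | h2
    · refine ⟨t, ⟨ht.1, ?_⟩, rfl⟩
      by_contra hle
      rcases (not_lt.1 hle).eq_or_lt with rfl | hlt
      · exact h.irrefl _ ha
      · exact h.asymm ha (hr.mono 1 h1m t ht hlt)
    · exact absurd h2 (h.asymm ha)
  · exact absurd (h1 (hr.mem 1 h1m)).1 (h.irrefl _)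

/-- A linear order has only one lower end: the smaller of `ψ 1` and `ψ' 1` lies on the other ray. -/
theorem exists_eq [T2Space X] {ψ' : ℝ → X} (hr : IsLowerRay A R ψ) (hr' : IsLowerRay A R ψ')
    (h : IsOpenOrder A R) : ∃ s ∈ Ioo (0 : ℝ) 2, ∃ t ∈ Ioo (0 : ℝ) 2, ψ s = ψ' t := by
  have h1m : (1 : ℝ) ∈ Ioo (0 : ℝ) 2 := by norm_num
  by_cases he : ψ 1 = ψ' 1
  · exact ⟨1, h1m, 1, h1m, he⟩
  rcases h.total _ (hr.mem 1 h1m) _ (hr'.mem 1 h1m) he with h2 | h2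
  · obtain ⟨t, ht, h3⟩ := hr'.mem_image_of_lt h h2
    exact ⟨1, h1m, t, ⟨ht.1, by linarith [ht.2]⟩, h3.symm⟩
  · obtain ⟨t, ht, h3⟩ := hr.mem_image_of_lt h h2
    exact ⟨t, ⟨ht.1, by linarith [ht.2]⟩, 1, h1m, h3⟩

end IsLowerRay

theorem Topology.IsOpenEmbedding.comp_affine {ψ : ℝ → X} (hψ : IsOpenEmbedding ψ) (d : ℝ) {κ : ℝ}
    (hκ : κ ≠ 0) : IsOpenEmbedding (fun s ↦ ψ (d + κ * s)) :=
  hψ.comp ((Homeomorph.addLeft d).isOpenEmbedding.comp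
    (Homeomorph.mulLeft₀ κ hκ).isOpenEmbedding)

/-- Between a point of an open set and a point outside there is a boundary point of the component
of the first point. -/
theorem exists_affine_boundary {D : Set ℝ} (hD : IsOpen D) {t u : ℝ} (ht : t ∈ D) (hu : u ∉ D) :
    ∃ d κ : ℝ, κ ≠ 0 ∧ d ∉ D ∧ (∀ s ∈ Ioo (0 : ℝ) 2, d + κ * s ∈ D) ∧ d ∈ uIcc t u ∧
      d + 2 * κ = t := by
  -- On the way from `u` to `t` take the last parameter `s` at which the point is outside `D`. That
  -- point is `d`, and `κ` is half of `t - d`, so parameters in `(0, 2)` sweep the open segment from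
  -- `d` to `t`.
  have hcomp : IsCompact (Icc (0 : ℝ) 1 ∩ (fun s ↦ u + s * (t - u)) ⁻¹' Dᶜ) :=
    isCompact_Icc.inter_right (hD.isClosed_compl.preimage (by fun_prop))
  obtain ⟨s, hs, hmax⟩ := hcomp.exists_isGreatest ⟨0, by simp, by simpa using hu⟩
  have hs1 : s ≠ 1 := by
    rintro rfl
    exact hs.2 (by simpa using ht)
  have hs1' : s < 1 := lt_of_le_of_ne hs.1.2 hs1
  have htu : t ≠ u := fun h ↦ hu (h ▸ ht)
  refine ⟨u + s * (t - u), (1 - s) / 2 * (t - u), ?_, hs.2, ?_, ?_, by ring⟩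
  · exact mul_ne_zero (by linarith) (sub_ne_zero.2 htu)
  · intro r hr
    by_contra hn
    have : s + (1 - s) / 2 * r ≤ s := hmax ⟨⟨?_, ?_⟩, ?_⟩
    · nlinarith [hr.1]
    · nlinarith [hr.1, hs.1.1]
    · nlinarith [hr.2]
    · show u + (s + (1 - s) / 2 * r) * (t - u) ∈ Dᶜ
      convert hn using 1
      ring_nf
  · rcases le_total t u with h | h
    · rw [uIcc_of_le h]; constructor <;> nlinarith [hs.1.1, hs.1.2]
    · rw [uIcc_of_ge h]; constructor <;> nlinarith [hs.1.1, hs.1.2]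

/-- Extend an ordered set through its lower end. -/
theorem IsLowerRay.exists_extension [T2Space X] {A : Set X} {R : Set (X × X)} {ψ : ℝ → X}
    (hr : IsLowerRay A R ψ) (h : IsOpenOrder A R) {δ : ℝ} (hδ : 0 < δ)
    (hdisj : ∀ s ∈ Ioc (-δ) 0, ψ s ∉ A) :
    ∃ B S, IsOpenOrder B S ∧ A ⊆ B ∧ R ⊆ S ∧ ¬ B ⊆ A := by
  have h1m : (1 : ℝ) ∈ Ioo (0 : ℝ) 2 := by norm_num
  have hinj := hr.isOpenEmbedding.injective
  set B := A ∪ ψ '' Ioo (-δ) 2 with hB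
  set S : Set (X × X) := R ∪ {z | ∃ s ∈ Ioc (-δ) 0, z.1 = ψ s ∧ z.2 ∈ A} ∪
    {z | ∃ s ∈ Ioc (-δ) 0, ∃ t ∈ Ioc (-δ) 0, s < t ∧ z.1 = ψ s ∧ z.2 = ψ t} with hS
  have hBmem : ∀ b ∈ B, b ∈ A ∨ ∃ s ∈ Ioc (-δ) 0, b = ψ s := by
    rintro b (hb | ⟨s, hs, rfl⟩)
    · exact Or.inl hb
    · rcases le_or_gt s 0 with h0 | h0
      · exact Or.inr ⟨s, ⟨hs.1, h0⟩, rfl⟩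
      · exact Or.inl (hr.mem s ⟨h0, hs.2⟩)
  have hnew : ∀ s ∈ Ioc (-δ) 0, ψ s ∈ B := fun s hs ↦ Or.inr ⟨s, ⟨hs.1, by linarith [hs.2]⟩, rfl⟩
  -- In its defining form (new points below old ones) `S` is not visibly open. Near the junction it
  -- is the order of parameters along `ψ` on `(-δ, 2)`; pairs whose upper point is beyond `ψ 1` form
  -- a product of open sets.
  have hSopen : S = R ∪ (fun z : ℝ × ℝ ↦ (ψ z.1, ψ z.2)) ''
      ({z | z.1 < z.2} ∩ Ioo (-δ) 2 ×ˢ Ioo (-δ) 2) ∪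
      (ψ '' Ioo (-δ) 1) ×ˢ {x | (ψ 1, x) ∈ R} := by
    ext ⟨x, y⟩
    constructor
    · rintro ((hxy | ⟨s, hs, rfl : x = _, hy : y ∈ A⟩) | ⟨s, hs, t, ht, hst, rfl : x = _, rfl : y = _⟩)
      · exact Or.inl (Or.inl hxy)
      · by_cases hy1 : y = ψ 1
        · refine Or.inl (Or.inr ⟨(s, 1), ⟨?_, ⟨hs.1, ?_⟩, ?_, ?_⟩, by rw [hy1]⟩) <;>
            simp only [mem_ofPred_eq] <;> linarith [hs.2]
        rcases h.total y hy _ (hr.mem 1 h1m) hy1 with h2 | h2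
        · obtain ⟨t, ht, rfl⟩ := hr.mem_image_of_lt h h2
          refine Or.inl (Or.inr ⟨(s, t), ⟨?_, ⟨hs.1, ?_⟩, ?_, ?_⟩, rfl⟩) <;>
            simp only [mem_ofPred_eq] <;> linarith [hs.2, ht.1, ht.2]
        · exact Or.inr ⟨⟨s, ⟨hs.1, by linarith [hs.2]⟩, rfl⟩, h2⟩
      · refine Or.inl (Or.inr ⟨(s, t), ⟨hst, ⟨hs.1, ?_⟩, ht.1, ?_⟩, rfl⟩) <;>
            simp only <;> linarith [hs.2, ht.2]
    · rintro ((hxy | ⟨⟨s, t⟩, ⟨hst, hs, ht⟩, he⟩) | ⟨⟨s, hs, rfl : _ = x⟩, hy : (ψ 1, y) ∈ R⟩)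
      · exact Or.inl (Or.inl hxy)
      · simp only [Prod.mk.injEq] at he
        obtain ⟨rfl, rfl⟩ := he
        simp only [mem_ofPred_eq] at hst hs ht
        rcases le_or_gt s 0 with hs0 | hs0
        · rcases le_or_gt t 0 with ht0 | ht0
          · exact Or.inr ⟨s, ⟨hs.1, hs0⟩, t, ⟨ht.1, ht0⟩, hst, rfl, rfl⟩
          · exact Or.inl (Or.inr ⟨s, ⟨hs.1, hs0⟩, rfl, hr.mem t ⟨ht0, ht.2⟩⟩)
        · exact Or.inl (Or.inl (hr.mono s ⟨hs0, hs.2⟩ t ⟨hs0.trans hst, ht.2⟩ hst))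
      · rcases le_or_gt s 0 with hs0 | hs0
        · exact Or.inl (Or.inr ⟨s, ⟨hs.1, hs0⟩, rfl, (h.subset hy).2⟩)
        · exact Or.inl (Or.inl (h.trans _ _ _
            (hr.mono s ⟨hs0, by linarith [hs.2]⟩ 1 h1m hs.2) hy))
  have hp : Ioo (0 : ℝ) 2 ⊆ Ioo (-δ) 2 := fun s hs ↦ ⟨by linarith [hs.1], hs.2⟩
  have h0 : (0 : ℝ) ∈ Ioc (-δ) 0 := ⟨by linarith, le_rfl⟩
  refine ⟨B, S, ⟨?_, ?_, ?_, ?_, ?_, ?_, ?_⟩, subset_union_left,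
    fun z hz ↦ Or.inl (Or.inl hz), fun hsub ↦ hr.zero_notMem (hsub (hnew 0 h0))⟩
  · exact h.isOpen_dom.union (hr.isOpenEmbedding.isOpenMap _ isOpen_Ioo)
  · exact h.isPreconnected.union (ψ 1) (hr.mem 1 h1m) ⟨1, hp h1m, rfl⟩
      (isPreconnected_Ioo.image _ hr.isOpenEmbedding.continuous.continuousOn)
  · rw [hSopen]
    refine (h.isOpen_rel.union ?_).union
      ((hr.isOpenEmbedding.isOpenMap _ isOpen_Ioo).prod (h.isOpen_Ioi _))
    exact (hr.isOpenEmbedding.prodMap hr.isOpenEmbedding).isOpenMap _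
      ((isOpen_lt continuous_fst continuous_snd).inter (isOpen_Ioo.prod isOpen_Ioo))
  · rintro ⟨x, y⟩ ((hxy | ⟨s, hs, rfl : x = _, hy⟩) | ⟨s, hs, t, ht, hst, rfl : x = _, rfl : y = _⟩)
    · exact ⟨Or.inl (h.subset hxy).1, Or.inl (h.subset hxy).2⟩
    · exact ⟨hnew s hs, Or.inl hy⟩
    · exact ⟨hnew s hs, hnew t ht⟩
  · rintro a ((haa | ⟨s, hs, h1 : a = _, hy⟩) | ⟨s, hs, t, ht, hst, h1 : a = _, h2 : a = _⟩)
    · exact h.irrefl a haa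
    · exact hdisj s hs (h1 ▸ hy)
    · exact hst.ne (hinj (h1.symm.trans h2))
  · rintro a b c
      ((hab | ⟨s, hs, h1 : a = _, hb : b ∈ A⟩) | ⟨s, hs, t, ht, hst, h1 : a = _, h2 : b = _⟩)
      ((hbc | ⟨s', hs', h1' : b = _, hc : c ∈ A⟩) |
        ⟨s', hs', t', ht', hst', h1' : b = _, h2' : c = _⟩)
    · exact Or.inl (Or.inl (h.trans _ _ _ hab hbc))
    · exact absurd (h1' ▸ (h.subset hab).2) (hdisj s' hs')
    · exact absurd (h1' ▸ (h.subset hab).2) (hdisj s' hs')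
    · exact Or.inl (Or.inr ⟨s, hs, h1, (h.subset hbc).2⟩)
    · exact absurd (h1' ▸ hb) (hdisj s' hs')
    · exact absurd (h1' ▸ hb) (hdisj s' hs')
    · exact absurd (h2 ▸ (h.subset hbc).1) (hdisj t ht)
    · exact Or.inl (Or.inr ⟨s, hs, h1, hc⟩)
    · have : t = s' := hinj (h2.symm.trans h1')
      exact Or.inr ⟨s, hs, t', ht', by linarith, h1, h2'⟩
  · intro a ha b hb hab
    rcases hBmem a ha with ha | ⟨s, hs, rfl⟩ <;> rcases hBmem b hb with hb | ⟨t, ht, rfl⟩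
    · exact (h.total a ha b hb hab).imp (fun h ↦ Or.inl (Or.inl h)) (fun h ↦ Or.inl (Or.inl h))
    · exact Or.inr (Or.inl (Or.inr ⟨t, ht, rfl, ha⟩))
    · exact Or.inl (Or.inl (Or.inr ⟨s, hs, rfl, hb⟩))
    · rcases lt_trichotomy s t with hst | rfl | hst
      · exact Or.inl (Or.inr ⟨s, hs, t, ht, hst, rfl, rfl⟩)
      · exact absurd rfl hab
      · exact Or.inr (Or.inr ⟨t, ht, s, hs, hst, rfl, rfl⟩)

/-- The hypothesis allows `x` and `y` to be exchanged, so the truth value of `P` is locally constant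
on `A`. -/
theorem IsPreconnected.forall_of_local {A : Set X} (hA : IsPreconnected A) {P : X → Prop}
    (h : ∀ b ∈ A, ∃ C ∈ 𝓝[A] b, ∀ x ∈ C, ∀ y ∈ C, P x → P y) {a : X} (ha : a ∈ A) (hP : P a) :
    ∀ b ∈ A, P b := by
  intro b hb
  refine (hA.induction₂ (fun x y ↦ P x ↔ P y) (fun x hx ↦ ?_) ?_ ?_ ha hb).1 hP
  · obtain ⟨C, hC, h1⟩ := h x hx
    have hxC : x ∈ C := mem_of_mem_nhdsWithin hx hC
    filter_upwards [hC] with y hy using ⟨h1 x hxC y hy, h1 y hy x hxC⟩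
  · exact fun x y z _ _ _ h1 h2 ↦ h1.trans h2
  · exact fun x y _ _ h1 ↦ h1.symm

/-- Order intervals are contained in compact sets. -/
theorem IsOpenOrder.exists_isCompact {A : Set X} {R : Set (X × X)}
    (h : IsOpenOrder A R) (hX : ∀ p : X, ∃ φ : ℝ → X, IsOpenEmbedding φ ∧ φ 0 = p)
    {a b : X} (ha : a ∈ A) (hb : b ∈ A) :
    ∃ K ⊆ A, IsCompact K ∧ ∀ x, (a, x) ∈ R → (x, b) ∈ R → x ∈ K := by
  refine h.isPreconnected.forall_of_local
    (P := fun b ↦ ∃ K ⊆ A, IsCompact K ∧ ∀ x, (a, x) ∈ R → (x, b) ∈ R → x ∈ K) ?_ ha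
    ⟨∅, empty_subset _, isCompact_empty, fun x h1 h2 ↦ absurd h2 (h.asymm h1)⟩ b hb
  intro b hb
  obtain ⟨φ, hφ, rfl⟩ := hX b
  have hpre : φ ⁻¹' A ∈ 𝓝 (0 : ℝ) :=
    hφ.continuous.continuousAt (h.isOpen_dom.mem_nhds hb)
  obtain ⟨ε, hε, hball⟩ := Metric.nhds_basis_closedBall.mem_iff.1 hpre
  rw [Real.closedBall_eq_Icc] at hball
  have hCA : φ '' Icc (0 - ε) (0 + ε) ⊆ A := image_subset_iff.2 hball
  refine ⟨φ '' Icc (0 - ε) (0 + ε), mem_nhdsWithin_of_mem_nhds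
    (hφ.isOpenMap.image_mem_nhds (Icc_mem_nhds (by linarith) (by linarith))), ?_⟩
  rintro b₁ hb₁ b₂ hb₂ ⟨K, hKA, hK, hKb⟩
  refine ⟨K ∪ φ '' Icc (0 - ε) (0 + ε), union_subset hKA hCA,
    hK.union (isCompact_Icc.image hφ.continuous), fun x hax hxb ↦ ?_⟩
  -- A point between `a` and `b₂` is below `b₁`, hence in `K`, or it is `b₁` or between `b₁` and
  -- `b₂`, hence in the chart interval by order convexity.
  by_cases hxb₁ : x = b₁
  · exact Or.inr (hxb₁ ▸ hb₁)
  rcases h.total x (h.subset hax).2 b₁ (hCA hb₁) hxb₁ with h1 | h1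
  · exact Or.inl (hKb x hax h1)
  · exact Or.inr (h.mem_of_between (isPreconnected_Icc.image _ hφ.continuous.continuousOn) hCA
      hb₁ hb₂ h1 hxb)

/-- If an ordered set has a lower end, it can be extended, unless the space is compact. -/
theorem IsLowerRay.exists_larger [T2Space X] [ConnectedSpace X] [NoncompactSpace X]
    {A : Set X} {R : Set (X × X)} {ψ : ℝ → X}
    (hr : IsLowerRay A R ψ) (h : IsOpenOrder A R)
    (hX : ∀ p : X, ∃ φ : ℝ → X, IsOpenEmbedding φ ∧ φ 0 = p) :
    ∃ B S, IsOpenOrder B S ∧ A ⊆ B ∧ R ⊆ S ∧ ¬ B ⊆ A := by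
  have h1m : (1 : ℝ) ∈ Ioo (0 : ℝ) 2 := by norm_num
  by_cases hδ : ∃ δ > 0, ∀ s ∈ Ioc (-δ) 0, ψ s ∉ A
  · obtain ⟨δ, hδ, hdisj⟩ := hδ
    exact hr.exists_extension h hδ hdisj
  -- Now `ψ` returns to `A` at arbitrarily small negative parameters. The end of `A` met there is
  -- shown to be the upper one, so `ψ 0` closes `A` up to a circle, which is compact and open and
  -- therefore all of `X`.
  exfalso
  push Not at hδ
  have hDo : IsOpen (ψ ⁻¹' A) := h.isOpen_dom.preimage hr.isOpenEmbedding.continuous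
  have hinj := hr.isOpenEmbedding.injective
  -- every other end inside the range of `ψ` on the negative side is an upper end
  have key : ∀ t₁ < 0, ψ t₁ ∈ A → ∃ d κ : ℝ, t₁ < d ∧ d ≤ 0 ∧ κ < 0 ∧ d + 2 * κ = t₁ ∧
      IsLowerRay A (Prod.swap ⁻¹' R) (fun s ↦ ψ (d + κ * s)) := by
    intro t₁ ht₁ ht₁A
    obtain ⟨d, κ, hκ, hd, hmem, hdI, hdt⟩ :=
      exists_affine_boundary hDo (t := t₁) (u := 0) ht₁A hr.zero_notMem
    rw [uIcc_of_le ht₁.le] at hdI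
    have hκ' : κ < 0 := lt_of_le_of_ne (by linarith [hdI.1]) hκ
    refine ⟨d, κ, by linarith, hdI.2, hκ', hdt, ?_⟩
    have hemb := hr.isOpenEmbedding.comp_affine d hκ
    have hd0 : ψ (d + κ * 0) ∉ A := by rw [mul_zero, add_zero]; exact hd
    rcases h.mono_or_anti hemb.continuous hemb.injective (convex_Ioo (0 : ℝ) 2) hmem with h1 | h1
    · exfalso
      -- Two lower rays have a common point, but these two use parameters of opposite sign of the
      -- injective `ψ`.
      obtain ⟨s, hs, t, ht, hst⟩ := hr.exists_eq ⟨hemb, hd0, hmem, h1⟩ h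
      have := hinj hst
      nlinarith [hs.1, ht.1, hdI.2]
    · exact ⟨hemb, hd0, hmem, h1⟩
  obtain ⟨t₁, ht₁, ht₁A⟩ := hδ 1 one_pos
  have ht₁0 : t₁ < 0 := lt_of_le_of_ne ht₁.2 (fun h0 ↦ hr.zero_notMem (h0 ▸ ht₁A))
  obtain ⟨d, κ, htd, hd0, hκ, hdκ, hray⟩ := key t₁ ht₁0 ht₁A
  -- If `d < 0`, a return between `d` and `0` would give a second upper ray, disjoint from the
  -- first; there is only one upper end.
  have hd : d = 0 := by
    by_contra hd
    have hd' : d < 0 := lt_of_le_of_ne hd0 hd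
    obtain ⟨t₂, ht₂, ht₂A⟩ := hδ (-d) (by linarith)
    have ht₂0 : t₂ < 0 := lt_of_le_of_ne ht₂.2 (fun h0 ↦ hr.zero_notMem (h0 ▸ ht₂A))
    obtain ⟨d₂, κ₂, htd₂, hd₂0, hκ₂, hdκ₂, hray₂⟩ := key t₂ ht₂0 ht₂A
    obtain ⟨s, hs, t, ht, hst⟩ := hray.exists_eq hray₂ h.swap
    have := hinj hst
    have h1 : d + κ * s < d := by nlinarith [hs.1]
    have h2 : t₂ < d₂ + κ₂ * t := by nlinarith [ht.2]
    linarith [ht₂.1]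
  subst hd
  obtain ⟨K, hKA, hK, hKb⟩ := h.exists_isCompact hX (hr.mem 1 h1m) (hray.mem 1 h1m)
  have hcomp : IsCompact (ψ '' Icc κ 1 ∪ K) :=
    (isCompact_Icc.image hr.isOpenEmbedding.continuous).union hK
  have hneg : ∀ s ∈ Ioo t₁ 0, ψ s ∈ A := by
    intro s hs
    have := hray.mem (s / κ) ⟨div_pos_of_neg_of_neg hs.2 hκ, by
      rw [div_lt_iff_of_neg hκ]; linarith [hs.1]⟩
    have he : 0 + κ * (s / κ) = s := by rw [zero_add, mul_div_cancel₀ s hκ.ne]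
    simpa only [he] using this
  -- The left side is compact and the right side is open. The arc `ψ '' Icc κ 1` passes through `ψ
  -- 0` and covers both ends of `A`; `K` covers the order interval from `ψ 1` to `ψ κ`.
  have hAeq : ψ '' Icc κ 1 ∪ K = A ∪ ψ '' Ioo t₁ 2 := by
    apply Subset.antisymm
    · rintro x (⟨s, hs, rfl⟩ | hx)
      · exact Or.inr ⟨s, ⟨by linarith [hs.1], by linarith [hs.2]⟩, rfl⟩
      · exact Or.inl (hKA hx)
    · have hA : A ⊆ ψ '' Icc κ 1 ∪ K := by
        intro x hx
        by_cases hx1 : x = ψ 1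
        · exact Or.inl ⟨1, ⟨by linarith, le_rfl⟩, hx1.symm⟩
        rcases h.total x hx _ (hr.mem 1 h1m) hx1 with h2 | h2
        · obtain ⟨s, hs, rfl⟩ := hr.mem_image_of_lt h h2
          exact Or.inl ⟨s, ⟨by linarith [hs.1], hs.2.le⟩, rfl⟩
        by_cases hx2 : x = ψ (0 + κ * 1)
        · exact Or.inl ⟨0 + κ * 1, ⟨by linarith, by linarith⟩, hx2.symm⟩
        rcases h.total x hx _ (hray.mem 1 h1m) hx2 with h3 | h3
        · exact Or.inr (hKb x h2 h3)
        · obtain ⟨s, hs, rfl⟩ := hray.mem_image_of_lt h.swap h3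
          exact Or.inl ⟨_, ⟨by nlinarith [hs.2], by nlinarith [hs.1]⟩, rfl⟩
      refine union_subset hA ?_
      rintro _ ⟨s, hs, rfl⟩
      rcases lt_trichotomy s 0 with h0 | rfl | h0
      · exact hA (hneg s ⟨hs.1, h0⟩)
      · exact Or.inl ⟨0, ⟨hκ.le, zero_le_one⟩, rfl⟩
      · exact hA (hr.mem s ⟨h0, hs.2⟩)
  have hopen : IsOpen (ψ '' Icc κ 1 ∪ K) := by
    rw [hAeq]
    exact h.isOpen_dom.union (hr.isOpenEmbedding.isOpenMap _ isOpen_Ioo)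
  have huniv : ψ '' Icc κ 1 ∪ K = univ :=
    IsClopen.eq_univ ⟨hcomp.isClosed, hopen⟩ ⟨ψ 1, Or.inl ⟨1, ⟨by linarith, le_rfl⟩, rfl⟩⟩
  exact noncompact_univ X (huniv ▸ hcomp)

/-- A nonempty open proper subset of a connected space is not closed. A chart at a boundary point
yields a ray entering `A`, which is a lower ray after possibly reversing the order. -/
theorem IsOpenOrder.exists_larger [T2Space X] [ConnectedSpace X] [NoncompactSpace X]
    {A : Set X} {R : Set (X × X)} (h : IsOpenOrder A R) (hne : A.Nonempty) (hA : A ≠ univ)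
    (hX : ∀ p : X, ∃ φ : ℝ → X, IsOpenEmbedding φ ∧ φ 0 = p) :
    ∃ B S, IsOpenOrder B S ∧ A ⊆ B ∧ R ⊆ S ∧ ¬ B ⊆ A := by
  have hcl : ∃ p ∈ closure A, p ∉ A := by
    by_contra hcl
    push Not at hcl
    exact hA (IsClopen.eq_univ ⟨closure_subset_iff_isClosed.1 hcl, h.isOpen_dom⟩ hne)
  obtain ⟨p, hp, hpA⟩ := hcl
  obtain ⟨φ, hφ, rfl⟩ := hX p
  obtain ⟨_, ⟨t, rfl⟩, htA⟩ := mem_closure_iff.1 hp _ hφ.isOpen_range ⟨0, rfl⟩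
  obtain ⟨d, κ, hκ, hd, hmem, -, -⟩ :=
    exists_affine_boundary (h.isOpen_dom.preimage hφ.continuous) (t := t) (u := 0) htA hpA
  have hemb := hφ.comp_affine d hκ
  have hd0 : φ (d + κ * 0) ∉ A := by rw [mul_zero, add_zero]; exact hd
  rcases h.mono_or_anti hemb.continuous hemb.injective (convex_Ioo (0 : ℝ) 2) hmem with h1 | h1
  · exact IsLowerRay.exists_larger ⟨hemb, hd0, hmem, h1⟩ h hX
  · obtain ⟨B, S, hBS, hAB, hRS, hne⟩ :=
      IsLowerRay.exists_larger (R := Prod.swap ⁻¹' R) ⟨hemb, hd0, hmem, h1⟩ h.swap hX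
    exact ⟨B, Prod.swap ⁻¹' S, hBS.swap, hAB, fun z hz ↦ hRS hz, hne⟩

/-- A connected non-compact Hausdorff one-dimensional manifold carries an open linear order. -/
theorem exists_isOpenOrder_univ [T2Space X] [ConnectedSpace X] [NoncompactSpace X]
    (hX : ∀ p : X, ∃ φ : ℝ → X, IsOpenEmbedding φ ∧ φ 0 = p) :
    ∃ R : Set (X × X), IsOpenOrder univ R := by
  obtain ⟨p⟩ : Nonempty X := inferInstance
  obtain ⟨φ, hφ, -⟩ := hX p
  have hstart : IsOpenOrder (range φ) ((fun z : ℝ × ℝ ↦ (φ z.1, φ z.2)) '' {z | z.1 < z.2}) := by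
    refine ⟨hφ.isOpen_range, isPreconnected_range hφ.continuous, ?_, ?_, ?_, ?_, ?_⟩
    · exact (hφ.prodMap hφ).isOpenMap _ (isOpen_lt continuous_fst continuous_snd)
    · rintro _ ⟨z, -, rfl⟩
      exact ⟨⟨_, rfl⟩, ⟨_, rfl⟩⟩
    · rintro _ ⟨z, hz, he⟩
      simp only [Prod.mk.injEq] at he
      exact (show z.1 < z.2 from hz).ne (hφ.injective (he.1.trans he.2.symm))
    · rintro a b c ⟨z, hz, he⟩ ⟨w, hw, hf⟩
      simp only [Prod.mk.injEq] at he hf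
      have : z.2 = w.1 := hφ.injective (he.2.trans hf.1.symm)
      refine ⟨(z.1, w.2), ?_, by simp [he.1, hf.2]⟩
      simp only [mem_ofPred_eq] at hz hw ⊢
      linarith
    · rintro _ ⟨s, rfl⟩ _ ⟨t, rfl⟩ hst
      rcases lt_trichotomy s t with h | rfl | h
      · exact Or.inl ⟨(s, t), h, rfl⟩
      · exact absurd rfl hst
      · exact Or.inr ⟨(t, s), h, rfl⟩
  -- Zorn's lemma for pairs `(A, R)` under inclusion in both components. Any two members of a chain
  -- lie in a common one, so the order axioms pass to the union.
  set T := {z : Set X × Set (X × X) | IsOpenOrder z.1 z.2 ∧ z.1.Nonempty} with hT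
  have hz : ∀ c ⊆ T, IsChain (· ≤ ·) c → ∀ y ∈ c, ∃ ub ∈ T, ∀ z ∈ c, z ≤ ub := by
    intro c hc hchain y hy
    have hle : ∀ z ∈ c, ∀ w ∈ c, ∃ v ∈ c, z ≤ v ∧ w ≤ v := by
      intro z hz w hw
      rcases hchain.total hz hw with h | h
      · exact ⟨w, hw, h, le_rfl⟩
      · exact ⟨z, hz, le_rfl, h⟩
    refine ⟨(⋃ z ∈ c, z.1, ⋃ z ∈ c, z.2), ⟨⟨?_, ?_, ?_, ?_, ?_, ?_, ?_⟩, ?_⟩, ?_⟩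
    · exact isOpen_biUnion fun z hz ↦ (hc hz).1.isOpen_dom
    · obtain ⟨x₀, hx₀⟩ := (hc hy).2
      refine isPreconnected_of_forall_pair ?_
      intro a ha b hb
      simp only [mem_iUnion] at ha hb
      obtain ⟨z, hz, haz⟩ := ha
      obtain ⟨w, hw, hbw⟩ := hb
      obtain ⟨v, hv, hzv, hwv⟩ := hle z hz w hw
      exact ⟨v.1, subset_biUnion_of_mem (u := fun z : Set X × Set (X × X) ↦ z.1) hv,
        hzv.1 haz, hwv.1 hbw, (hc hv).1.isPreconnected⟩
    · exact isOpen_biUnion fun z hz ↦ (hc hz).1.isOpen_rel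
    · intro x hx
      simp only [mem_iUnion] at hx
      obtain ⟨z, hz, hxz⟩ := hx
      have := (hc hz).1.subset hxz
      exact ⟨mem_biUnion hz this.1, mem_biUnion hz this.2⟩
    · intro a ha
      simp only [mem_iUnion] at ha
      obtain ⟨z, hz, haz⟩ := ha
      exact (hc hz).1.irrefl a haz
    · intro a b d hab hbd
      simp only [mem_iUnion] at hab hbd
      obtain ⟨z, hz, haz⟩ := hab
      obtain ⟨w, hw, hbw⟩ := hbd
      obtain ⟨v, hv, hzv, hwv⟩ := hle z hz w hw
      exact mem_biUnion hv ((hc hv).1.trans a b d (hzv.2 haz) (hwv.2 hbw))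
    · intro a ha b hb hab
      simp only [mem_iUnion] at ha hb
      obtain ⟨z, hz, haz⟩ := ha
      obtain ⟨w, hw, hbw⟩ := hb
      obtain ⟨v, hv, hzv, hwv⟩ := hle z hz w hw
      exact ((hc hv).1.total a (hzv.1 haz) b (hwv.1 hbw) hab).imp
        (fun h ↦ mem_biUnion hv h) (fun h ↦ mem_biUnion hv h)
    · obtain ⟨x₀, hx₀⟩ := (hc hy).2
      exact ⟨x₀, mem_biUnion hy hx₀⟩
    · intro z hz
      exact ⟨subset_biUnion_of_mem (u := fun z : Set X × Set (X × X) ↦ z.1) hz,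
        subset_biUnion_of_mem (u := fun z : Set X × Set (X × X) ↦ z.2) hz⟩
  obtain ⟨m, -, hmax⟩ := zorn_le_nonempty₀ T hz
    (range φ, (fun z : ℝ × ℝ ↦ (φ z.1, φ z.2)) '' {z | z.1 < z.2}) ⟨hstart, range_nonempty φ⟩
  by_cases hu : m.1 = univ
  · exact ⟨m.2, hu ▸ hmax.1.1⟩
  · obtain ⟨B, S, hBS, hAB, hRS, hn⟩ := hmax.1.1.exists_larger hmax.1.2 hu hX
    exact absurd (hmax.2 (y := (B, S)) ⟨hBS, hmax.1.2.mono hAB⟩ ⟨hAB, hRS⟩).1 hn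

end OneManifolds

/-! ### Fibrewise orders and their coherence across leaves. -/

section LeafOrders

/-- A strict total order on each fibre of `q`, open along each fibre. -/
structure IsLeafOrder {N S : Type*} [TopologicalSpace N] (q : N → S) (r : N → N → Prop) :
    Prop where
  proj_eq : ∀ {p p'}, r p p' → q p = q p'
  irrefl : ∀ p, ¬ r p p
  trans : ∀ {p p' p''}, r p p' → r p' p'' → r p p''
  total : ∀ {p p'}, q p = q p' → p ≠ p' → r p p' ∨ r p' p
  leaf_open : ∀ {p p'}, r p p' → ∃ W ∈ 𝓝 p, ∃ W' ∈ 𝓝 p', ∀ w ∈ W, ∀ w' ∈ W',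
    q w = q p → q w' = q p → r w w'

namespace IsLeafOrder

variable {N S : Type*} [TopologicalSpace N] {q : N → S} {r : N → N → Prop}

theorem asymm (h : IsLeafOrder q r) {p p' : N} (hp : r p p') : ¬ r p' p := fun h' ↦
  h.irrefl p (h.trans hp h')

theorem isOpen_comp (h : IsLeafOrder q r) {Y : Type*} [TopologicalSpace Y] {γ γ' : Y → N}
    (hγ : Continuous γ) (hγ' : Continuous γ') {x : S} (hx : ∀ y, q (γ y) = x)
    (hx' : ∀ y, q (γ' y) = x) : IsOpen {y | r (γ y) (γ' y)} := by
  rw [isOpen_iff_mem_nhds]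
  intro y hy
  obtain ⟨W, hW, W', hW', hWW⟩ := h.leaf_open hy
  filter_upwards [hγ.continuousAt hW, hγ'.continuousAt hW'] with z hz hz'
  exact hWW _ hz _ hz' (by rw [hx, hx]) (by rw [hx', hx])

end IsLeafOrder

variable {E E' : Type*} [NormedAddCommGroup E] [NormedSpace ℝ E]
  [NormedAddCommGroup E'] [NormedSpace ℝ E']
  {N S : Type*} [TopologicalSpace N] [ChartedSpace E N] [TopologicalSpace S] [ChartedSpace E' S]
  {q : N → S}

/-- Plaques are charts of the leaves in their subspace topology, so each leaf can be ordered by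
itself. The choices on different leaves are unrelated at this stage. -/
theorem exists_isLeafOrder [T2Space N] (hb : HasFlowBoxes E E' q)
    (hconn : ∀ x, IsConnected (q ⁻¹' {x})) (hnc : ∀ x, ¬ IsCompact (q ⁻¹' {x})) :
    ∃ r, IsLeafOrder q r := by
  have hR : ∀ x, ∃ R : Set (q ⁻¹' {x} × q ⁻¹' {x}), IsOpenOrder univ R := by
    intro x
    have h1 : ConnectedSpace (q ⁻¹' {x}) := isConnected_iff_connectedSpace.1 (hconn x)
    have h2 : NoncompactSpace (q ⁻¹' {x}) := by
      rw [← not_compactSpace_iff, ← isCompact_iff_compactSpace]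
      exact hnc x
    refine exists_isOpenOrder_univ ?_
    rintro ⟨p, rfl : q p = x⟩
    obtain ⟨e, hp, -, hp0⟩ := hb p univ univ_mem
    have hx := e.proj_mem p hp
    refine ⟨fun t ↦ ⟨e.map (q p, t), e.proj_map _ hx t⟩, ?_, Subtype.ext ?_⟩
    · refine .of_continuous_injective_isOpenMap ((e.continuous_plaque hx).subtype_mk _) ?_ ?_
      · intro s t hst
        have := congrArg (fun z ↦ e.coord z.1) hst
        simpa only [e.coord_map _ hx] using this
      · intro V hV
        -- The box meets the leaf in exactly one plaque, so the image of `V` is the trace of this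
        -- open set on the leaf.
        have h3 : IsOpen (e.source ∩ e.coord ⁻¹' V) :=
          e.contMDiffOn_coord.continuousOn.isOpen_inter_preimage e.isOpen_source hV
        convert h3.preimage (continuous_subtype_val (p := fun y ↦ y ∈ q ⁻¹' {q p})) using 1
        ext ⟨w, hw : q w = q p⟩
        constructor
        · rintro ⟨t, ht, he⟩
          have he' : e.map (q p, t) = w := congrArg Subtype.val he
          subst he'
          exact ⟨e.map_mem _ hx t, by simpa [e.coord_map _ hx] using ht⟩
        · rintro ⟨h4, h5⟩
          refine ⟨e.coord w, h5, Subtype.ext ?_⟩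
          have := e.map_coord w h4
          rwa [hw] at this
    · simp only
      rw [← hp0]
      exact e.map_coord p hp
  choose R hR using hR
  refine ⟨fun p p' ↦ ∃ x, ∃ hp : q p = x, ∃ hp' : q p' = x, (⟨p, hp⟩, ⟨p', hp'⟩) ∈ R x,
    ?_, ?_, ?_, ?_, ?_⟩
  · rintro p p' ⟨x, hp, hp', -⟩
    exact hp.trans hp'.symm
  · rintro p ⟨x, hp, hp', h⟩
    exact (hR x).irrefl _ h
  · rintro p p' p'' ⟨x, hp, hp', h⟩ ⟨y, hy, hy', h'⟩
    obtain rfl : x = y := hp'.symm.trans hy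
    exact ⟨x, hp, hy', (hR x).trans _ _ _ h h'⟩
  · intro p p' he hne
    rcases (hR (q p)).total ⟨p, rfl⟩ trivial ⟨p', he.symm⟩ trivial
      (fun h ↦ hne (congrArg Subtype.val h)) with h | h
    · exact Or.inl ⟨q p, rfl, he.symm, h⟩
    · exact Or.inr ⟨q p, he.symm, rfl, h⟩
  · rintro p p' ⟨x, rfl, hp', h⟩
    obtain ⟨T, hT, T', hT', hTT⟩ := mem_nhds_prod_iff.1 ((hR _).isOpen_rel.mem_nhds h)
    obtain ⟨W, hW, hWT⟩ := mem_nhds_subtype _ _ _ |>.1 hT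
    obtain ⟨W', hW', hWT'⟩ := mem_nhds_subtype _ _ _ |>.1 hT'
    exact ⟨W, hW, W', hW', fun w hw w' hw' he he' ↦ ⟨q p, he, he',
      hTT ⟨@hWT ⟨w, he⟩ hw, @hWT' ⟨w', he'⟩ hw'⟩⟩⟩

namespace FlowBox

variable {r : N → N → Prop}

/-- The order `r` increases with the coordinate of the box, over `x`. -/
def Increasing (r : N → N → Prop) (e : FlowBox E E' q) (x : S) : Prop :=
  ∀ s t, s < t → r (e.map (x, s)) (e.map (x, t))

/-- The connected triangle `s < t` again decides between the two directions, here separately on each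
plaque. -/
theorem increasing_or_flip (h : IsLeafOrder q r) (e : FlowBox E E' q) {x : S} (hx : x ∈ e.base) :
    e.Increasing r x ∨ e.flip.Increasing r x := by
  have hc := e.continuous_plaque hx
  have hconv : Convex ℝ {z : ℝ × ℝ | z.1 < z.2} := by
    intro z hz w hw a b ha hb hab
    simp only [mem_ofPred_eq, Prod.fst_add, Prod.smul_fst, smul_eq_mul, Prod.snd_add,
      Prod.smul_snd] at *
    rcases ha.eq_or_lt with rfl | ha'
    · simp only [zero_add] at hab; subst hab; simpa using hw
    · nlinarith
  have ho : IsOpen {z : ℝ × ℝ | r (e.map (x, z.1)) (e.map (x, z.2))} :=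
    h.isOpen_comp (hc.comp continuous_fst) (hc.comp continuous_snd)
      (fun _ ↦ e.proj_map x hx _) (fun _ ↦ e.proj_map x hx _)
  have ho' : IsOpen {z : ℝ × ℝ | r (e.map (x, z.2)) (e.map (x, z.1))} :=
    h.isOpen_comp (hc.comp continuous_snd) (hc.comp continuous_fst)
      (fun _ ↦ e.proj_map x hx _) (fun _ ↦ e.proj_map x hx _)
  have hcov : {z : ℝ × ℝ | z.1 < z.2} ⊆ {z : ℝ × ℝ | r (e.map (x, z.1)) (e.map (x, z.2))} ∪
      {z : ℝ × ℝ | r (e.map (x, z.2)) (e.map (x, z.1))} := by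
    intro z hz
    refine h.total (by rw [e.proj_map x hx, e.proj_map x hx]) (fun he ↦ ?_)
    have := congrArg e.coord he
    rw [e.coord_map x hx, e.coord_map x hx] at this
    exact (show z.1 < z.2 from hz).ne this
  rcases hconv.isPreconnected.subset_or_subset ho ho'
    (Set.disjoint_left.2 fun z h1 h2 ↦ h.asymm h1 h2) hcov with h1 | h1
  · exact Or.inl fun s t hst ↦ h1 (show (s, t) ∈ {z : ℝ × ℝ | z.1 < z.2} from hst)
  · exact Or.inr fun s t hst ↦ h1 (show (-t, -s) ∈ {z : ℝ × ℝ | z.1 < z.2} from neg_lt_neg hst)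

theorem rel_iff (h : IsLeafOrder q r) {e : FlowBox E E' q} {x : S} (hi : e.Increasing r x)
    {s t : ℝ} : r (e.map (x, s)) (e.map (x, t)) ↔ s < t := by
  refine ⟨fun hr ↦ ?_, hi s t⟩
  by_contra hle
  rcases (not_lt.1 hle).eq_or_lt with rfl | hlt
  · exact h.irrefl _ hr
  · exact h.asymm hr (hi t s hlt)

theorem rel_iff_coord (h : IsLeafOrder q r) {e : FlowBox E E' q} {p p' : N} (hp : p ∈ e.source)
    (hp' : p' ∈ e.source) (he : q p = q p') (hi : e.Increasing r (q p)) :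
    r p p' ↔ e.coord p < e.coord p' := by
  rw [← rel_iff h hi, e.map_coord p hp, he, e.map_coord p' hp']

/-- The plaques of a box are order convex. -/
theorem mem_source_of_between (h : IsLeafOrder q r) (e : FlowBox E E' q) {u v p : N}
    (hu : u ∈ e.source) (hv : v ∈ e.source) (hup : r u p) (hpv : r p v) : p ∈ e.source := by
  by_contra hp
  have hx := e.proj_mem u hu
  have hqp : q p = q u := (h.proj_eq hup).symm
  have hqv : q v = q u := by rw [← hqp, ← h.proj_eq hpv]
  have hc := e.continuous_plaque hx
  have hdisj : Disjoint {t | r (e.map (q u, t)) p} {t | r p (e.map (q u, t))} :=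
    Set.disjoint_left.2 fun z h1 h2 ↦ h.asymm h1 h2
  have hcov : univ ⊆ {t | r (e.map (q u, t)) p} ∪ {t | r p (e.map (q u, t))} := fun t _ ↦
    h.total (by rw [e.proj_map _ hx, hqp]) (fun he ↦ hp (he ▸ e.map_mem _ hx t))
  rcases isPreconnected_univ.subset_or_subset
    (h.isOpen_comp hc continuous_const (x := q u) (fun _ ↦ e.proj_map _ hx _) (fun _ ↦ hqp))
    (h.isOpen_comp continuous_const hc (x := q u) (fun _ ↦ hqp) (fun _ ↦ e.proj_map _ hx _))
    hdisj hcov with h1 | h1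
  · have h2 : r (e.map (q u, e.coord v)) p := h1 (mem_univ _)
    rw [← hqv, e.map_coord v hv] at h2
    exact h.asymm h2 hpv
  · have h2 : r p (e.map (q u, e.coord u)) := h1 (mem_univ _)
    rw [e.map_coord u hu] at h2
    exact h.asymm h2 hup

end FlowBox

/-- A property that propagates along plaques holds on whole fibres. -/
theorem HasFlowBoxes.leaf_induction {x : S}
    (hconn : IsPreconnected (q ⁻¹' {x})) {P : N → Prop}
    (h : ∀ p, q p = x → ∃ e : FlowBox E E' q, p ∈ e.source ∧ ∀ p₁ ∈ e.source, ∀ p₂ ∈ e.source,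
      q p₁ = x → q p₂ = x → P p₁ → P p₂) {p₀ : N} (hp₀ : q p₀ = x) (hP : P p₀) {p : N}
    (hp : q p = x) : P p := by
  refine hconn.forall_of_local (fun b hb ↦ ?_) hp₀ hP p hp
  obtain ⟨e, hbe, he⟩ := h b hb
  refine ⟨e.source ∩ q ⁻¹' {x}, inter_mem (mem_nhdsWithin_of_mem_nhds
    (e.isOpen_source.mem_nhds hbe)) self_mem_nhdsWithin, ?_⟩
  exact fun p₁ h₁ p₂ h₂ ↦ he p₁ h₁.1 p₂ h₂.1 h₁.2 h₂.2

/-- The box `e` is compatible with the fibrewise order `r`. -/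
def FlowBox.Adapted (r : N → N → Prop) (e : FlowBox E E' q) : Prop :=
  ∀ x ∈ e.base, e.Increasing r x

/-- One comparison of two points on a plaque decides the direction of `e` on that leaf. With both
points in `e` and `e₁` near `p₁`, the adapted box `e₁` settles the comparison for all nearby leaves
at once, so `e`, flipped if necessary and restricted to those leaves, is adapted around `p₂` too. -/
theorem FlowBox.exists_adapted_of_adapted {r : N → N → Prop} (h : IsLeafOrder q r)
    (hq : Continuous q) {e e₁ : FlowBox E E' q} (he₁ : e₁.Adapted r) {p₁ p₂ : N}
    (h₁ : p₁ ∈ e₁.source) (h₁' : p₁ ∈ e.source) (h₂ : p₂ ∈ e.source) (hq₁₂ : q p₁ = q p₂) :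
    ∃ e₂ : FlowBox E E' q, e₂.Adapted r ∧ p₂ ∈ e₂.source ∧ e₂.source ⊆ e.source ∧
      (e.coord p₂ = 0 → e₂.coord p₂ = 0) := by
  wlog hinc : e.Increasing r (q p₁) generalizing e
  · have hf := (e.increasing_or_flip h (e.proj_mem p₁ h₁')).resolve_left hinc
    obtain ⟨e₂, h3, h4, h5, h6⟩ := this (e := e.flip) h₁' h₂ hf
    exact ⟨e₂, h3, h4, h5, fun h0 ↦ h6 (show - e.coord p₂ = 0 by rw [h0, neg_zero])⟩
  have hx := e.proj_mem p₁ h₁'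
  -- a second point above `p₁`, in both boxes
  have hev : ∀ᶠ t in 𝓝 (e.coord p₁), e.map (q p₁, t) ∈ e₁.source := by
    refine (e.continuous_plaque hx).continuousAt (e₁.isOpen_source.mem_nhds ?_)
    rwa [e.map_coord p₁ h₁']
  obtain ⟨t, ht, hlt⟩ := ((hev.filter_mono nhdsWithin_le_nhds).and
    (self_mem_nhdsWithin (s := Ioi (e.coord p₁)))).exists
  have hs₁ := e.continuousAt_section hx (e.coord p₁)
  have hs₂ := e.continuousAt_section hx t
  have hp₁e : e.map (q p₁, e.coord p₁) = p₁ := e.map_coord p₁ h₁'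
  have hcoord : e₁.coord (e.map (q p₁, e.coord p₁)) < e₁.coord (e.map (q p₁, t)) := by
    have hqt : q (e.map (q p₁, t)) = q p₁ := e.proj_map _ hx t
    rw [hp₁e, ← FlowBox.rel_iff_coord h h₁ ht hqt.symm (he₁ _ (e₁.proj_mem _ h₁))]
    have := hinc _ _ hlt
    rwa [hp₁e] at this
  have hmem₁ : e.map (q p₁, e.coord p₁) ∈ e₁.source := by rwa [hp₁e]
  have h3 : ∀ᶠ x in 𝓝 (q p₁), e.map (x, e.coord p₁) ∈ e₁.source ∧ e.map (x, t) ∈ e₁.source ∧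
      e₁.coord (e.map (x, e.coord p₁)) < e₁.coord (e.map (x, t)) := by
    have h4 := (ContinuousAt.comp (f := fun y ↦ e.map (y, e.coord p₁))
      (e₁.continuousAt_coord hmem₁) hs₁).eventually_lt
      (ContinuousAt.comp (f := fun y ↦ e.map (y, t)) (e₁.continuousAt_coord ht) hs₂) hcoord
    filter_upwards [hs₁ (e₁.isOpen_source.mem_nhds hmem₁), hs₂ (e₁.isOpen_source.mem_nhds ht), h4]
      with y h5 h6 h7 using ⟨h5, h6, h7⟩
  obtain ⟨V, hV, hVo, hxV⟩ := eventually_nhds_iff.1 h3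
  refine ⟨e.restrict hq V hVo, ?_, ⟨h₂, ?_⟩, inter_subset_left, fun h0 ↦ h0⟩
  · rintro x ⟨hxe, hxV'⟩
    obtain ⟨h5, h6, h7⟩ := hV x hxV'
    have hqt : q (e.map (x, e.coord p₁)) = q (e.map (x, t)) := by
      rw [e.proj_map x hxe, e.proj_map x hxe]
    have h8 := (FlowBox.rel_iff_coord h h5 h6 hqt (he₁ _ (e₁.proj_mem _ h5))).2 h7
    rcases e.increasing_or_flip h hxe with h9 | h9
    · exact h9
    · exfalso
      have := h9 (-t) (-e.coord p₁) (neg_lt_neg hlt)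
      simp only [FlowBox.flip, neg_neg] at this
      exact h.asymm h8 this
  · rw [mem_preimage, ← hq₁₂]
    exact hxV

/-- A fibrewise order over the open set `U` that is compatible with boxes around each point. -/
structure IsOrientedLeafOrder (E E' : Type*) [NormedAddCommGroup E] [NormedSpace ℝ E]
    [NormedAddCommGroup E'] [NormedSpace ℝ E']
    {N S : Type*} [TopologicalSpace N] [ChartedSpace E N] [TopologicalSpace S] [ChartedSpace E' S]
    (q : N → S) (U : Set S) (r : N → N → Prop) : Prop where
  isLeafOrder : IsLeafOrder q r
  isOpen : IsOpen U
  exists_adapted : ∀ p, q p ∈ U → ∀ W ∈ 𝓝 p, ∃ e : FlowBox E E' q, e.Adapted r ∧ p ∈ e.source ∧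
    e.source ⊆ W ∧ e.coord p = 0

/-- Over the base of a box, the fibres can be coherently ordered. -/
theorem FlowBox.exists_isOrientedLeafOrder [T2Space N] (hq : Continuous q)
    (hb : HasFlowBoxes E E' q)
    (hconn : ∀ x, IsConnected (q ⁻¹' {x})) (hnc : ∀ x, ¬ IsCompact (q ⁻¹' {x}))
    (e : FlowBox E E' q) : ∃ r, IsOrientedLeafOrder E E' q e.base r := by
  obtain ⟨r₀, h₀⟩ := exists_isLeafOrder hb hconn hnc
  classical
  -- The order is reversed exactly on the leaves where the coordinate of `e` does not increase. Over
  -- points outside `e.base` the choice is immaterial.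
  set r : N → N → Prop := fun p p' ↦ if e.Increasing r₀ (q p) then r₀ p p' else r₀ p' p with hr
  have hrpos : ∀ {p}, e.Increasing r₀ (q p) → ∀ p', r p p' ↔ r₀ p p' := fun {p} hp p' ↦ by
    simp only [hr, hp, if_true]
  have hrneg : ∀ {p}, ¬ e.Increasing r₀ (q p) → ∀ p', r p p' ↔ r₀ p' p := fun {p} hp p' ↦ by
    simp only [hr, hp, if_false]
  have hproj : ∀ {p p'}, r p p' → q p = q p' := by
    intro p p' hpp
    by_cases hp : e.Increasing r₀ (q p)
    · exact h₀.proj_eq ((hrpos hp _).1 hpp)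
    · exact (h₀.proj_eq ((hrneg hp _).1 hpp)).symm
  have h : IsLeafOrder q r := by
    refine ⟨hproj, fun p hp ↦ ?_, ?_, ?_, ?_⟩
    · by_cases hi : e.Increasing r₀ (q p)
      · exact h₀.irrefl _ ((hrpos hi _).1 hp)
      · exact h₀.irrefl _ ((hrneg hi _).1 hp)
    · intro p p' p'' h1 h2
      have he := hproj h1
      by_cases hi : e.Increasing r₀ (q p)
      · exact (hrpos hi _).2 (h₀.trans ((hrpos hi _).1 h1) ((hrpos (he ▸ hi) _).1 h2))
      · exact (hrneg hi _).2 (h₀.trans ((hrneg (he ▸ hi) _).1 h2) ((hrneg hi _).1 h1))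
    · intro p p' he hne
      by_cases hi : e.Increasing r₀ (q p)
      · exact (h₀.total he hne).imp (hrpos hi _).2 (hrpos (he ▸ hi) _).2
      · exact (h₀.total he hne).symm.imp (hrneg hi _).2 (hrneg (he ▸ hi) _).2
    · intro p p' hpp
      have he := hproj hpp
      by_cases hi : e.Increasing r₀ (q p)
      · obtain ⟨W, hW, W', hW', hWW⟩ := h₀.leaf_open ((hrpos hi _).1 hpp)
        exact ⟨W, hW, W', hW', fun w hw w' hw' h1 h2 ↦
          (hrpos (h1 ▸ hi) _).2 (hWW w hw w' hw' h1 h2)⟩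
      · obtain ⟨W', hW', W, hW, hWW⟩ := h₀.leaf_open ((hrneg hi _).1 hpp)
        exact ⟨W, hW, W', hW', fun w hw w' hw' h1 h2 ↦
          (hrneg (h1 ▸ hi) _).2 (hWW w' hw' w hw (h2.trans he) (h1.trans he))⟩
  have hinc : e.Adapted r := by
    intro x hx s t hst
    have hqx : q (e.map (x, s)) = x := e.proj_map x hx s
    by_cases hi : e.Increasing r₀ x
    · exact (hrpos (by rwa [hqx]) _).2 (hi s t hst)
    · refine (hrneg (by rwa [hqx]) _).2 ?_
      have := ((e.increasing_or_flip h₀ hx).resolve_left hi) (-t) (-s) (neg_lt_neg hst)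
      simpa only [FlowBox.flip, neg_neg] using this
  refine ⟨r, h, e.isOpen_base, fun p hp ↦ ?_⟩
  -- Being in an adapted box spreads along the leaf, starting from the centre of the plaque of `e`
  -- itself.
  have hgood : ∃ e' : FlowBox E E' q, e'.Adapted r ∧ p ∈ e'.source := by
    refine HasFlowBoxes.leaf_induction (E := E) (E' := E') (hconn (q p)).isPreconnected
      (P := fun p ↦ ∃ e' : FlowBox E E' q, e'.Adapted r ∧ p ∈ e'.source) (fun p' hp' ↦ ?_)
      (e.proj_map (q p) hp 0) ⟨e, hinc, e.map_mem (q p) hp 0⟩ rfl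
    obtain ⟨e', he', -, -⟩ := hb p' univ univ_mem
    refine ⟨e', he', fun p₁ h₁ p₂ h₂ hq₁ hq₂ ⟨e₁, he₁, hp₁⟩ ↦ ?_⟩
    obtain ⟨e₂, h3, h4, -⟩ :=
      FlowBox.exists_adapted_of_adapted h hq he₁ hp₁ h₁ h₂ (hq₁.trans hq₂.symm)
    exact ⟨e₂, h3, h4⟩
  intro W hW
  obtain ⟨e', he', hpe'⟩ := hgood
  obtain ⟨e'', h1, h2, h3⟩ := hb p W hW
  obtain ⟨e₂, h4, h5, h6, h7⟩ := FlowBox.exists_adapted_of_adapted h hq he' hpe' h1 h1 rfl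
  exact ⟨e₂, h4, h5, h6.trans h2, h7 h3⟩

namespace IsOrientedLeafOrder

variable {U : Set S} {r : N → N → Prop}

/-- A coherent fibrewise order is open in the fibre product. -/
theorem rel_nhds (h : IsOrientedLeafOrder E E' q U r) (hb : HasFlowBoxes E E' q)
    (hq : Continuous q) {p p' : N} (hU : q p ∈ U) (hconn : IsPreconnected (q ⁻¹' {q p}))
    (hpp : r p p') : ∃ W ∈ 𝓝 p, ∃ W' ∈ 𝓝 p', ∀ w ∈ W, ∀ w' ∈ W', q w = q w' → r w w' := by
  have hl := h.isLeafOrder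
  set R : N → N → Prop := fun p p' ↦
    ∃ W ∈ 𝓝 p, ∃ W' ∈ 𝓝 p', ∀ w ∈ W, ∀ w' ∈ W', q w = q w' → r w w' with hR
  -- Openness of `q` enters here: every leaf close to `a` still meets the chosen neighbourhood of
  -- the intermediate point `b`.
  have htrans : ∀ a b c, q a = q b → R a b → R b c → R a c := by
    rintro a b c hab ⟨W, hW, W', hW', h1⟩ ⟨T, hT, T', hT', h2⟩
    have hO : q '' (W' ∩ T) ∈ 𝓝 (q a) := hab ▸ hb.isOpenMap.image_mem_nhds (inter_mem hW' hT)
    refine ⟨W ∩ q ⁻¹' (q '' (W' ∩ T)), inter_mem hW (hq.continuousAt hO), T', hT', ?_⟩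
    rintro w ⟨hw, ⟨v, hv, hvw⟩⟩ w' hw' hww
    exact hl.trans (h1 w hw v hv.1 hvw.symm) (h2 v hv.2 w' hw' (hvw.trans hww))
  have hloc : ∀ e : FlowBox E E' q, e.Adapted r → ∀ a ∈ e.source, ∀ b ∈ e.source, r a b →
      R a b := by
    intro e he a ha b hb' hab
    have hc := (FlowBox.rel_iff_coord hl ha hb' (hl.proj_eq hab) (he _ (e.proj_mem _ ha))).1 hab
    obtain ⟨m, hm⟩ := exists_between hc
    refine ⟨e.source ∩ {w | e.coord w < m}, inter_mem (e.isOpen_source.mem_nhds ha)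
      ((e.continuousAt_coord ha).eventually (gt_mem_nhds hm.1)), e.source ∩ {w | m < e.coord w},
      inter_mem (e.isOpen_source.mem_nhds hb')
      ((e.continuousAt_coord hb').eventually (lt_mem_nhds hm.2)), ?_⟩
    intro w hw w' hw' hww
    exact (FlowBox.rel_iff_coord hl hw.1 hw'.1 hww (he _ (e.proj_mem _ hw.1))).2
      ((show e.coord w < m from hw.2).trans hw'.2)
  -- The claim covers all `b'` in the order interval from `p` to `b`, not just `b`. It is vacuous at
  -- `b = p` and survives steps along the leaf in either direction.
  have key : ∀ b, q b = q p → ∀ b', r p b' → (r b' b ∨ b' = b) → R p b' := by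
    intro b hbq
    refine HasFlowBoxes.leaf_induction (E := E) (E' := E') hconn
      (P := fun b ↦ ∀ b', r p b' → (r b' b ∨ b' = b) → R p b') (fun c hc ↦ ?_) (p₀ := p) rfl ?_ hbq
    · obtain ⟨e, he, hce, -⟩ := h.exists_adapted c (hc ▸ hU) univ univ_mem
      refine ⟨e, hce, fun p₁ h₁ p₂ h₂ hq₁ hq₂ hP b' hpb' hb' ↦ ?_⟩
      -- either `b'` is below `p₁`, or it lies in the box
      by_cases hle : r b' p₁ ∨ b' = p₁
      · exact hP b' hpb' hle
      push Not at hle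
      have hqb' : q b' = q p := (hl.proj_eq hpb').symm
      have h₁b' : r p₁ b' := (hl.total (hqb'.trans hq₁.symm) hle.2).resolve_left hle.1
      have hb'e : b' ∈ e.source := by
        rcases hb' with hb' | rfl
        · exact FlowBox.mem_source_of_between hl e h₁ h₂ h₁b' hb'
        · exact h₂
      have hR₁ : R p₁ b' := hloc e he p₁ h₁ b' hb'e h₁b'
      by_cases hpp₁ : p = p₁
      · exact hpp₁ ▸ hR₁
      rcases hl.total hq₁.symm hpp₁ with h3 | h3
      · exact htrans p p₁ b' hq₁.symm (hP p₁ h3 (Or.inr rfl)) hR₁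
      · exact hloc e he p (FlowBox.mem_source_of_between hl e h₁ hb'e h3 hpb') b' hb'e hpb'
    · intro b' h1 h2
      rcases h2 with h2 | rfl
      · exact absurd h2 (hl.asymm h1)
      · exact absurd h1 (hl.irrefl _)
  exact key p' (hl.proj_eq hpp).symm p' hpp (Or.inr rfl)

end IsOrientedLeafOrder

end LeafOrders

/-! ### Locally finite families of small sets. -/

section Covers

universe u

/-- If there are arbitrarily small objects around each point, some locally finite family of them
has the property that the associated smaller sets cover the space. -/
theorem exists_locallyFinite_family {X : Type u} {K : Type*} [TopologicalSpace X] [LocallyCompactSpace X]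
    [SigmaCompactSpace X] [T2Space X] (P : K → Prop) (big small : K → Set X)
    (h : ∀ x, ∀ W ∈ 𝓝 x, ∃ k, P k ∧ big k ⊆ W ∧ small k ∈ 𝓝 x) :
    ∃ (ι : Type u) (k : ι → K), (∀ i, P (k i)) ∧ LocallyFinite (fun i ↦ big (k i)) ∧
      ∀ x, ∃ i, x ∈ small (k i) := by
  have hbasis : ∀ x : X, (𝓝 x).HasBasis (fun V ↦ (x ∈ V ∧ IsOpen V) ∧ IsCompact (closure V)) id := by
    intro x
    refine (nhds_basis_opens x).to_hasBasis (fun U hU ↦ ?_) (fun V hV ↦ ⟨V, hV.1, subset_rfl⟩)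
    obtain ⟨C, hC, hCU, hCc⟩ := LocallyCompactSpace.local_compact_nhds x U (hU.2.mem_nhds hU.1)
    exact ⟨interior C, ⟨⟨mem_interior_iff_mem_nhds.2 hC, isOpen_interior⟩,
      hCc.of_isClosed_subset isClosed_closure
        (closure_minimal interior_subset hCc.isClosed)⟩, interior_subset.trans hCU⟩
  obtain ⟨α, c, u, hu, hcov, hlf⟩ :=
    refinement_of_locallyCompact_sigmaCompact_of_nhds_basis hbasis
  -- Finitely many small sets cover the compact set `v a`, while the corresponding big sets stay
  -- inside `u a`; so local finiteness is inherited from `u`.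
  obtain ⟨v, hv, hvc, hvu⟩ := exists_iUnion_eq_closed_subset (u := u) (fun a ↦ (hu a).1.2)
    (fun x ↦ hlf.point_finite x) hcov
  have hvK : ∀ a, IsCompact (v a) := fun a ↦
    (hu a).2.of_isClosed_subset (hvc a) ((hvu a).trans subset_closure)
  have hchoose : ∀ a, ∀ x : v a, ∃ k, P k ∧ big k ⊆ u a ∧ small k ∈ 𝓝 (x : X) := fun a x ↦
    h x _ ((hu a).1.2.mem_nhds (hvu a x.2))
  choose k hkP hkb hks using hchoose
  have hfin : ∀ a, ∃ t : Finset (v a), v a ⊆ ⋃ x ∈ t, small (k a x) := fun a ↦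
    (hvK a).elim_nhds_subcover' (fun x hx ↦ small (k a ⟨x, hx⟩)) (fun x hx ↦ hks a ⟨x, hx⟩)
  choose t htc using hfin
  refine ⟨Σ a, t a, fun i ↦ k i.1 i.2, fun i ↦ hkP _ _, ?_, ?_⟩
  · intro x
    obtain ⟨T, hT, hTf⟩ := hlf x
    refine ⟨T, hT, ?_⟩
    have : {i : Σ a, t a | ((big (k i.1 i.2)) ∩ T).Nonempty} ⊆
        ⋃ a ∈ {a | ((id (u a)) ∩ T).Nonempty}, range (fun x : t a ↦ (⟨a, x⟩ : Σ a, t a)) := by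
      rintro ⟨a, x⟩ ⟨y, hy, hyT⟩
      exact mem_biUnion (x := a) ⟨y, hkb a x hy, hyT⟩ ⟨x, rfl⟩
    exact (hTf.biUnion fun a _ ↦ finite_range _).subset this
  · intro x
    obtain ⟨a, ha⟩ := mem_iUnion.1 (hv ▸ mem_univ x : x ∈ ⋃ a, v a)
    obtain ⟨y, hy, hxy⟩ := mem_iUnion₂.1 (htc a ha)
    exact ⟨⟨a, ⟨y, hy⟩⟩, hxy⟩

end Covers

/-! ### Fibre coordinates as sums of step functions. -/

section Steps

/-- A smooth step function that is the identity on `[-1, 1]`. -/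
structure IsSmoothStep (σ : ℝ → ℝ) : Prop where
  contDiff : ContDiff ℝ ∞ σ
  monotone : Monotone σ
  eq_self : ∀ t ∈ Icc (-1 : ℝ) 1, σ t = t
  eq_right : ∀ t, 2 ≤ t → σ t = σ 2
  eq_left : ∀ t, t ≤ -2 → σ t = σ (-2)

/-- The primitive of a bump function that is `1` on `[-1, 1]` and vanishes where `|u| ≥ 2`. -/
theorem exists_isSmoothStep : ∃ σ, IsSmoothStep σ := by
  let φ : ContDiffBump (0 : ℝ) := ⟨1, 2, one_pos, one_lt_two⟩
  have hφc : Continuous φ := φ.continuous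
  set σ : ℝ → ℝ := fun t ↦ ∫ u in (0 : ℝ)..t, φ u with hσ
  have hd : ∀ t, HasDerivAt σ (φ t) t := fun t ↦
    intervalIntegral.integral_hasDerivAt_right (hφc.intervalIntegrable _ _)
      (hφc.stronglyMeasurableAtFilter _ _) hφc.continuousAt
  have hdiff : Differentiable ℝ σ := fun t ↦ (hd t).differentiableAt
  have hderiv : deriv σ = φ := funext fun t ↦ (hd t).deriv
  have hconst : ∀ a b : ℝ, (∀ u ∈ uIcc a b, φ u = 0) → σ a = σ b := by
    intro a b h
    have h1 := intervalIntegral.integral_interval_sub_left (hφc.intervalIntegrable 0 b)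
      (hφc.intervalIntegrable (μ := MeasureTheory.volume) 0 a)
    rw [intervalIntegral.integral_congr (g := fun _ ↦ (0 : ℝ)) h] at h1
    simp only [intervalIntegral.integral_zero] at h1
    simp only [hσ]
    linarith
  have hout : ∀ u : ℝ, 2 ≤ |u| → φ u = 0 := fun u hu ↦
    φ.zero_of_le_dist (by simpa [Real.dist_eq] using hu)
  refine ⟨σ, ?_, monotone_of_deriv_nonneg hdiff (fun t ↦ by rw [hderiv]; exact φ.nonneg), ?_, ?_, ?_⟩
  · rw [contDiff_infty_iff_deriv, hderiv]
    exact ⟨hdiff, φ.contDiff⟩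
  · intro t ht
    have h1 : σ t = ∫ u in (0 : ℝ)..t, (1 : ℝ) := by
      refine intervalIntegral.integral_congr fun u hu ↦ φ.one_of_mem_closedBall ?_
      rw [Real.closedBall_eq_Icc]
      have h0 : (0 : ℝ) ∈ Icc (-1 : ℝ) 1 := by norm_num
      have := (ordConnected_Icc.uIcc_subset h0 ht) hu
      simpa [φ] using this
    simpa using h1
  · intro t ht
    refine hconst t 2 fun u hu ↦ hout u ?_
    rw [uIcc_of_ge ht] at hu
    rw [abs_of_nonneg (by linarith [hu.1])]
    exact hu.1
  · intro t ht
    refine hconst t (-2) fun u hu ↦ hout u ?_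
    rw [uIcc_of_le ht] at hu
    rw [abs_of_nonpos (by linarith [hu.2])]
    linarith [hu.2]

theorem IsSmoothStep.le_right {σ : ℝ → ℝ} (h : IsSmoothStep σ) (t : ℝ) : σ t ≤ σ 2 := by
  rcases le_total t 2 with h1 | h1
  · exact h.monotone h1
  · exact (h.eq_right t h1).le

theorem IsSmoothStep.left_le {σ : ℝ → ℝ} (h : IsSmoothStep σ) (t : ℝ) : σ (-2) ≤ σ t := by
  rcases le_total t (-2) with h1 | h1
  · exact (h.eq_left t h1).ge
  · exact h.monotone h1

theorem IsSmoothStep.lt_of_lt {σ : ℝ → ℝ} (h : IsSmoothStep σ) {s t : ℝ} (hs : s ∈ Ico (-1 : ℝ) 1)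
    (hst : s < t) : σ s < σ t := by
  have h1 : σ s = s := h.eq_self s ⟨hs.1, hs.2.le⟩
  rcases le_total t 1 with h2 | h2
  · rw [h1, h.eq_self t ⟨by linarith [hs.1], h2⟩]
    exact hst
  · have h3 : σ 1 = 1 := h.eq_self 1 ⟨by norm_num, le_rfl⟩
    have := h.monotone h2
    linarith [hs.2]

variable {E E' : Type*} [NormedAddCommGroup E] [NormedSpace ℝ E]
  [NormedAddCommGroup E'] [NormedSpace ℝ E']
  {N S : Type*} [TopologicalSpace N] [ChartedSpace E N] [TopologicalSpace S] [ChartedSpace E' S]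
  {q : N → S}

namespace FlowBox

variable {r : N → N → Prop} {σ : ℝ → ℝ} {e : FlowBox E E' q}

open scoped Classical in
/-- The step function `σ` of the coordinate of a box, extended by constants above and below. -/
noncomputable def step (r : N → N → Prop) (σ : ℝ → ℝ) (e : FlowBox E E' q) (p : N) : ℝ :=
  if p ∈ e.source then σ (e.coord p) else if r (e.map (q p, 0)) p then σ 2 else σ (-2)

theorem step_of_mem {p : N} (hp : p ∈ e.source) : e.step r σ p = σ (e.coord p) := by
  simp [step, hp]

theorem step_of_above {p : N} (hp : p ∉ e.source) (h : r (e.map (q p, 0)) p) :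
    e.step r σ p = σ 2 := by
  simp [step, hp, h]

theorem step_of_below {p : N} (hp : p ∉ e.source) (h : ¬ r (e.map (q p, 0)) p) :
    e.step r σ p = σ (-2) := by
  simp [step, hp, h]

theorem rel_of_not_rel (h : IsLeafOrder q r) {p : N} (hx : q p ∈ e.base) (hp : p ∉ e.source)
    (hr : ¬ r (e.map (q p, 0)) p) : r p (e.map (q p, 0)) :=
  (h.total (by rw [e.proj_map _ hx]) (fun he ↦ hp (by rw [← he]; exact e.map_mem _ hx 0))).resolve_left hr

/-- Plaques are order convex, so a point of the leaf off the box is above the whole plaque or below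
all of it; comparison with the centre `e.map (q p', 0)` tells which. -/
theorem above_of_rel (h : IsLeafOrder q r) {p p' : N} (hp : p ∈ e.source) (hp' : p' ∉ e.source)
    (hpp : r p p') : r (e.map (q p', 0)) p' := by
  have hx : q p' ∈ e.base := h.proj_eq hpp ▸ e.proj_mem p hp
  by_contra hn
  exact hp' (e.mem_source_of_between h hp (e.map_mem _ hx 0) hpp (rel_of_not_rel h hx hp' hn))

theorem not_above_of_rel (h : IsLeafOrder q r) {p p' : N} (hp : p ∉ e.source) (hp' : p' ∈ e.source)
    (hpp : r p p') : ¬ r (e.map (q p, 0)) p := by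
  have hx : q p ∈ e.base := h.proj_eq hpp ▸ e.proj_mem p' hp'
  exact fun hn ↦ hp (e.mem_source_of_between h (e.map_mem _ hx 0) hp' hn hpp)

theorem step_mono (h : IsLeafOrder q r) (hσ : IsSmoothStep σ) (he : e.Adapted r) {p p' : N}
    (hx : q p ∈ e.base) (hpp : r p p') : e.step r σ p ≤ e.step r σ p' := by
  have hqq := h.proj_eq hpp
  by_cases hp : p ∈ e.source <;> by_cases hp' : p' ∈ e.source
  · rw [step_of_mem hp, step_of_mem hp']
    exact hσ.monotone ((rel_iff_coord h hp hp' hqq (he _ hx)).1 hpp).le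
  · rw [step_of_mem hp, step_of_above hp' (above_of_rel h hp hp' hpp)]
    exact hσ.le_right _
  · rw [step_of_mem hp', step_of_below hp (not_above_of_rel h hp hp' hpp)]
    exact hσ.left_le _
  · by_cases hr : r (e.map (q p, 0)) p
    · rw [step_of_above hp hr, step_of_above hp' (hqq ▸ h.trans hr hpp)]
    · rw [step_of_below hp hr]
      by_cases hr' : r (e.map (q p', 0)) p'
      · rw [step_of_above hp' hr']
        exact hσ.le_right _
      · rw [step_of_below hp' hr']

theorem step_lt (h : IsLeafOrder q r) (hσ : IsSmoothStep σ) (he : e.Adapted r) {p p' : N}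
    (hp : p ∈ e.source) (hc : e.coord p ∈ Ico (-1 : ℝ) 1) (hpp : r p p') :
    e.step r σ p < e.step r σ p' := by
  by_cases hp' : p' ∈ e.source
  · rw [step_of_mem hp, step_of_mem hp']
    exact hσ.lt_of_lt hc ((rel_iff_coord h hp hp' (h.proj_eq hpp) (he _ (e.proj_mem p hp))).1 hpp)
  · rw [step_of_mem hp, step_of_above hp' (above_of_rel h hp hp' hpp)]
    exact hσ.lt_of_lt hc (by linarith [hc.2])

/-- A step function is constant along the plaques of a box that does not meet its own box. -/
theorem step_eq_of_disjoint (h : IsLeafOrder q r)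
    {e' : FlowBox E E' q} {w w' : N} (hw : w ∈ e'.source) (hw' : w' ∈ e'.source) (hqq : q w = q w')
    (hx : q w ∈ e.base) (hdisj : Disjoint e.source e'.source) :
    e.step r σ w = e.step r σ w' := by
  by_cases heq : w = w'
  · rw [heq]
  wlog hr : r w w' generalizing w w'
  · exact (this hw' hw hqq.symm (hqq ▸ hx) (Ne.symm heq)
      ((h.total hqq heq).resolve_left hr)).symm
  have hn : w ∉ e.source := Set.disjoint_right.1 hdisj hw
  have hn' : w' ∉ e.source := Set.disjoint_right.1 hdisj hw'
  by_cases hra : r (e.map (q w, 0)) w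
  · rw [step_of_above hn hra, step_of_above hn' (hqq ▸ h.trans hra hr)]
  · by_cases hra' : r (e.map (q w', 0)) w'
    · exfalso
      have h1 := rel_of_not_rel h hx hn hra
      rw [← hqq] at hra'
      exact Set.disjoint_left.1 hdisj (e.map_mem _ hx 0)
        (e'.mem_source_of_between h hw hw' h1 hra')
    · rw [step_of_below hn hra, step_of_below hn' hra']

/-- Off the box the function is locally constant. A point `p` above the plaque is above its level
`3`, and by `rel_nhds` so are nearby points relative to their own plaques. Such a point is off its
plaque or has coordinate greater than `3`, where `σ` is already constant. The level `-3` serves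
below. -/
theorem contMDiffAt_step {U : Set S} (h : IsOrientedLeafOrder E E' q U r)
    (hb : HasFlowBoxes E E' q) (hq : Continuous q)
    (hconn : ∀ x, IsPreconnected (q ⁻¹' {x})) (hσ : IsSmoothStep σ) (he : e.Adapted r) {p : N}
    (hx : q p ∈ e.base) (hU : q p ∈ U) : ContMDiffAt 𝓘(ℝ, E) 𝓘(ℝ, ℝ) ∞ (e.step r σ) p := by
  have hl := h.isLeafOrder
  by_cases hp : p ∈ e.source
  · refine ((hσ.contDiff.contMDiff (x := e.coord p)).comp p
      (e.contMDiffAt_coord hp)).congr_of_eventuallyEq ?_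
    filter_upwards [e.isOpen_source.mem_nhds hp] with w hw using step_of_mem hw
  have hev : ∀ᶠ w in 𝓝 p, q w ∈ e.base := hq.continuousAt (e.isOpen_base.mem_nhds hx)
  have hsec : ∀ t, ContinuousAt (fun w ↦ e.map (q w, t)) p := fun t ↦
    ContinuousAt.comp (f := q) (e.continuousAt_section hx t) hq.continuousAt
  by_cases hr : r (e.map (q p, 0)) p
  · have hr3 : r (e.map (q p, 3)) p := by
      refine (hl.total (by rw [e.proj_map _ hx]) 
          (fun he ↦ hp (by rw [← he]; exact e.map_mem _ hx 3))).resolve_right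
        fun h3 ↦ hp (e.mem_source_of_between hl (e.map_mem _ hx 0) (e.map_mem _ hx 3) hr h3)
    obtain ⟨W, hW, W', hW', hWW⟩ := h.rel_nhds hb hq (by rwa [e.proj_map _ hx])
      (by rw [e.proj_map _ hx]; exact hconn _) hr3
    refine (contMDiffAt_const (c := σ 2)).congr_of_eventuallyEq ?_
    filter_upwards [hev, hsec 3 hW, hW'] with w hwx hwW hwW'
    have h3 : r (e.map (q w, 3)) w := hWW _ hwW w hwW' (e.proj_map _ hwx _)
    by_cases hw : w ∈ e.source
    · have h4 := (rel_iff_coord hl (e.map_mem _ hwx 3) hw (e.proj_map _ hwx _)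
        (he _ (by rw [e.proj_map _ hwx]; exact hwx))).1 h3
      rw [e.coord_map _ hwx] at h4
      rw [step_of_mem hw, hσ.eq_right _ (by linarith)]
    · rw [step_of_above hw (hl.trans (he _ hwx 0 3 (by norm_num)) h3)]
  · have hr' := rel_of_not_rel hl hx hp hr
    have hr3 : r p (e.map (q p, -3)) := by
      refine (hl.total (by rw [e.proj_map _ hx]) 
          (fun he ↦ hp (by rw [he]; exact e.map_mem _ hx (-3)))).resolve_right
        fun h3 ↦ hp (e.mem_source_of_between hl (e.map_mem _ hx (-3)) (e.map_mem _ hx 0) h3 hr')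
    obtain ⟨W', hW', W, hW, hWW⟩ := h.rel_nhds hb hq hU (hconn _) hr3
    refine (contMDiffAt_const (c := σ (-2))).congr_of_eventuallyEq ?_
    filter_upwards [hev, hsec (-3) hW, hW'] with w hwx hwW hwW'
    have h3 : r w (e.map (q w, -3)) := hWW w hwW' _ hwW (e.proj_map _ hwx _).symm
    by_cases hw : w ∈ e.source
    · have h4 := (rel_iff_coord hl hw (e.map_mem _ hwx (-3)) (e.proj_map _ hwx _).symm
        (he _ hwx)).1 h3
      rw [e.coord_map _ hwx] at h4
      rw [step_of_mem hw, hσ.eq_left _ (by linarith)]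
    · rw [step_of_below hw (hl.asymm (hl.trans h3 (he _ hwx (-3) 0 (by norm_num))))]

end FlowBox

/-- A smooth function on `q ⁻¹' U` that restricts to a diffeomorphism onto `ℝ` on each fibre. -/
structure IsFibreCoordinate (E E' : Type*) [NormedAddCommGroup E] [NormedSpace ℝ E]
    [NormedAddCommGroup E'] [NormedSpace ℝ E']
    {N S : Type*} [TopologicalSpace N] [ChartedSpace E N] [TopologicalSpace S] [ChartedSpace E' S]
    (q : N → S) (U : Set S) (F : N → ℝ) : Prop where
  isOpen : IsOpen U
  contMDiffAt : ∀ p, q p ∈ U → ContMDiffAt 𝓘(ℝ, E) 𝓘(ℝ, ℝ) ∞ F p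
  injOn : ∀ p p', q p ∈ U → q p = q p' → F p = F p' → p = p'
  surjOn : ∀ x ∈ U, ∀ y, ∃ p, q p = x ∧ F p = y
  deriv_ne : ∀ p, q p ∈ U → ∃ e : FlowBox E E' q, p ∈ e.source ∧
    deriv (fun t ↦ F (e.map (q p, t))) (e.coord p) ≠ 0

/-- Over an open set with a coherent fibrewise order and a section there is a fibre coordinate. -/
theorem IsOrientedLeafOrder.exists_isFibreCoordinate
    [FiniteDimensional ℝ E] [FiniteDimensional ℝ E'] [T2Space N] [SecondCountableTopology N]
    [T2Space S] [IsManifold 𝓘(ℝ, E') ∞ S]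
    {U : Set S} {r : N → N → Prop} (h : IsOrientedLeafOrder E E' q U r)
    (hb : HasFlowBoxes E E' q) (hq : ContMDiff 𝓘(ℝ, E) 𝓘(ℝ, E') ∞ q)
    (hconn : ∀ x, IsPreconnected (q ⁻¹' {x})) {s : S → N}
    (hs : ∀ x ∈ U, ContMDiffAt 𝓘(ℝ, E') 𝓘(ℝ, E) ∞ s x) (hqs : ∀ x ∈ U, q (s x) = x) :
    ∃ F : N → ℝ, IsFibreCoordinate E E' q U F := by
  have hl := h.isLeafOrder
  have hqc := hq.continuous
  obtain ⟨σ, hσ⟩ := exists_isSmoothStep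
  -- a locally finite family of boxes
  have hfam : ∃ (ι : Type _) (k : ι → FlowBox E E' q × (S → ℝ)),
      (∀ i, (k i).1.Adapted r ∧ ContMDiff 𝓘(ℝ, E') 𝓘(ℝ, ℝ) ∞ (k i).2 ∧ (∀ x, 0 ≤ (k i).2 x) ∧
        tsupport (k i).2 ⊆ (k i).1.base) ∧
      (∀ p, q p ∈ U → ∃ T ∈ 𝓝 p, ∃ I : Set ι, I.Finite ∧ ∀ i ∉ I,
        Disjoint (k i).1.source T) ∧
      ∀ p, q p ∈ U → ∃ i, p ∈ (k i).1.source ∧ |(k i).1.coord p| < 1 / 2 ∧ (k i).2 (q p) = 1 := by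
    have hUo : IsOpen (q ⁻¹' U) := h.isOpen.preimage hqc
    have : LocallyCompactSpace N := ChartedSpace.locallyCompactSpace E N
    have : LocallyCompactSpace E' := inferInstance
    have : LocallyCompactSpace (q ⁻¹' U) := hUo.locallyCompactSpace
    obtain ⟨ι, k, hP, hlf, hcov⟩ := exists_locallyFinite_family (X := q ⁻¹' U)
      (fun k : FlowBox E E' q × (S → ℝ) ↦ k.1.Adapted r ∧ ContMDiff 𝓘(ℝ, E') 𝓘(ℝ, ℝ) ∞ k.2 ∧
        (∀ x, 0 ≤ k.2 x) ∧ tsupport k.2 ⊆ k.1.base)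
      (fun k ↦ (↑) ⁻¹' k.1.source)
      (fun k ↦ (↑) ⁻¹' {p | p ∈ k.1.source ∧ |k.1.coord p| < 1 / 2 ∧ k.2 (q p) = 1}) (by
        rintro ⟨p, hp⟩ W hW
        obtain ⟨T, hT, hTW⟩ := (mem_nhds_subtype _ _ _).1 hW
        obtain ⟨e, he, hpe, heT, he0⟩ := h.exists_adapted p hp T hT
        obtain ⟨χ, -, hχ⟩ := (SmoothBumpFunction.nhds_basis_tsupport (I := 𝓘(ℝ, E')) (q p)).mem_iff.1
          (e.isOpen_base.mem_nhds (e.proj_mem p hpe))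
        refine ⟨(e, χ), ⟨he, χ.contMDiff, fun x ↦ χ.nonneg, hχ⟩, ?_, ?_⟩
        · exact (preimage_mono heT).trans hTW
        · refine (mem_nhds_subtype _ _ _).2 ⟨_, ?_, subset_rfl⟩
          have h1 : ∀ᶠ p' in 𝓝 p, |e.coord p'| < 1 / 2 := by
            refine (e.continuousAt_coord hpe).abs.eventually (gt_mem_nhds ?_)
            simp only [he0]; norm_num
          filter_upwards [e.isOpen_source.mem_nhds hpe, h1,
            hqc.continuousAt.eventually χ.eventuallyEq_one] with p' h2 h3 h4
          exact ⟨h2, h3, h4⟩)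
    refine ⟨ι, k, hP, fun p hp ↦ ?_, fun p hp ↦ hcov ⟨p, hp⟩⟩
    obtain ⟨t, ht, htf⟩ := hlf ⟨p, hp⟩
    obtain ⟨T, hT, hTt⟩ := (mem_nhds_subtype _ _ _).1 ht
    refine ⟨T ∩ q ⁻¹' U, inter_mem hT (hUo.mem_nhds hp), _, htf, fun i hi ↦ ?_⟩
    refine Set.disjoint_left.2 fun y hy hyT ↦ hi ?_
    exact ⟨⟨y, hyT.2⟩, hy, hTt hyT.1⟩
  obtain ⟨ι, k, hP, hlf, hcov⟩ := hfam
  -- The bump function on the base removes the summand before the step function loses its meaning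
  -- outside the base of its box.
  set g : ι → N → ℝ := fun i p ↦ (k i).2 (q p) * (k i).1.step r σ p with hg
  -- smoothness, monotonicity and local constancy of the summands
  have hgs : ∀ i p, q p ∈ U → ContMDiffAt 𝓘(ℝ, E) 𝓘(ℝ, ℝ) ∞ (g i) p := by
    intro i p hp
    by_cases hx : q p ∈ tsupport (k i).2
    · exact (((hP i).2.1.comp hq).contMDiffAt).mul (FlowBox.contMDiffAt_step h hb hqc hconn hσ
        (hP i).1 ((hP i).2.2.2 hx) hp)
    · refine (contMDiffAt_const (c := (0 : ℝ))).congr_of_eventuallyEq ?_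
      filter_upwards [hqc.continuousAt ((isClosed_tsupport _).isOpen_compl.mem_nhds hx)] with w hw
      simp [hg, image_eq_zero_of_notMem_tsupport hw]
  have hbase : ∀ i x, x ∉ (k i).1.base → (k i).2 x = 0 := fun i x hx ↦
    image_eq_zero_of_notMem_tsupport fun hx' ↦ hx ((hP i).2.2.2 hx')
  have hgm : ∀ i p p', r p p' → g i p ≤ g i p' := by
    intro i p p' hpp
    have hqq := hl.proj_eq hpp
    by_cases hx : q p ∈ (k i).1.base
    · simp only [hg, ← hqq]
      exact mul_le_mul_of_nonneg_left (FlowBox.step_mono hl hσ (hP i).1 hx hpp) ((hP i).2.2.1 _)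
    · simp only [hg, ← hqq, hbase i _ hx, zero_mul, le_refl]
  have hgc : ∀ i (e : FlowBox E E' q), Disjoint (k i).1.source e.source → ∀ w ∈ e.source,
      ∀ w' ∈ e.source, q w = q w' → g i w = g i w' := by
    intro i e hdisj w hw w' hw' hqq
    by_cases hx : q w ∈ (k i).1.base
    · simp only [hg, ← hqq]
      rw [FlowBox.step_eq_of_disjoint hl hw hw' hqq hx hdisj]
    · simp only [hg, ← hqq, hbase i _ hx, zero_mul]
  -- finite variation
  have hfin : ∀ p, q p ∈ U → ∃ W ∈ 𝓝 (s (q p)), ∃ W' ∈ 𝓝 p, ∃ I : Set ι, I.Finite ∧ ∀ i ∉ I,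
      ∀ w ∈ W, ∀ w' ∈ W', q w = q w' → g i w = g i w' := by
    intro p hp
    -- Walk along the leaf from `s (q p)` to `p`. Each small box on the way meets only finitely many
    -- boxes of the family, and the other summands are constant on its plaques.
    refine HasFlowBoxes.leaf_induction (E := E) (E' := E') (hconn (q p)) (p₀ := s (q p))
      (P := fun p' ↦ ∃ W ∈ 𝓝 (s (q p)), ∃ W' ∈ 𝓝 p', ∃ I : Set ι, I.Finite ∧ ∀ i ∉ I,
        ∀ w ∈ W, ∀ w' ∈ W', q w = q w' → g i w = g i w') ?_ (hqs _ hp) ?_ rfl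
    · intro b hbx
      obtain ⟨T, hT, I₀, hI₀, hIT⟩ := hlf b (hbx ▸ hp)
      obtain ⟨e, hbe, heT, -⟩ := hb b T hT
      refine ⟨e, hbe, ?_⟩
      rintro p₁ hp₁ p₂ hp₂ hq₁ hq₂ ⟨W, hW, W', hW', I, hI, hWW⟩
      have hO : q '' (W' ∩ e.source) ∈ 𝓝 (q (s (q p))) := by
        rw [hqs _ hp, ← hq₁]
        exact hb.isOpenMap.image_mem_nhds (inter_mem hW' (e.isOpen_source.mem_nhds hp₁))
      refine ⟨W ∩ q ⁻¹' (q '' (W' ∩ e.source)), inter_mem hW (hqc.continuousAt hO), e.source,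
        e.isOpen_source.mem_nhds hp₂, I ∪ I₀, hI.union hI₀, ?_⟩
      rintro i hi w ⟨hw, v, hv, hvw⟩ w' hw' hww
      rw [hWW i (fun h ↦ hi (Or.inl h)) w hw v hv.1 hvw.symm]
      exact hgc i e ((hIT i (fun h ↦ hi (Or.inr h))).mono_right heT) v hv.2 w' hw'
        (hvw.trans hww)
    · obtain ⟨T, hT, I₀, hI₀, hIT⟩ := hlf (s (q p)) (by rwa [hqs _ hp])
      obtain ⟨e, hbe, heT, -⟩ := hb _ T hT
      exact ⟨e.source, e.isOpen_source.mem_nhds hbe, e.source, e.isOpen_source.mem_nhds hbe, I₀,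
        hI₀, fun i hi w hw w' hw' ↦ hgc i e ((hIT i hi).mono_right heT) w hw w' hw'⟩
  have hfin' : ∀ p, q p ∈ U → ∃ I : Finset ι, ∀ᶠ w in 𝓝 p, ∀ i ∉ I, g i w = g i (s (q w)) := by
    intro p hp
    obtain ⟨W, hW, W', hW', I, hI, hWW⟩ := hfin p hp
    refine ⟨hI.toFinset, ?_⟩
    have h1 : ContinuousAt (fun w ↦ s (q w)) p :=
      ContinuousAt.comp (f := q) (hs _ hp).continuousAt hqc.continuousAt
    filter_upwards [h1 hW, hW', hqc.continuousAt (h.isOpen.mem_nhds hp)] with w hw hw' hwU i hi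
    exact (hWW i (by simpa using hi) _ hw w hw' (hqs _ hwU)).symm
  -- A step function is usually nonzero even far from its box, so the plain sum of the `g i` need
  -- not be finite. Subtracting the values on the section leaves finitely many nonzero terms near
  -- each point.
  set F : N → ℝ := fun p ↦ ∑ᶠ i, (g i p - g i (s (q p))) with hF
  have hFsum : ∀ (p : N) (I : Finset ι), (∀ i ∉ I, g i p = g i (s (q p))) →
      F p = ∑ i ∈ I, (g i p - g i (s (q p))) := by
    intro p I hI
    refine finsum_eq_sum_of_support_subset _ fun i hi ↦ ?_
    by_contra hn
    exact hi (sub_eq_zero.2 (hI i hn))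
  have hFs : ∀ p, q p ∈ U → ContMDiffAt 𝓘(ℝ, E) 𝓘(ℝ, ℝ) ∞ F p := by
    intro p hp
    obtain ⟨I, hI⟩ := hfin' p hp
    have h1 : ContMDiffAt 𝓘(ℝ, E) 𝓘(ℝ, ℝ) ∞ (fun w ↦ ∑ i ∈ I, (g i w - g i (s (q w)))) p := by
      refine contMDiffAt_finsetSum fun i _ ↦ (hgs i p hp).sub ?_
      exact (hgs i _ (by rwa [hqs _ hp])).comp p (f := fun w ↦ s (q w))
        ((hs _ hp).comp p hq.contMDiffAt)
    refine h1.congr_of_eventuallyEq ?_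
    filter_upwards [hI] with w hw using hFsum w I hw
  -- the total increases at least as much as any summand
  have hFg : ∀ i p p', q p ∈ U → r p p' → g i p' - g i p ≤ F p' - F p := by
    intro i p p' hp hpp
    classical
    have hqq := hl.proj_eq hpp
    obtain ⟨I, hI⟩ := hfin' p hp
    obtain ⟨I', hI'⟩ := hfin' p' (hqq ▸ hp)
    have h1 := hFsum p (insert i (I ∪ I')) fun j hj ↦ hI.self_of_nhds j fun hj' ↦ hj
      (Finset.mem_insert_of_mem (Finset.mem_union_left _ hj'))
    have h2 := hFsum p' (insert i (I ∪ I')) fun j hj ↦ hI'.self_of_nhds j fun hj' ↦ hj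
      (Finset.mem_insert_of_mem (Finset.mem_union_right _ hj'))
    rw [h1, h2, ← Finset.sum_sub_distrib]
    have h3 : ∀ j, g j p' - g j (s (q p')) - (g j p - g j (s (q p))) = g j p' - g j p := by
      intro j; rw [hqq]; ring
    simp only [h3]
    exact Finset.single_le_sum (f := fun j ↦ g j p' - g j p)
      (fun j _ ↦ sub_nonneg.2 (hgm j p p' hpp)) (Finset.mem_insert_self _ _)
  have hgi : ∀ i p, p ∈ (k i).1.source → (k i).2 (q p) = 1 → g i p = σ ((k i).1.coord p) := by
    intro i p hp h1
    simp only [hg, h1, one_mul, FlowBox.step_of_mem hp]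
  have hFmono : ∀ p p', q p ∈ U → r p p' → F p < F p' := by
    intro p p' hp hpp
    obtain ⟨i, hi, hic, hi1⟩ := hcov p hp
    have h1 : g i p < g i p' := by
      have := FlowBox.step_lt hl hσ (hP i).1 hi
        ⟨by linarith [(abs_lt.1 hic).1], by linarith [(abs_lt.1 hic).2]⟩ hpp
      simpa only [hg, ← hl.proj_eq hpp, hi1, one_mul] using this
    linarith [hFg i p p' hp hpp]
  -- In a box with `|coord p| < 1 / 2`, moving to coordinate `1` or `-1` changes its summand by more
  -- than `1 / 2`, and `F` changes at least as much. Repetition makes `F` unbounded above and below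
  -- on the leaf.
  have hgain : ∀ p, q p ∈ U → (∃ p', q p' = q p ∧ F p + 1 / 2 ≤ F p') ∧
      ∃ p', q p' = q p ∧ F p' ≤ F p - 1 / 2 := by
    intro p hp
    obtain ⟨i, hi, hic, hi1⟩ := hcov p hp
    have hx := (k i).1.proj_mem p hi
    have hself : g i p = (k i).1.coord p := by
      rw [hgi i p hi hi1]
      exact hσ.eq_self _ ⟨by linarith [(abs_lt.1 hic).1], by linarith [(abs_lt.1 hic).2]⟩
    have hval : ∀ t ∈ Icc (-1 : ℝ) 1, g i ((k i).1.map (q p, t)) = t := by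
      intro t ht
      rw [hgi i _ ((k i).1.map_mem _ hx t) (by rwa [(k i).1.proj_map _ hx]), (k i).1.coord_map _ hx]
      exact hσ.eq_self t ht
    refine ⟨⟨(k i).1.map (q p, 1), (k i).1.proj_map _ hx _, ?_⟩,
      ⟨(k i).1.map (q p, -1), (k i).1.proj_map _ hx _, ?_⟩⟩
    · have h1 : r p ((k i).1.map (q p, 1)) := by
        have := (hP i).1 _ hx ((k i).1.coord p) 1 (by linarith [(abs_lt.1 hic).2])
        rwa [(k i).1.map_coord p hi] at this
      have h2 := hFg i _ _ hp h1
      rw [hself, hval 1 (by norm_num)] at h2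
      linarith [(abs_lt.1 hic).2]
    · have h1 : r ((k i).1.map (q p, -1)) p := by
        have := (hP i).1 _ hx (-1) ((k i).1.coord p) (by linarith [(abs_lt.1 hic).1])
        rwa [(k i).1.map_coord p hi] at this
      have h2 := hFg i _ _ (by rwa [(k i).1.proj_map _ hx]) h1
      rw [hself, hval (-1) (by norm_num)] at h2
      linarith [(abs_lt.1 hic).1]
  refine ⟨F, h.isOpen, hFs, ?_, ?_, ?_⟩
  · intro p p' hp hqq hFF
    by_contra hne
    rcases hl.total hqq hne with h1 | h1
    · exact (hFmono p p' hp h1).ne hFF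
    · exact (hFmono p' p (hqq ▸ hp) h1).ne hFF.symm
  · intro x hx y
    have hup : ∀ n : ℕ, ∃ p, q p = x ∧ F (s x) + n * (1 / 2) ≤ F p := by
      intro n
      induction n with
      | zero => exact ⟨s x, hqs x hx, by simp⟩
      | succ n ih =>
        obtain ⟨p, rfl, hp⟩ := ih
        obtain ⟨p', hp', h1⟩ := (hgain p hx).1
        exact ⟨p', hp', by push_cast; linarith⟩
    have hdown : ∀ n : ℕ, ∃ p, q p = x ∧ F p ≤ F (s x) - n * (1 / 2) := by
      intro n
      induction n with
      | zero => exact ⟨s x, hqs x hx, by simp⟩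
      | succ n ih =>
        obtain ⟨p, rfl, hp⟩ := ih
        obtain ⟨p', hp', h1⟩ := (hgain p hx).2
        exact ⟨p', hp', by push_cast; linarith⟩
    obtain ⟨n, hn⟩ := exists_nat_ge (2 * (y - F (s x)))
    obtain ⟨m, hm⟩ := exists_nat_ge (2 * (F (s x) - y))
    obtain ⟨p, hp, hpy⟩ := hup n
    obtain ⟨p', hp', hpy'⟩ := hdown m
    have hcont : ContinuousOn F (q ⁻¹' {x}) := fun w hw ↦
      (hFs w ((show q w = x from hw).symm ▸ hx)).continuousAt.continuousWithinAt
    obtain ⟨w, hw, hwy⟩ := (hconn x).intermediate_value (a := p') (b := p) hp' hp hcont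
      (show y ∈ Icc (F p') (F p) from ⟨by linarith, by linarith⟩)
    exact ⟨w, hw, hwy⟩
  · intro p hp
    obtain ⟨i, hi, hic, hi1⟩ := hcov p hp
    have hx := (k i).1.proj_mem p hi
    refine ⟨(k i).1, hi, ?_⟩
    have hΓ := (k i).1.contMDiff_plaque hx
    have hqΓ : ∀ t, q ((k i).1.map (q p, t)) = q p := fun t ↦ (k i).1.proj_map _ hx t
    have hdF : DifferentiableAt ℝ (fun t ↦ F ((k i).1.map (q p, t))) ((k i).1.coord p) := by
      have := (hFs ((k i).1.map (q p, (k i).1.coord p)) (by rwa [hqΓ])).comp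
        ((k i).1.coord p) (f := fun t ↦ (k i).1.map (q p, t)) (hΓ _)
      exact (contMDiffAt_iff_contDiffAt.1 this).differentiableAt (by simp)
    have hdg : HasDerivAt (fun t ↦ g i ((k i).1.map (q p, t))) 1 ((k i).1.coord p) := by
      refine (hasDerivAt_id _).congr_of_eventuallyEq ?_
      filter_upwards [Icc_mem_nhds (a := -1) (b := 1) (x := (k i).1.coord p)
        (by linarith [(abs_lt.1 hic).1]) (by linarith [(abs_lt.1 hic).2])] with t ht
      rw [hgi i _ ((k i).1.map_mem _ hx t) (by rwa [hqΓ]), (k i).1.coord_map _ hx, hσ.eq_self t ht]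
      rfl
    -- The summand `g i` has derivative `1` at this point and the remainder is monotone, so the
    -- derivative of `F` is at least `1`.
    have hmono : Monotone (fun t ↦ F ((k i).1.map (q p, t)) - g i ((k i).1.map (q p, t))) := by
      intro t t' htt
      rcases htt.eq_or_lt with rfl | hlt
      · exact le_rfl
      · have := hFg i _ _ (by rwa [hqΓ]) ((hP i).1 _ hx t t' hlt)
        simp only
        linarith
    have h1 := hmono.deriv_nonneg (x := (k i).1.coord p)
    rw [deriv_fun_sub hdF hdg.differentiableAt, hdg.deriv] at h1
    intro h0
    rw [h0] at h1
    linarith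

end Steps

/-! ### From fibre coordinates to trivialisations, by implicit functions. -/

section FibreCoordinates

variable {E E' : Type*} [NormedAddCommGroup E] [NormedSpace ℝ E]
  [NormedAddCommGroup E'] [NormedSpace ℝ E']
  {N S : Type*} [TopologicalSpace N] [ChartedSpace E N] [TopologicalSpace S] [ChartedSpace E' S]
  {q : N → S}

/-- Implicit functions: a smooth real function of `(x, t)` with nonzero `t`-derivative can locally
be solved smoothly for `t`. -/
theorem exists_implicit [FiniteDimensional ℝ E'] [IsManifold 𝓘(ℝ, E') ∞ S] {G : S × ℝ → ℝ} {x₀ : S}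
    {t₀ : ℝ} (hG : ContMDiffAt (𝓘(ℝ, E').prod 𝓘(ℝ, ℝ)) 𝓘(ℝ, ℝ) ∞ G (x₀, t₀))
    (hd : deriv (fun t ↦ G (x₀, t)) t₀ ≠ 0) :
    ∃ κ : S × ℝ → ℝ, ContMDiffAt (𝓘(ℝ, E').prod 𝓘(ℝ, ℝ)) 𝓘(ℝ, ℝ) ∞ κ (x₀, G (x₀, t₀)) ∧
      ∀ᶠ z in 𝓝 (x₀, G (x₀, t₀)), G (z.1, κ z) = z.2 := by
  have : CompleteSpace E' := FiniteDimensional.complete ℝ E'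
  set φ := chartAt E' x₀ with hφ
  have hx₀ : x₀ ∈ φ.source := mem_chart_source E' x₀
  have hφx₀ : φ.symm (φ x₀) = x₀ := φ.left_inv hx₀
  set H : E' × ℝ → ℝ := fun z ↦ G (φ.symm z.1, z.2) with hH
  have hHs : ContDiffAt ℝ ∞ H (φ x₀, t₀) := by
    have h0 : ContMDiffAt 𝓘(ℝ, E') 𝓘(ℝ, E') ∞ φ.symm (φ x₀) :=
      (contMDiffOn_chart_symm (I := 𝓘(ℝ, E')) (n := ∞) (x := x₀)).contMDiffAt
        (φ.open_target.mem_nhds (φ.map_source hx₀))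
    have h1 : ContMDiffAt (𝓘(ℝ, E').prod 𝓘(ℝ, ℝ)) (𝓘(ℝ, E').prod 𝓘(ℝ, ℝ)) ∞
        (fun z : E' × ℝ ↦ (φ.symm z.1, z.2)) (φ x₀, t₀) :=
      (h0.comp (φ x₀, t₀) (f := Prod.fst) contMDiffAt_fst).prodMk contMDiffAt_snd
    have h2 : ContMDiffAt (𝓘(ℝ, E').prod 𝓘(ℝ, ℝ)) 𝓘(ℝ, ℝ) ∞ H (φ x₀, t₀) :=
      ContMDiffAt.comp (φ x₀, t₀) (g := G) (f := fun z : E' × ℝ ↦ (φ.symm z.1, z.2))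
        (by simpa only [hφx₀] using hG) h1
    rw [← contMDiffAt_iff_contDiffAt, modelWithCornersSelf_prod, ← chartedSpaceSelf_prod]
    exact h2
  set L := fderiv ℝ H (φ x₀, t₀) with hL
  have hHd : HasStrictFDerivAt H L (φ x₀, t₀) := hHs.hasStrictFDerivAt (by simp)
  have hc : deriv (fun t ↦ G (x₀, t)) t₀ = L (0, 1) := by
    have h1 : HasDerivAt (fun t : ℝ ↦ (φ x₀, t)) ((0, 1) : E' × ℝ) t₀ :=
      (hasDerivAt_const _ _).prodMk (hasDerivAt_id _)
    have h2 := hHd.hasFDerivAt.comp_hasDerivAt t₀ h1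
    have h3 : (H ∘ fun t : ℝ ↦ (φ x₀, t)) = fun t ↦ G (x₀, t) := by
      funext t; simp [hH, hφx₀]
    rw [h3] at h2
    exact h2.deriv
  rw [hc] at hd
  -- The derivative of `(y, t) ↦ (y, H (y, t))` is block triangular, with diagonal blocks the
  -- identity and the nonzero `t`-derivative. The second component of the local inverse solves for
  -- `t`.
  let A : (E' × ℝ) ≃L[ℝ] (E' × ℝ) := (ContinuousLinearEquiv.refl ℝ E').skewProd
    (ContinuousLinearEquiv.unitsEquivAut ℝ (Units.mk0 _ hd))
    (L.comp (ContinuousLinearMap.inl ℝ E' ℝ))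
  set T : E' × ℝ → E' × ℝ := fun z ↦ (z.1, H z) with hT
  have hTs : ContDiffAt ℝ ∞ T (φ x₀, t₀) := contDiffAt_fst.prodMk hHs
  have hTd : HasFDerivAt T (A : E' × ℝ →L[ℝ] E' × ℝ) (φ x₀, t₀) := by
    have h1 := (hasFDerivAt_fst (𝕜 := ℝ) (p := (φ x₀, t₀))).prodMk hHd.hasFDerivAt
    refine h1.congr_fderiv ?_
    ext v
    · simp [A]
    · simp [A]
    · simp [A]
    · simp only [ContinuousLinearMap.comp_apply, ContinuousLinearMap.inr_apply]
      simp [A]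
      exact map_zero L
  set K := hTs.localInverse hTd (by simp) with hK
  have hKs : ContDiffAt ℝ ∞ K (T (φ x₀, t₀)) := hTs.to_localInverse hTd (by simp)
  have hTK : ∀ᶠ w in 𝓝 (T (φ x₀, t₀)), T (K w) = w :=
    (hTs.hasStrictFDerivAt' hTd (by simp)).eventually_right_inverse
  have hTx₀ : T (φ x₀, t₀) = (φ x₀, G (x₀, t₀)) := by simp [hT, hH, hφx₀]
  rw [hTx₀] at hKs hTK
  have hφs : ContMDiffAt 𝓘(ℝ, E') 𝓘(ℝ, E') ∞ φ x₀ :=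
    (contMDiffOn_chart (I := 𝓘(ℝ, E')) (n := ∞) (x := x₀)).contMDiffAt
      (φ.open_source.mem_nhds hx₀)
  have hφs' : ContMDiffAt (𝓘(ℝ, E').prod 𝓘(ℝ, ℝ)) 𝓘(ℝ, E' × ℝ) ∞
      (fun z : S × ℝ ↦ (φ z.1, z.2)) (x₀, G (x₀, t₀)) := by
    rw [modelWithCornersSelf_prod, ← chartedSpaceSelf_prod]
    exact (hφs.comp (x₀, G (x₀, t₀)) (f := Prod.fst) contMDiffAt_fst).prodMk contMDiffAt_snd
  refine ⟨fun z ↦ (K (φ z.1, z.2)).2, ?_, ?_⟩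
  · exact ((contDiffAt_snd.comp _ hKs).contMDiffAt).comp (x₀, G (x₀, t₀))
      (f := fun z : S × ℝ ↦ (φ z.1, z.2)) hφs'
  · have h1 := hφs'.continuousAt.eventually hTK
    filter_upwards [h1, continuousAt_fst.eventually (φ.open_source.mem_nhds hx₀)] with z hz hzs
    have e1 : (K (φ z.1, z.2)).1 = φ z.1 := congrArg Prod.fst hz
    have e2 : H (K (φ z.1, z.2)) = z.2 := congrArg Prod.snd hz
    simp only [hH] at e2
    rwa [e1, φ.left_inv hzs] at e2

/-- A fibre coordinate over `U` makes `q ⁻¹' U` a box. -/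
theorem IsFibreCoordinate.exists_flowBox [FiniteDimensional ℝ E'] [IsManifold 𝓘(ℝ, E') ∞ S]
    [Nonempty N] {U : Set S} {F : N → ℝ}
    (hF : IsFibreCoordinate E E' q U F) (hq : Continuous q) :
    ∃ e : FlowBox E E' q, e.base = U ∧ e.source = q ⁻¹' U ∧ e.coord = F := by
  -- Over `U` this picks the unique point with the given projection and fibre coordinate; elsewhere
  -- it is an arbitrary value. By uniqueness it agrees locally with the smooth solution of the
  -- implicit equation.
  set m : S × ℝ → N := fun z ↦ Classical.epsilon fun p ↦ q p = z.1 ∧ F p = z.2 with hm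
  have hmspec : ∀ x ∈ U, ∀ t, q (m (x, t)) = x ∧ F (m (x, t)) = t := fun x hx t ↦
    Classical.epsilon_spec (hF.surjOn x hx t)
  refine ⟨{ base := U
            isOpen_base := hF.isOpen
            source := q ⁻¹' U
            isOpen_source := hF.isOpen.preimage hq
            coord := F
            map := m
            proj_mem := fun p hp ↦ hp
            map_mem := fun x hx t ↦ by rw [mem_preimage, (hmspec x hx t).1]; exact hx
            proj_map := fun x hx t ↦ (hmspec x hx t).1
            coord_map := fun x hx t ↦ (hmspec x hx t).2
            map_coord := fun p hp ↦ hF.injOn _ _ (by rw [(hmspec _ hp _).1]; exact hp)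
              (hmspec _ hp _).1 (hmspec _ hp _).2
            contMDiffOn_coord := fun p hp ↦ (hF.contMDiffAt p hp).contMDiffWithinAt
            contMDiffOn_map := ?_ }, rfl, rfl, rfl⟩
  rintro ⟨x₀, y₀⟩ ⟨hx₀ : x₀ ∈ U, -⟩
  refine ContMDiffAt.contMDiffWithinAt ?_
  obtain ⟨hqp, hFp⟩ := hmspec x₀ hx₀ y₀
  set p₀ := m (x₀, y₀) with hp₀
  have hpU : q p₀ ∈ U := hqp.symm ▸ hx₀
  obtain ⟨e, hpe, hde⟩ := hF.deriv_ne p₀ hpU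
  have hxe : x₀ ∈ e.base := hqp ▸ e.proj_mem p₀ hpe
  rw [hqp] at hde
  have hmp : e.map (x₀, e.coord p₀) = p₀ := hqp ▸ e.map_coord p₀ hpe
  have hG : ContMDiffAt (𝓘(ℝ, E').prod 𝓘(ℝ, ℝ)) 𝓘(ℝ, ℝ) ∞ (fun z ↦ F (e.map z))
      (x₀, e.coord p₀) :=
    ContMDiffAt.comp (x₀, e.coord p₀) (by rw [hmp]; exact hF.contMDiffAt p₀ hpU)
      (e.contMDiffAt_map hxe _)
  obtain ⟨κ, hκ, hκG⟩ := exists_implicit hG hde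
  simp only [hmp, hFp] at hκ hκG
  have h1 : ContMDiffAt (𝓘(ℝ, E').prod 𝓘(ℝ, ℝ)) 𝓘(ℝ, E) ∞ (fun z : S × ℝ ↦ e.map (z.1, κ z))
      (x₀, y₀) :=
    (e.contMDiffAt_map hxe _).comp (x₀, y₀) (f := fun z : S × ℝ ↦ (z.1, κ z))
      (contMDiffAt_fst.prodMk hκ)
  refine h1.congr_of_eventuallyEq ?_
  filter_upwards [hκG, continuousAt_fst.eventually (e.isOpen_base.mem_nhds hxe),
    continuousAt_fst.eventually (hF.isOpen.mem_nhds hx₀)] with z hz hze hzU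
  have h2 : q (m z) = z.1 ∧ F (m z) = z.2 := hmspec z.1 hzU z.2
  refine hF.injOn _ _ (by rw [h2.1]; exact hzU) ?_ ?_
  · rw [h2.1, e.proj_map _ hze]
  · rw [h2.2, hz]

end FibreCoordinates

/-! ### Averaging trivialisations to make the coordinate changes linear. -/

section LinearAtlases

/-- A submersion with one-dimensional fibres, all of them connected and non-compact. -/
structure IsLineFibration (E E' : Type*) [NormedAddCommGroup E] [NormedSpace ℝ E]
    [NormedAddCommGroup E'] [NormedSpace ℝ E']
    {N S : Type*} [TopologicalSpace N] [ChartedSpace E N] [TopologicalSpace S] [ChartedSpace E' S]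
    (q : N → S) : Prop where
  contMDiff : ContMDiff 𝓘(ℝ, E) 𝓘(ℝ, E') ∞ q
  hasFlowBoxes : HasFlowBoxes E E' q
  isConnected : ∀ x, IsConnected (q ⁻¹' {x})
  not_isCompact : ∀ x, ¬ IsCompact (q ⁻¹' {x})

variable {E E' : Type*} [NormedAddCommGroup E] [NormedSpace ℝ E]
  [NormedAddCommGroup E'] [NormedSpace ℝ E']
  {N S : Type*} [TopologicalSpace N] [ChartedSpace E N] [TopologicalSpace S] [ChartedSpace E' S]
  {q : N → S}

/-- A line fibration is locally trivial. -/
theorem IsLineFibration.exists_full_flowBox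
    [FiniteDimensional ℝ E] [FiniteDimensional ℝ E'] [T2Space N] [SecondCountableTopology N]
    [T2Space S] [IsManifold 𝓘(ℝ, E') ∞ S] (h : IsLineFibration E E' q) (x : S) :
    ∃ e : FlowBox E E' q, x ∈ e.base ∧ e.source = q ⁻¹' e.base := by
  obtain ⟨p, rfl : q p = x⟩ := (h.isConnected x).nonempty
  obtain ⟨e₀, hp, -, -⟩ := h.hasFlowBoxes p univ univ_mem
  obtain ⟨r, hr⟩ := e₀.exists_isOrientedLeafOrder h.contMDiff.continuous h.hasFlowBoxes
    h.isConnected h.not_isCompact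
  obtain ⟨F, hF⟩ := hr.exists_isFibreCoordinate h.hasFlowBoxes h.contMDiff
    (fun x ↦ (h.isConnected x).isPreconnected) (s := fun x ↦ e₀.map (x, 0))
    (fun x hx ↦ e₀.contMDiffAt_section hx 0) (fun x hx ↦ e₀.proj_map x hx 0)
  have : Nonempty N := ⟨p⟩
  obtain ⟨e, heb, hes, -⟩ := hF.exists_flowBox h.contMDiff.continuous
  exact ⟨e, heb ▸ e₀.proj_mem p hp, by rw [hes, heb]⟩

/-- A cover of `N` by full boxes whose fibre coordinates are related by linear transformations. -/
structure LinearAtlas (E E' : Type*) [NormedAddCommGroup E] [NormedSpace ℝ E]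
    [NormedAddCommGroup E'] [NormedSpace ℝ E']
    {N S : Type*} [TopologicalSpace N] [ChartedSpace E N] [TopologicalSpace S] [ChartedSpace E' S]
    (q : N → S) where
  /-- the boxes of the atlas -/
  box : S → FlowBox E E' q
  mem_base : ∀ x, x ∈ (box x).base
  source_eq : ∀ i, (box i).source = q ⁻¹' (box i).base
  coord_map : ∀ i j, ∀ x ∈ (box i).base, x ∈ (box j).base → ∀ t,
    (box j).coord ((box i).map (x, t)) = (box j).coord ((box i).map (x, 1)) * t

/-- The sign of the increment of a function over the unit interval. -/
noncomputable def incrementSign (u : ℝ → ℝ) : ℝ := (u 1 - u 0) / |u 1 - u 0|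

theorem incrementSign_of_strictMono {u : ℝ → ℝ} (h : StrictMono u) : incrementSign u = 1 := by
  have : 0 < u 1 - u 0 := sub_pos.2 (h one_pos)
  rw [incrementSign, abs_of_pos this, div_self this.ne']

theorem incrementSign_of_strictAnti {u : ℝ → ℝ} (h : StrictAnti u) : incrementSign u = -1 := by
  have : u 1 - u 0 < 0 := sub_neg.2 (h one_pos)
  rw [incrementSign, abs_of_neg this, div_neg, div_self this.ne]

/-- Orientation signs multiply under composition; for transition functions this is the cocycle
identity. -/
theorem incrementSign_comp {u v : ℝ → ℝ} (hu : StrictMono u ∨ StrictAnti u)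
    (hv : StrictMono v ∨ StrictAnti v) :
    incrementSign (u ∘ v) = incrementSign v * incrementSign u := by
  rcases hu with hu | hu <;> rcases hv with hv | hv
  · rw [incrementSign_of_strictMono hu, incrementSign_of_strictMono hv,
      incrementSign_of_strictMono (hu.comp hv), one_mul]
  · rw [incrementSign_of_strictMono hu, incrementSign_of_strictAnti hv,
      incrementSign_of_strictAnti (hu.comp_strictAnti hv), mul_one]
  · rw [incrementSign_of_strictAnti hu, incrementSign_of_strictMono hv,
      incrementSign_of_strictAnti (hu.comp_strictMono hv), one_mul]
  · rw [incrementSign_of_strictAnti hu, incrementSign_of_strictAnti hv,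
      incrementSign_of_strictMono (hu.comp hv)]
    norm_num

theorem strictMono_incrementSign_mul {u : ℝ → ℝ} (hu : StrictMono u ∨ StrictAnti u) :
    StrictMono (fun t ↦ incrementSign u * u t) := by
  rcases hu with hu | hu
  · simpa only [incrementSign_of_strictMono hu, one_mul] using hu
  · simpa only [incrementSign_of_strictAnti hu, neg_one_mul] using hu.neg

theorem incrementSign_mul_self {u : ℝ → ℝ} (hu : StrictMono u ∨ StrictAnti u) :
    incrementSign u * incrementSign u = 1 := by
  rcases hu with hu | hu
  · simp only [incrementSign_of_strictMono hu, one_mul]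
  · simp only [incrementSign_of_strictAnti hu]; norm_num

namespace FlowBox

variable {e e' e'' : FlowBox E E' q}

/-- The transition function between the fibre coordinates of two boxes. -/
def transition (e e' : FlowBox E E' q) (x : S) (t : ℝ) : ℝ := e'.coord (e.map (x, t))

theorem map_transition (hs' : e'.source = q ⁻¹' e'.base) {x : S} (hx : x ∈ e.base)
    (hx' : x ∈ e'.base) (t : ℝ) : e'.map (x, e.transition e' x t) = e.map (x, t) := by
  have h1 : e.map (x, t) ∈ e'.source := by rw [hs', mem_preimage, e.proj_map x hx]; exact hx'
  have h2 := e'.map_coord _ h1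
  rwa [e.proj_map x hx] at h2

theorem transition_comp (hs' : e'.source = q ⁻¹' e'.base) {x : S} (hx : x ∈ e.base)
    (hx' : x ∈ e'.base) : e'.transition e'' x ∘ e.transition e' x = e.transition e'' x := by
  funext t
  simp only [comp_apply]
  rw [transition, map_transition hs' hx hx', transition]

theorem transition_self {x : S} (hx : x ∈ e.base) (t : ℝ) : e.transition e x t = t :=
  e.coord_map x hx t

theorem contMDiffAt_transition (hs' : e'.source = q ⁻¹' e'.base) {x : S} (hx : x ∈ e.base)
    (hx' : x ∈ e'.base) (t : ℝ) : ContMDiffAt (𝓘(ℝ, E').prod 𝓘(ℝ, ℝ)) 𝓘(ℝ, ℝ) ∞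
      (fun z : S × ℝ ↦ e.transition e' z.1 z.2) (x, t) := by
  have h1 : e.map (x, t) ∈ e'.source := by rw [hs', mem_preimage, e.proj_map x hx]; exact hx'
  exact (e'.contMDiffAt_coord h1).comp (x, t) (e.contMDiffAt_map hx t)

theorem contDiff_transition (hs' : e'.source = q ⁻¹' e'.base) {x : S} (hx : x ∈ e.base)
    (hx' : x ∈ e'.base) : ContDiff ℝ ∞ (e.transition e' x) := by
  rw [← contMDiff_iff_contDiff]
  exact fun t ↦ (contMDiffAt_transition hs' hx hx' t).comp t (f := fun t ↦ (x, t))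
    (contMDiffAt_const.prodMk contMDiffAt_id)

theorem contMDiffAt_transition_const (hs' : e'.source = q ⁻¹' e'.base) {x : S} (hx : x ∈ e.base)
    (hx' : x ∈ e'.base) (t : ℝ) :
    ContMDiffAt 𝓘(ℝ, E') 𝓘(ℝ, ℝ) ∞ (fun y ↦ e.transition e' y t) x :=
  (contMDiffAt_transition hs' hx hx' t).comp x (f := fun y ↦ (y, t))
    (contMDiffAt_id.prodMk contMDiffAt_const)

/-- The reverse transition is a left inverse, and a continuous injective real function is strictly
monotone. -/
theorem transition_strict (hs' : e'.source = q ⁻¹' e'.base) {x : S}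
    (hx : x ∈ e.base) (hx' : x ∈ e'.base) :
    StrictMono (e.transition e' x) ∨ StrictAnti (e.transition e' x) := by
  refine (contDiff_transition hs' hx hx').continuous.strictMono_of_inj fun s t hst ↦ ?_
  have h1 := congrFun (transition_comp (e'' := e) hs' hx hx')
  have h2 := h1 s
  rw [comp_apply, hst, ← comp_apply (f := e'.transition e x), h1 t, transition_self hx,
    transition_self hx] at h2
  exact h2.symm

/-- The chain rule for the transition and its inverse. -/
theorem deriv_transition_ne_zero (hs : e.source = q ⁻¹' e.base) (hs' : e'.source = q ⁻¹' e'.base)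
    {x : S} (hx : x ∈ e.base) (hx' : x ∈ e'.base) (t : ℝ) : deriv (e.transition e' x) t ≠ 0 := by
  intro h0
  have h1 : e'.transition e x ∘ e.transition e' x = id := by
    rw [transition_comp hs' hx hx']
    exact funext fun t ↦ transition_self hx t
  have h2 := deriv_comp t
    ((contDiff_transition hs hx' hx).differentiable (by simp)).differentiableAt
    ((contDiff_transition hs' hx hx').differentiable (by simp)).differentiableAt
  rw [h1, deriv_id, h0, mul_zero] at h2
  exact one_ne_zero h2

end FlowBox

/-- A line fibration has a linear atlas. -/
theorem IsLineFibration.exists_linearAtlas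
    [FiniteDimensional ℝ E] [FiniteDimensional ℝ E'] [T2Space N] [SecondCountableTopology N]
    [T2Space S] [SecondCountableTopology S] [IsManifold 𝓘(ℝ, E') ∞ S]
    (h : IsLineFibration E E' q) : Nonempty (LinearAtlas E E' q) := by
  have hqc := h.contMDiff.continuous
  choose b hbx hbs using h.exists_full_flowBox
  have : LocallyCompactSpace S := ChartedSpace.locallyCompactSpace E' S
  obtain ⟨χ, hχ⟩ := SmoothPartitionOfUnity.exists_isSubordinate 𝓘(ℝ, E') (s := univ) isClosed_univ
    (fun x ↦ (b x).base) (fun x ↦ (b x).isOpen_base) (fun x _ ↦ mem_iUnion.2 ⟨x, hbx x⟩)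
  have hχb : ∀ i x, χ i x ≠ 0 → x ∈ (b i).base := fun i x hx ↦ hχ i (subset_tsupport _ hx)
  set ε : S → S → S → ℝ := fun j i x ↦ incrementSign ((b j).transition (b i) x) with hε
  have hstrict : ∀ j i x, x ∈ (b j).base → x ∈ (b i).base →
      StrictMono ((b j).transition (b i) x) ∨ StrictAnti ((b j).transition (b i) x) :=
    fun j i x hj hi ↦ FlowBox.transition_strict (hbs i) hj hi
  have hcocycle : ∀ k j i x, x ∈ (b k).base → x ∈ (b j).base → x ∈ (b i).base →
      ε k i x = ε k j x * ε j i x := by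
    intro k j i x hk hj hi
    simp only [hε]
    rw [← FlowBox.transition_comp (hbs j) hk hj, incrementSign_comp (hstrict j i x hj hi)
      (hstrict k j x hk hj)]
  have hεs : ∀ j i x, x ∈ (b j).base → x ∈ (b i).base →
      ContMDiffAt 𝓘(ℝ, E') 𝓘(ℝ, ℝ) ∞ (ε j i) x := by
    intro j i x hj hi
    have h1 : ContMDiffAt 𝓘(ℝ, E') 𝓘(ℝ, ℝ) ∞
        (fun y ↦ (b j).transition (b i) y 1 - (b j).transition (b i) y 0) x :=
      (FlowBox.contMDiffAt_transition_const (hbs i) hj hi 1).sub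
        (FlowBox.contMDiffAt_transition_const (hbs i) hj hi 0)
    have h2 : (b j).transition (b i) x 1 - (b j).transition (b i) x 0 ≠ 0 := by
      rcases hstrict j i x hj hi with h | h
      · exact (sub_pos.2 (h one_pos)).ne'
      · exact (sub_neg.2 (h one_pos)).ne
    -- Writing the sign as a quotient makes its smoothness in the base point immediate, since the
    -- increment does not vanish.
    have h3 : ContDiffAt ℝ ∞ (fun d : ℝ ↦ d / |d|)
        ((b j).transition (b i) x 1 - (b j).transition (b i) x 0) :=
      contDiffAt_id.div (contDiffAt_abs h2) (abs_ne_zero.2 h2)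
    exact h3.contMDiffAt.comp x h1
  -- All box coordinates over the point are oriented like box `j` and averaged. On a leaf this is a
  -- convex combination of increasing diffeomorphisms of `ℝ`, hence again one; its dependence on `j`
  -- is a sign.
  set F : S → N → ℝ := fun j p ↦ ∑ᶠ i, χ i (q p) * (ε j i (q p) * (b i).coord p) with hF
  -- the new coordinates in the old ones
  have hlt : ∀ x, ∃ I : Finset S, (∀ i ∈ I, χ i x ≠ 0) ∧ ∑ i ∈ I, χ i x = 1 ∧
      ∀ f : S → ℝ, ∑ᶠ i, χ i x * f i = ∑ i ∈ I, χ i x * f i := by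
    intro x
    have hfin : (support fun i ↦ χ i x).Finite := χ.locallyFinite.point_finite x
    have hI : ∀ f : S → ℝ, ∑ᶠ i, χ i x * f i = ∑ i ∈ hfin.toFinset, χ i x * f i := by
      intro f
      refine finsum_eq_sum_of_support_subset _ fun i hi ↦ ?_
      rw [Finite.coe_toFinset]
      exact left_ne_zero_of_mul hi
    refine ⟨hfin.toFinset, fun i hi ↦ by simpa using hi, ?_, hI⟩
    have := hI fun _ ↦ 1
    simp only [mul_one] at this
    rw [← this]
    exact χ.sum_eq_one (mem_univ x)
  have hFmap : ∀ j, ∀ x ∈ (b j).base, ∀ t, F j ((b j).map (x, t)) =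
      ∑ᶠ i, χ i x * (ε j i x * (b j).transition (b i) x t) := by
    intro j x hx t
    simp only [hF, (b j).proj_map x hx, FlowBox.transition]
  have hFmono : ∀ j, ∀ x ∈ (b j).base, StrictMono fun t ↦ F j ((b j).map (x, t)) := by
    intro j x hx s t hst
    obtain ⟨I, hI, hI1, hIf⟩ := hlt x
    simp only [hFmap j x hx, hIf]
    have hne : I.Nonempty := by
      rw [Finset.nonempty_iff_ne_empty]
      rintro rfl
      simp at hI1
    refine Finset.sum_lt_sum_of_nonempty hne fun i hi ↦ ?_
    refine mul_lt_mul_of_pos_left ?_ (lt_of_le_of_ne (χ.nonneg i x) (hI i hi).symm)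
    exact strictMono_incrementSign_mul (hstrict j i x hx (hχb i x (hI i hi))) hst
  have hFcoord : ∀ j, IsFibreCoordinate E E' q (b j).base (F j) := by
    intro j
    refine ⟨(b j).isOpen_base, ?_, ?_, ?_, ?_⟩
    · intro p hp
      have hlf : LocallyFinite fun i ↦
          support fun p ↦ χ i (q p) * (ε j i (q p) * (b i).coord p) :=
        (χ.locallyFinite.preimage_continuous hqc).subset fun i p hp ↦ left_ne_zero_of_mul hp
      refine contMDiffAt_finsum hlf fun i ↦ ?_
      by_cases hi : q p ∈ tsupport (χ i)
      · have hpi := hχ i hi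
        refine ((χ i).contMDiff.contMDiffAt.comp p h.contMDiff.contMDiffAt).mul
          (((hεs j i (q p) hp hpi).comp p h.contMDiff.contMDiffAt).mul
            ((b i).contMDiffAt_coord ?_))
        rw [hbs i]; exact hpi
      · refine (contMDiffAt_const (c := (0 : ℝ))).congr_of_eventuallyEq ?_
        filter_upwards [hqc.continuousAt ((isClosed_tsupport _).isOpen_compl.mem_nhds hi)] with w hw
        rw [image_eq_zero_of_notMem_tsupport hw, zero_mul]
    · intro p p' hp hqq hFF
      have hps : p ∈ (b j).source := by rw [hbs]; exact hp
      have hps' : p' ∈ (b j).source := by rw [hbs]; exact (hqq ▸ hp : q p' ∈ _)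
      have h1 := (b j).map_coord p hps
      have h2 := (b j).map_coord p' hps'
      rw [← hqq] at h2
      rw [← h1, ← h2] at hFF ⊢
      rw [(hFmono j _ hp).injective hFF]
    · intro x hx y
      obtain ⟨I, hI, hI1, hIf⟩ := hlt x
      have hcont : Continuous fun t ↦ F j ((b j).map (x, t)) := by
        simp only [hFmap j x hx, hIf]
        refine continuous_finsetSum _ fun i hi ↦ continuous_const.mul (continuous_const.mul ?_)
        exact (FlowBox.contDiff_transition (hbs i) hx (hχb i x (hI i hi))).continuous
      -- each summand takes every value
      have hsurj : ∀ i ∈ I, ∃ t, ε j i x * (b j).transition (b i) x t = y := by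
        intro i hi
        have hxi := hχb i x (hI i hi)
        have hsq : ε j i x * ε j i x = 1 := incrementSign_mul_self (hstrict j i x hx hxi)
        refine ⟨(b i).transition (b j) x (ε j i x * y), ?_⟩
        have := congrFun (FlowBox.transition_comp (e'' := b i) (hbs j) hxi hx) (ε j i x * y)
        rw [comp_apply, FlowBox.transition_self hxi] at this
        rw [this, ← mul_assoc, hsq, one_mul]
      choose! τ hτ using hsurj
      have hmono : ∀ i ∈ I, StrictMono fun t ↦ ε j i x * (b j).transition (b i) x t := fun i hi ↦
        strictMono_incrementSign_mul (hstrict j i x hx (hχb i x (hI i hi)))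
      have hcomb : ∑ i ∈ I, χ i x * y = y := by rw [← Finset.sum_mul, hI1, one_mul]
      -- Beyond all `τ i` every averaged function is at least `y`, and so is their convex
      -- combination; before all of them it is at most `y`.
      obtain ⟨a, ha⟩ := I.image τ |>.bddAbove
      obtain ⟨c, hc⟩ := I.image τ |>.bddBelow
      have hup : y ≤ F j ((b j).map (x, a)) := by
        rw [hFmap j x hx, hIf, ← hcomb]
        refine Finset.sum_le_sum fun i hi ↦ mul_le_mul_of_nonneg_left ?_ (χ.nonneg i x)
        have := (hmono i hi).monotone (ha (Finset.mem_coe.2 (Finset.mem_image_of_mem τ hi)))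
        simp only [hτ i hi] at this
        exact this
      have hdown : F j ((b j).map (x, c)) ≤ y := by
        rw [hFmap j x hx, hIf, ← hcomb]
        refine Finset.sum_le_sum fun i hi ↦ mul_le_mul_of_nonneg_left ?_ (χ.nonneg i x)
        have := (hmono i hi).monotone (hc (Finset.mem_coe.2 (Finset.mem_image_of_mem τ hi)))
        simp only [hτ i hi] at this
        exact this
      obtain ⟨t, ht⟩ := mem_range_of_exists_le_of_exists_ge hcont ⟨c, hdown⟩ ⟨a, hup⟩
      exact ⟨_, (b j).proj_map x hx t, ht⟩
    · intro p hp
      have hps : p ∈ (b j).source := by rw [hbs]; exact hp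
      refine ⟨b j, hps, ne_of_gt ?_⟩
      obtain ⟨I, hI, hI1, hIf⟩ := hlt (q p)
      simp only [hFmap j _ hp, hIf]
      have hdiff : ∀ i ∈ I, DifferentiableAt ℝ (fun t ↦ χ i (q p) *
          (ε j i (q p) * (b j).transition (b i) (q p) t)) ((b j).coord p) := fun i hi ↦
        ((((FlowBox.contDiff_transition (hbs i) hp (hχb i _ (hI i hi))).differentiable
          (by simp)).differentiableAt).const_mul _).const_mul _
      rw [deriv_fun_sum hdiff]
      have hne : I.Nonempty := by
        rw [Finset.nonempty_iff_ne_empty]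
        rintro rfl
        simp at hI1
      refine Finset.sum_pos (fun i hi ↦ ?_) hne
      have hxi := hχb i _ (hI i hi)
      have hst := hstrict j i _ hp hxi
      have hd := ((FlowBox.contDiff_transition (hbs i) hp hxi).differentiable
          (by simp)).differentiableAt (x := (b j).coord p)
      rw [deriv_const_mul _ (hd.const_mul _)]
      refine mul_pos (lt_of_le_of_ne (χ.nonneg i _) (hI i hi).symm) ?_
      refine lt_of_le_of_ne (strictMono_incrementSign_mul hst).monotone.deriv_nonneg ?_
      rw [deriv_const_mul _ hd]
      refine (mul_ne_zero ?_ (FlowBox.deriv_transition_ne_zero (hbs j) (hbs i) hp hxi _)).symm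
      exact left_ne_zero_of_mul_eq_one (incrementSign_mul_self hst)
  -- The factor `ε k j` comes out of every summand by the cocycle identity, so the new coordinate
  -- changes are multiplications by a sign.
  have hFchange : ∀ k j p, q p ∈ (b k).base → q p ∈ (b j).base →
      F k p = ε k j (q p) * F j p := by
    intro k j p hk hj
    obtain ⟨I, hI, -, hIf⟩ := hlt (q p)
    simp only [hF]
    rw [hIf, hIf, Finset.mul_sum]
    refine Finset.sum_congr rfl fun i hi ↦ ?_
    rw [hcocycle k j i _ hk hj (hχb i _ (hI i hi))]
    ring
  have hbox : ∀ j, ∃ e : FlowBox E E' q, e.base = (b j).base ∧ e.source = q ⁻¹' (b j).base ∧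
      e.coord = F j := by
    intro j
    have : Nonempty N := ⟨(h.isConnected j).nonempty.some⟩
    exact (hFcoord j).exists_flowBox hqc
  choose B hBb hBs hBc using hbox
  refine ⟨⟨B, fun x ↦ by rw [hBb]; exact hbx x, fun i ↦ by rw [hBs, hBb], ?_⟩⟩
  intro i j x hi hj t
  have hmap : ∀ t, (B j).coord ((B i).map (x, t)) = ε j i x * t := by
    intro t
    have hqx : q ((B i).map (x, t)) = x := (B i).proj_map x hi t
    rw [hBc, hFchange j i _ (by rw [hqx, ← hBb]; exact hj) (by rw [hqx, ← hBb]; exact hi), hqx,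
      ← hBc, (B i).coord_map x hi]
  rw [hmap t, hmap 1, mul_one]

namespace LinearAtlas

variable (A : LinearAtlas E E' q)

theorem coord_eq {i j : S} {p : N} (hi : q p ∈ (A.box i).base) (hj : q p ∈ (A.box j).base) :
    (A.box j).coord p =
      (A.box j).coord ((A.box i).map (q p, 1)) * (A.box i).coord p := by
  have hp : p ∈ (A.box i).source := by rw [A.source_eq]; exact hi
  conv_lhs => rw [← (A.box i).map_coord p hp]
  rw [A.coord_map i j _ hi hj]

theorem map_eq {i j : S} {x : S} (hi : x ∈ (A.box i).base) (hj : x ∈ (A.box j).base) (t : ℝ) :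
    (A.box i).map (x, t) = (A.box j).map (x, (A.box j).coord ((A.box i).map (x, 1)) * t) := by
  rw [← A.coord_map i j x hi hj]
  exact (FlowBox.map_transition (A.source_eq j) hi hj t).symm

/-- The zero section of a linear atlas. -/
def zeroSection (x : S) : N := (A.box x).map (x, 0)

/-- Linear coordinate changes fix `0`, so all boxes agree on this point; this makes the zero section
smooth. -/
theorem zeroSection_eq {i x : S} (hi : x ∈ (A.box i).base) :
    A.zeroSection x = (A.box i).map (x, 0) := by
  rw [zeroSection, A.map_eq (A.mem_base x) hi, mul_zero]

theorem proj_zeroSection (x : S) : q (A.zeroSection x) = x :=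
  (A.box x).proj_map x (A.mem_base x) 0

theorem contMDiff_zeroSection : ContMDiff 𝓘(ℝ, E') 𝓘(ℝ, E) ∞ A.zeroSection := by
  intro x
  refine ((A.box x).contMDiffAt_section (A.mem_base x) 0).congr_of_eventuallyEq ?_
  filter_upwards [(A.box x).isOpen_base.mem_nhds (A.mem_base x)] with y hy using A.zeroSection_eq hy

end LinearAtlas

/-- Move the zero section of a box. -/
def FlowBox.translate (e : FlowBox E E' q) (hs' : e.source = q ⁻¹' e.base)
    (hq : ContMDiff 𝓘(ℝ, E) 𝓘(ℝ, E') ∞ q) {s : S → N}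
    (hs : ContMDiff 𝓘(ℝ, E') 𝓘(ℝ, E) ∞ s) (hqs : ∀ x, q (s x) = x) : FlowBox E E' q where
  base := e.base
  isOpen_base := e.isOpen_base
  source := e.source
  isOpen_source := e.isOpen_source
  coord p := e.coord p - e.coord (s (q p))
  map z := e.map (z.1, z.2 + e.coord (s z.1))
  proj_mem := e.proj_mem
  map_mem x hx t := e.map_mem x hx _
  proj_map x hx t := e.proj_map x hx _
  coord_map x hx t := by
    simp only [e.proj_map x hx, e.coord_map x hx, add_sub_cancel_right]
  map_coord p hp := by
    simp only [sub_add_cancel]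
    exact e.map_coord p hp
  contMDiffOn_coord := by
    refine e.contMDiffOn_coord.sub
      (e.contMDiffOn_coord.comp (hs.comp hq).contMDiffOn fun p hp ↦ ?_)
    simp only [hs', mem_preimage, hqs]
    exact e.proj_mem p hp
  contMDiffOn_map := by
    have h1 : ContMDiffOn 𝓘(ℝ, E') 𝓘(ℝ, ℝ) ∞ (fun x ↦ e.coord (s x)) e.base :=
      e.contMDiffOn_coord.comp hs.contMDiffOn fun x hx ↦ by
        rw [mem_preimage, hs', mem_preimage, hqs]; exact hx
    refine e.contMDiffOn_map.comp (contMDiffOn_fst.prodMk (contMDiffOn_snd.add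
      (h1.comp contMDiffOn_fst fun z hz ↦ hz.1))) fun z hz ↦ ⟨hz.1, mem_univ _⟩

/-- Move the zero section of a linear atlas. -/
def LinearAtlas.translate (A : LinearAtlas E E' q)
    (hq : ContMDiff 𝓘(ℝ, E) 𝓘(ℝ, E') ∞ q) {s : S → N}
    (hs : ContMDiff 𝓘(ℝ, E') 𝓘(ℝ, E) ∞ s) (hqs : ∀ x, q (s x) = x) : LinearAtlas E E' q where
  box i := (A.box i).translate (A.source_eq i) hq hs hqs
  mem_base := A.mem_base
  source_eq := A.source_eq
  coord_map i j x hi hj t := by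
    have h1 := fun u ↦ A.coord_map i j x hi hj u
    -- The shifts `coord (s x)` in two boxes are related by the same factor as the coordinates, so
    -- translation keeps the changes linear.
    have h2 := A.coord_eq (p := s x) (i := i) (j := j) (by rwa [hqs]) (by rwa [hqs])
    rw [hqs] at h2
    have h3 := fun u ↦ (A.box i).proj_map x hi u
    simp only [FlowBox.translate, h3]
    rw [h1, h1 (1 + _), h2]
    ring

theorem LinearAtlas.translate_zeroSection (A : LinearAtlas E E' q)
    (hq : ContMDiff 𝓘(ℝ, E) 𝓘(ℝ, E') ∞ q) {s : S → N}
    (hs : ContMDiff 𝓘(ℝ, E') 𝓘(ℝ, E) ∞ s) (hqs : ∀ x, q (s x) = x) (x : S) :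
    (A.translate hq hs hqs).zeroSection x = s x := by
  have h1 : s x ∈ (A.box x).source := by
    rw [A.source_eq, mem_preimage, hqs]; exact A.mem_base x
  have h2 := (A.box x).map_coord _ h1
  rw [hqs] at h2
  simp only [LinearAtlas.zeroSection, LinearAtlas.translate, FlowBox.translate, zero_add]
  exact h2

end LinearAtlases

/-! ### The line bundle of a linear atlas. -/

section LineBundleOfAtlas

variable {E E' : Type*} [NormedAddCommGroup E] [NormedSpace ℝ E]
  [NormedAddCommGroup E'] [NormedSpace ℝ E']
  {N S : Type*} [TopologicalSpace N] [ChartedSpace E N] [TopologicalSpace S] [ChartedSpace E' S]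
  {q : N → S}

namespace LinearAtlas

variable (A : LinearAtlas E E' q)

/-- The factor relating the fibre coordinates of two boxes. -/
def factor (i j x : S) : ℝ := (A.box j).coord ((A.box i).map (x, 1))

theorem factor_self {i x : S} (hi : x ∈ (A.box i).base) : A.factor i i x = 1 :=
  (A.box i).coord_map x hi 1

theorem factor_mul {i j k x : S} (hi : x ∈ (A.box i).base) (hj : x ∈ (A.box j).base)
    (hk : x ∈ (A.box k).base) : A.factor j k x * A.factor i j x = A.factor i k x := by
  have hx := (A.box i).proj_map x hi 1
  have := A.coord_eq (p := (A.box i).map (x, 1)) (i := j) (j := k) (by rwa [hx]) (by rwa [hx])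
  rw [hx] at this
  exact this.symm

theorem contMDiffOn_factor (i j : S) :
    ContMDiffOn 𝓘(ℝ, E') 𝓘(ℝ, ℝ) ∞ (A.factor i j) ((A.box i).base ∩ (A.box j).base) :=
  fun _ hx ↦ (FlowBox.contMDiffAt_transition_const (A.source_eq j) hx.1 hx.2 1).contMDiffWithinAt

/-- The vector bundle core with the factors of a linear atlas as coordinate changes. -/
noncomputable def core : VectorBundleCore ℝ S ℝ S where
  baseSet i := (A.box i).base
  isOpen_baseSet i := (A.box i).isOpen_base
  indexAt x := x
  mem_baseSet_at := A.mem_base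
  coordChange i j x := ContinuousLinearMap.toSpanSingleton ℝ (A.factor i j x)
  coordChange_self i x hx v := by simp [A.factor_self hx]
  continuousOn_coordChange i j :=
    (ContinuousLinearMap.toSpanSingletonCLE (𝕜 := ℝ) (E := ℝ)).continuous.comp_continuousOn
      (A.contMDiffOn_factor i j).continuousOn
  coordChange_comp i j k x hx v := by
    simp only [ContinuousLinearMap.toSpanSingleton_apply, smul_eq_mul]
    rw [← A.factor_mul hx.1.1 hx.1.2 hx.2]
    ring

theorem core_coordChange_apply (i j x : S) (v : ℝ) :
    A.core.coordChange i j x v = A.factor i j x * v := by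
  simp [core, mul_comm]

instance isContMDiff_core : A.core.IsContMDiff 𝓘(ℝ, E') ∞ where
  contMDiffOn_coordChange i j :=
    (ContinuousLinearMap.toSpanSingletonCLE (𝕜 := ℝ) (E := ℝ)).contDiff.contMDiff.comp_contMDiffOn
      (A.contMDiffOn_factor i j)

/-- The linear identification of the vector bundle of a linear atlas with `N`. -/
noncomputable def coreDiffeomorph (hq : ContMDiff 𝓘(ℝ, E) 𝓘(ℝ, E') ∞ q) :
    TotalSpace ℝ A.core.Fiber ≃ₘ^∞⟮𝓘(ℝ, E').prod 𝓘(ℝ, ℝ), 𝓘(ℝ, E)⟯ N where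
  toFun p := (A.box p.1).map (p.1, p.2)
  invFun p := ⟨q p, (A.box (q p)).coord p⟩
  left_inv p := by
    have h1 := (A.box p.1).proj_map p.1 (A.mem_base p.1) p.2
    refine TotalSpace.ext h1 ?_
    simp only [h1]
    exact heq_of_eq ((A.box p.1).coord_map p.1 (A.mem_base p.1) p.2)
  right_inv p := (A.box (q p)).map_coord p (by rw [A.source_eq]; exact A.mem_base _)
  contMDiff_toFun := by
    intro p₀
    have h0 : ContMDiffAt (𝓘(ℝ, E').prod 𝓘(ℝ, ℝ)) (𝓘(ℝ, E').prod 𝓘(ℝ, ℝ)) ∞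
      (id : TotalSpace ℝ A.core.Fiber → TotalSpace ℝ A.core.Fiber) p₀ := contMDiffAt_id
    rw [contMDiffAt_totalSpace] at h0
    have h1 := ((A.box p₀.1).contMDiffAt_map (A.mem_base p₀.1)
      (A.core.localTriv p₀.1 p₀).2).comp p₀ (f := fun p : TotalSpace ℝ A.core.Fiber ↦
        (p.1, (A.core.localTriv p₀.1 p).2)) (h0.1.prodMk h0.2)
    refine h1.congr_of_eventuallyEq ?_
    filter_upwards [h0.1.continuousAt.preimage_mem_nhds
      ((A.box p₀.1).isOpen_base.mem_nhds (A.mem_base p₀.1))] with p hp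
    -- The formula for the map uses the box indexed by `p.1`, which varies with `p`. Linear
    -- coordinate change rewrites it in the fixed box at `p₀.1`, where it is smooth.
    refine (A.map_eq (A.mem_base p.1) hp p.2).trans ?_
    exact congrArg (fun t ↦ (A.box p₀.1).map (p.1, t))
      (A.core_coordChange_apply p.1 p₀.1 p.1 p.2).symm
  contMDiff_invFun := by
    intro p₀
    rw [contMDiffAt_totalSpace]
    refine ⟨hq p₀, ?_⟩
    refine ((A.box (q p₀)).contMDiffAt_coord
      (by rw [A.source_eq]; exact A.mem_base _)).congr_of_eventuallyEq ?_
    filter_upwards [(hq p₀).continuousAt.preimage_mem_nhds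
      ((A.box (q p₀)).isOpen_base.mem_nhds (A.mem_base (q p₀)))] with p hp
    rw [A.coord_eq (A.mem_base _) hp]
    exact A.core_coordChange_apply _ _ _ _

end LinearAtlas

/-- A map with full boxes is a fibre bundle with typical fibre `ℝ`. -/
theorem isRealFibreBundle_of_flowBox
    (h : ∀ x, ∃ e : FlowBox E E' q, x ∈ e.base ∧ e.source = q ⁻¹' e.base)
    (hq : ContMDiff 𝓘(ℝ, E) 𝓘(ℝ, E') ∞ q) :
    IsRealFibreBundle 𝓘(ℝ, E) 𝓘(ℝ, E') q := by
  intro x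
  obtain ⟨e, hx, hes⟩ := h x
  refine ⟨{
    toFun p := (q p, e.coord p)
    invFun := e.map
    source := q ⁻¹' e.base
    target := e.base ×ˢ univ
    map_source' p hp := ⟨hp, mem_univ _⟩
    map_target' z hz := by rw [mem_preimage, e.proj_map _ hz.1]; exact hz.1
    left_inv' p hp := e.map_coord p (hes ▸ hp)
    right_inv' z hz := by rw [e.proj_map _ hz.1, e.coord_map _ hz.1]
    open_source := hes ▸ e.isOpen_source
    open_target := e.isOpen_base.prod isOpen_univ
    continuousOn_toFun := hq.continuous.continuousOn.prodMk
      (e.contMDiffOn_coord.continuousOn.mono hes.ge)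
    continuousOn_invFun := e.contMDiffOn_map.continuousOn
    baseSet := e.base
    open_baseSet := e.isOpen_base
    source_eq := rfl
    target_eq := rfl
    proj_toFun p _ := rfl }, hx, ?_, e.contMDiffOn_map⟩
  exact hq.contMDiffOn.prodMk (e.contMDiffOn_coord.mono hes.ge)

end LineBundleOfAtlas

/-- A line fibration with a section comes from a line bundle with its zero section. -/
theorem exists_lineBundle_diffeomorph {n : ℕ}
    {N : Type*} [TopologicalSpace N] [ChartedSpace (EuclideanSpace ℝ (Fin (n + 1))) N]
    {S : Type*} [TopologicalSpace S] [ChartedSpace (EuclideanSpace ℝ (Fin n)) S] {q : N → S}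
    (A : LinearAtlas (EuclideanSpace ℝ (Fin (n + 1))) (EuclideanSpace ℝ (Fin n)) q)
    (hq : ContMDiff (𝓡 (n + 1)) (𝓡 n) ∞ q) {s : S → N} (hs : ContMDiff (𝓡 n) (𝓡 (n + 1)) ∞ s)
    (hqs : ∀ x, q (s x) = x) :
    ∃ (L : SmoothLineBundle n S) (Φ : L.Total ≃ₘ^∞⟮(𝓡 n).prod 𝓘(ℝ, ℝ), 𝓡 (n + 1)⟯ N),
      (∀ p : L.Total, q (Φ p) = p.1) ∧ ∀ x : S, Φ ⟨x, 0⟩ = s x := by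
  let B := A.translate hq hs hqs
  exact ⟨{ Fiber := B.core.Fiber }, B.coreDiffeomorph hq,
    fun p ↦ (B.box p.1).proj_map p.1 (B.mem_base p.1) p.2, A.translate_zeroSection hq hs hqs⟩

/-! ### Pullbacks of degenerate metrics and their kernels. -/

section Pullback

variable {EP : Type*} [NormedAddCommGroup EP] [NormedSpace ℝ EP]
  {HP : Type*} [TopologicalSpace HP] {IP : ModelWithCorners ℝ EP HP}
  {P : Type*} [TopologicalSpace P] [ChartedSpace HP P]
  {E : Type*} [NormedAddCommGroup E] [NormedSpace ℝ E]
  {H : Type*} [TopologicalSpace H] {I : ModelWithCorners ℝ E H}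
  {N : Type*} [TopologicalSpace N] [ChartedSpace H N]

/-- Precomposition of both arguments of a bilinear form with a linear map. -/
noncomputable def bilinComp {F F' : Type*} [NormedAddCommGroup F] [NormedSpace ℝ F]
    [NormedAddCommGroup F'] [NormedSpace ℝ F'] (b : F →L[ℝ] F →L[ℝ] ℝ) (d : F' →L[ℝ] F) :
    F' →L[ℝ] F' →L[ℝ] ℝ :=
  ((ContinuousLinearMap.compL ℝ F' F ℝ).flip d).comp (b.comp d)

set_option synthInstance.maxHeartbeats 100000 in
theorem ContMDiffAt.bilinComp {F F' : Type*} [NormedAddCommGroup F] [NormedSpace ℝ F]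
    [NormedAddCommGroup F'] [NormedSpace ℝ F'] {b : P → F →L[ℝ] F →L[ℝ] ℝ} {d : P → F' →L[ℝ] F}
    {p : P} (hb : ContMDiffAt IP 𝓘(ℝ, F →L[ℝ] F →L[ℝ] ℝ) ∞ b p)
    (hd : ContMDiffAt IP 𝓘(ℝ, F' →L[ℝ] F) ∞ d p) :
    ContMDiffAt IP 𝓘(ℝ, F' →L[ℝ] F' →L[ℝ] ℝ) ∞ (fun p ↦ _root_.bilinComp (b p) (d p)) p := by
  have h1 : ContMDiff 𝓘(ℝ, F' →L[ℝ] F) 𝓘(ℝ, (F →L[ℝ] ℝ) →L[ℝ] F' →L[ℝ] ℝ) ∞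
      ((ContinuousLinearMap.compL ℝ F' F ℝ).flip) :=
    (ContinuousLinearMap.contDiff _).contMDiff
  exact ContMDiffAt.clm_comp ((h1 _).comp p hd) (hb.clm_comp hd)

theorem trivial_linearMapAt {B : Type*} [TopologicalSpace B] (x₀ x : B) (r : ℝ) :
    (trivializationAt ℝ (Bundle.Trivial B ℝ) x₀).linearMapAt ℝ x r = r := by
  exact congrArg (fun L : ℝ →ₗ[ℝ] ℝ ↦ L r) (Bundle.Trivial.linearMapAt_trivialization ℝ B ℝ x)

variable {f : P → N} {k : N → P}

/-- The derivative of a map with a smooth local right inverse is onto. -/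
theorem mfderiv_surjective_of_rightInverse {p : P} (hf : MDifferentiableAt IP I f p)
    (hk : MDifferentiableAt I IP k (f p)) (hkf : k (f p) = p) (hfk : ∀ᶠ y in 𝓝 (f p), f (k y) = y) :
    Surjective (mfderiv IP I f p) := by
  intro w
  refine ⟨mfderiv I IP k (f p) w, ?_⟩
  have h1 : mfderiv I I (f ∘ k) (f p) = ContinuousLinearMap.id ℝ _ := by
    rw [(show f ∘ k =ᶠ[𝓝 (f p)] id from hfk).mfderiv_eq, mfderiv_id]
  rw [mfderiv_comp_of_eq hf hk hkf] at h1
  have h2 : ∀ p', p' = p → ∀ u : EP, (mfderiv IP I f p' u : E) = mfderiv IP I f p u := by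
    rintro _ rfl u
    rfl
  exact (h2 _ hkf _).symm.trans (congrArg (fun L : E →L[ℝ] E ↦ L w) h1)

variable [IsManifold IP ∞ P] [IsManifold I ∞ N]

/-- The pullback of a degenerate metric along a smooth map. -/
noncomputable def DegenerateMetric.pullback (h : DegenerateMetric I N) (f : P → N)
    (hf : ContMDiff IP I ∞ f) : DegenerateMetric IP P where
  form p := bilinComp (F := E) (F' := EP) (h.form (f p)) (mfderiv IP I f p)
  symm p v w := h.symm _ _ _
  contMDiff := by
    intro p₀
    rw [contMDiffAt_hom_bundle]
    refine ⟨contMDiffAt_id, ?_⟩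
    have h1 := (h.contMDiff (f p₀))
    rw [contMDiffAt_hom_bundle] at h1
    have h2 := h1.2.comp p₀ (hf p₀)
    have h3 := (hf p₀).mfderiv_const (m := ∞) (by simp)
    -- In tangent coordinates around `p₀` and `f p₀` the pullback is the coordinate form composed
    -- with the coordinate derivative. The remaining steps identify the two where both
    -- trivialisations are defined.
    have h4 : ContMDiffAt IP 𝓘(ℝ, EP →L[ℝ] EP →L[ℝ] ℝ) ∞ (fun p ↦ bilinComp
        (ContinuousLinearMap.inCoordinates E (TangentSpace I) (E →L[ℝ] ℝ)
          (fun x : N ↦ TangentSpace I x →L[ℝ] ℝ) (f p₀) (f p) (f p₀) (f p) (h.form (f p)))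
        (inTangentCoordinates IP I id f (mfderiv IP I f) p₀ p)) p₀ := h2.bilinComp h3
    refine h4.congr_of_eventuallyEq ?_
    have hb : ∀ᶠ p in 𝓝 p₀, p ∈ (trivializationAt EP (TangentSpace IP) p₀).baseSet :=
      (trivializationAt EP (TangentSpace IP) p₀).open_baseSet.mem_nhds
        (mem_baseSet_trivializationAt _ _ _)
    have hb' : ∀ᶠ p in 𝓝 p₀, f p ∈ (trivializationAt E (TangentSpace I) (f p₀)).baseSet :=
      (hf p₀).continuousAt.preimage_mem_nhds
        ((trivializationAt E (TangentSpace I) (f p₀)).open_baseSet.mem_nhds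
          (mem_baseSet_trivializationAt _ _ _))
    filter_upwards [hb, hb'] with p hp hfp
    have hinv : ∀ u, (trivializationAt E (TangentSpace I) (f p₀)).symm (f p)
        (inTangentCoordinates IP I id f (mfderiv IP I f) p₀ p u) =
        mfderiv IP I f p ((trivializationAt EP (TangentSpace IP) p₀).symm p u) := by
      intro u
      refine (congrArg (fun L : EP →L[ℝ] E ↦ (trivializationAt E (TangentSpace I) (f p₀)).symm (f p)
        (L u)) (ContinuousLinearMap.inCoordinates_eq hp hfp)).trans ?_
      exact ((trivializationAt E (TangentSpace I) (f p₀)).continuousLinearEquivAt ℝ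
        (f p) hfp).symm_apply_apply _
    refine ContinuousLinearMap.ext fun v ↦ ContinuousLinearMap.ext fun w ↦ ?_
    refine (inCoordinates_apply_eq₂ (E₃ := Bundle.Trivial P ℝ) hp hp (mem_univ _)).trans ?_
    refine Eq.trans ?_ (inCoordinates_apply_eq₂ (E₃ := Bundle.Trivial N ℝ) hfp hfp
      (mem_univ _)).symm
    refine (trivial_linearMapAt _ _ _).trans (Eq.trans ?_ (trivial_linearMapAt _ _ _).symm)
    exact (congrArg₂ (fun a b ↦ h.form (f p) a b) (hinv v) (hinv w)).symm

variable {E' : Type*} [NormedAddCommGroup E'] [NormedSpace ℝ E']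
  {H' : Type*} [TopologicalSpace H'] {I' : ModelWithCorners ℝ E' H'}
  {M : Type*} [TopologicalSpace M] [ChartedSpace H' M] {ρ : N → M}

/-- The kernel of a degenerate metric is also given by vertical vector fields over open sets. -/
theorem DegenerateMetric.KernelEqVertical.iff_on [FiniteDimensional ℝ E] [T2Space N]
    {h : DegenerateMetric I N} (hh : h.KernelEqVertical I' ρ) {U : Set N}
    (hU : IsOpen U) {Y : (x : N) → TangentSpace I x}
    (hY : ContMDiffOn I I.tangent ∞ (fun x ↦ (⟨x, Y x⟩ : TangentBundle I N)) U) :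
    (∀ x ∈ U, h.form x (Y x) = 0) ↔ ∀ x ∈ U, mfderiv I I' ρ x (Y x) = 0 := by
  -- A bump function makes a local field global, agreeing with `Y` at `x` and vanishing off `U`;
  -- both conditions are linear over functions.
  have key : ∀ x ∈ U, ∃ ψ : N → ℝ, ψ x = 1 ∧ (∀ y ∉ U, ψ y = 0) ∧
      IsSmoothVectorField (fun y ↦ ψ y • Y y) := by
    intro x hx
    obtain ⟨ψ, -, hψ⟩ := (SmoothBumpFunction.nhds_basis_tsupport (I := I) x).mem_iff.1
      (hU.mem_nhds hx)
    refine ⟨ψ, ψ.eq_one, fun y hy ↦ image_eq_zero_of_notMem_tsupport fun h ↦ hy (hψ h), ?_⟩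
    exact ContMDiffOn.smul_section_of_tsupport (V := fun x : N ↦ TangentSpace I x)
      ψ.contMDiff.contMDiffOn hU hψ hY
  constructor
  · intro h0 x hx
    obtain ⟨ψ, hψx, hψ, hs⟩ := key x hx
    have := (hh _ hs).1 (fun y ↦ ?_) x
    · simpa [hψx] using this
    · by_cases hy : y ∈ U
      · rw [map_smul, h0 y hy, smul_zero]
      · rw [hψ y hy, zero_smul, map_zero]
  · intro h0 x hx
    obtain ⟨ψ, hψx, hψ, hs⟩ := key x hx
    have := (hh _ hs).2 (fun y ↦ ?_) x
    · simpa [hψx] using this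
    · by_cases hy : y ∈ U
      · rw [map_smul, h0 y hy, smul_zero]
      · rw [hψ y hy, zero_smul, map_zero]

variable {S : Type*} [TopologicalSpace S] [ChartedSpace H' S] {pr : P → S}

/-- The pulled-back form tests only against the image of the derivative, which is why surjectivity
is needed. -/
theorem DegenerateMetric.pullback_form_eq_zero (h : DegenerateMetric I N)
    (hf : ContMDiff IP I ∞ f) {p : P} (hs : Surjective (mfderiv IP I f p))
    (v : TangentSpace IP p) :
    (h.pullback f hf).form p v = 0 ↔ h.form (f p) (mfderiv IP I f p v) = 0 := by
  constructor
  · intro h0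
    refine ContinuousLinearMap.ext fun w ↦ ?_
    obtain ⟨u, rfl⟩ := hs w
    exact congrArg (fun L : EP →L[ℝ] ℝ ↦ L u) h0
  · intro h0
    refine ContinuousLinearMap.ext fun w ↦ ?_
    exact congrArg (fun L : E →L[ℝ] ℝ ↦ L (mfderiv IP I f p w)) h0

/-- The kernel of the pullback of a degenerate metric along an open embedding. -/
theorem DegenerateMetric.KernelEqVertical.pullback [FiniteDimensional ℝ E] [T2Space N]
    {h : DegenerateMetric I N} (hh : h.KernelEqVertical I' ρ) {U : Set N} (hU : IsOpen U)
    (hf : ContMDiff IP I ∞ f) (hfU : ∀ p, f p ∈ U) (hk : ContMDiffOn I IP ∞ k U)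
    (hkf : ∀ p, k (f p) = p) (hfk : ∀ y ∈ U, f (k y) = y)
    (hpr : ∀ p v, mfderiv IP I' pr p v = 0 ↔ mfderiv I I' ρ (f p) (mfderiv IP I f p v) = 0) :
    (h.pullback f hf).KernelEqVertical I' pr := by
  intro X hX
  have hs : ∀ p, Surjective (mfderiv IP I f p) := fun p ↦
    mfderiv_surjective_of_rightInverse ((hf p).mdifferentiableAt (by simp))
      ((hk.contMDiffAt (hU.mem_nhds (hfU p))).mdifferentiableAt (by simp)) (hkf p)
      (by filter_upwards [hU.mem_nhds (hfU p)] with y hy using hfk y hy)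
  -- The field is pushed forward to `U` along `f`, since the hypothesis concerns fields on `N`.
  have hY : ContMDiffOn I I.tangent ∞
      (fun y ↦ (⟨y, mfderiv IP I f (k y) (X (k y))⟩ : TangentBundle I N)) U := by
    refine (((hf.contMDiff_tangentMap (m := ∞) (by simp)).comp hX).comp_contMDiffOn hk).congr
      fun y hy ↦ TotalSpace.ext (hfk y hy).symm HEq.rfl
  have h1 := hh.iff_on hU hY
  have h2 : ∀ {R : (y : N) → E → Prop}, (∀ y ∈ U, R y (mfderiv IP I f (k y) (X (k y)))) ↔
      ∀ p, R (f p) (mfderiv IP I f p (X p)) := by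
    refine fun {R} ↦ ⟨fun h p ↦ ?_, fun h y hy ↦ ?_⟩
    · have := h (f p) (hfU p)
      rwa [hkf] at this
    · have := h (k y)
      rwa [hfk y hy] at this
  have h3 := h2 (R := fun y (v : E) ↦ h.form y v = 0)
  have h4 := h2 (R := fun y (v : E) ↦ mfderiv I I' ρ y v = 0)
  simp only [h.pullback_form_eq_zero hf (hs _), hpr]
  exact h3.symm.trans (h1.trans h4)

end Pullback

/-! ### Smooth maps into the unit group of the reals. -/

section Units

variable {E : Type*} [NormedAddCommGroup E] [NormedSpace ℝ E]
  {H : Type*} [TopologicalSpace H] {I : ModelWithCorners ℝ E H}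
  {N : Type*} [TopologicalSpace N] [ChartedSpace H N]

/-- A nonzero real number as a unit, with junk value `1` at `0`. -/
noncomputable def unitOf (r : ℝ) : ℝˣ := if h : r = 0 then 1 else Units.mk0 r h

theorem val_unitOf {r : ℝ} (h : r ≠ 0) : (unitOf r : ℝ) = r := by
  rw [unitOf, dif_neg h, Units.val_mk0]

theorem unitOf_mul (a : ℝˣ) {r : ℝ} (h : r ≠ 0) : unitOf (a * r) = a * unitOf r := by
  ext
  rw [val_unitOf (mul_ne_zero a.ne_zero h), Units.val_mul, val_unitOf h]

theorem unitOf_val (a : ℝˣ) : unitOf a = a := Units.ext (val_unitOf a.ne_zero)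

/-- The units are charted by their open embedding into `ℝ`, so continuity and smoothness can be
tested on the underlying real number. -/
theorem ContMDiffAt.unitOf {f : N → ℝ} {p : N} (hf : ContMDiffAt I 𝓘(ℝ, ℝ) ∞ f p) (h : f p ≠ 0) :
    ContMDiffAt I 𝓘(ℝ, ℝ) ∞ (fun x ↦ _root_.unitOf (f x)) p := by
  have hev : (fun x ↦ (_root_.unitOf (f x) : ℝ)) =ᶠ[𝓝 p] f := by
    filter_upwards [hf.continuousAt.eventually_ne h] with x hx using val_unitOf hx
  rw [contMDiffAt_iff_target]
  refine ⟨?_, hf.congr_of_eventuallyEq hev⟩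
  rw [ContinuousAt, Units.isEmbedding_val₀.tendsto_nhds_iff]
  have := hf.continuousAt.congr hev.symm
  exact this

end Units

/-! ### The punctured line bundle as a principal bundle. -/

namespace SmoothLineBundle

variable {n : ℕ} {S : Type*} [TopologicalSpace S] [ChartedSpace (EuclideanSpace ℝ (Fin n)) S]
  (L : SmoothLineBundle n S)

theorem contMDiff_puncturedVal :
    ContMDiff ((𝓡 n).prod 𝓘(ℝ, ℝ)) ((𝓡 n).prod 𝓘(ℝ, ℝ)) ∞ (Subtype.val : L.punctured → L.Total) :=
  contMDiff_subtype_val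

theorem contMDiff_puncturedProj : ContMDiff ((𝓡 n).prod 𝓘(ℝ, ℝ)) (𝓡 n) ∞ L.puncturedProj :=
  (contMDiff_proj L.Fiber).comp L.contMDiff_puncturedVal

theorem snd_trivialization_ne_zero (p : L.punctured) {x : S}
    (hx : p.1.1 ∈ (trivializationAt ℝ L.Fiber x).baseSet) :
    (trivializationAt ℝ L.Fiber x p.1).2 ≠ 0 := by
  have := ((trivializationAt ℝ L.Fiber x).continuousLinearEquivAt ℝ p.1.1 hx).map_ne_zero_iff
    (x := p.1.2)
  exact this.2 p.2

theorem snd_trivialization_smul (a : ℝ) (p : L.Total) {x : S}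
    (hx : p.1 ∈ (trivializationAt ℝ L.Fiber x).baseSet) :
    (trivializationAt ℝ L.Fiber x ⟨p.1, a • p.2⟩).2 =
      a * (trivializationAt ℝ L.Fiber x p).2 :=
  ((trivializationAt ℝ L.Fiber x).continuousLinearEquivAt ℝ p.1 hx).map_smul a p.2

theorem contMDiff_smul_punctured [IsManifold (𝓡 n) ∞ S] :
    ContMDiff (𝓘(ℝ, ℝ).prod ((𝓡 n).prod 𝓘(ℝ, ℝ))) ((𝓡 n).prod 𝓘(ℝ, ℝ)) ∞
      (fun z : ℝˣ × L.punctured ↦ z.1 • z.2) := by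
  rw [← ContMDiff.subtypeVal_comp_iff]
  intro z₀
  have h0 : ContMDiffAt (𝓘(ℝ, ℝ).prod ((𝓡 n).prod 𝓘(ℝ, ℝ))) ((𝓡 n).prod 𝓘(ℝ, ℝ)) ∞
      (fun z : ℝˣ × L.punctured ↦ z.2.1) z₀ := (L.contMDiff_puncturedVal.comp contMDiff_snd) z₀
  have h1 := h0
  rw [contMDiffAt_totalSpace] at h1
  rw [contMDiffAt_totalSpace]
  refine ⟨h1.1, ?_⟩
  have h2 : ContMDiffAt (𝓘(ℝ, ℝ).prod ((𝓡 n).prod 𝓘(ℝ, ℝ))) 𝓘(ℝ, ℝ) ∞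
      (fun z : ℝˣ × L.punctured ↦ (z.1 : ℝ)) z₀ := (Units.contMDiff_val.comp contMDiff_fst) z₀
  refine (h2.mul h1.2).congr_of_eventuallyEq ?_
  filter_upwards [h1.1.continuousAt.preimage_mem_nhds
    ((trivializationAt ℝ L.Fiber z₀.2.1.1).open_baseSet.mem_nhds
      (mem_baseSet_trivializationAt ℝ L.Fiber z₀.2.1.1))] with z hz
  exact L.snd_trivialization_smul z.1 z.2.1 hz

open Classical in
/-- The inverse of a trivialization, with values in the punctured line bundle. -/
noncomputable def puncturedSymm (x : S) (z : S × ℝˣ) (d : L.punctured) : L.punctured :=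
  if h : (trivializationAt ℝ L.Fiber x).toOpenPartialHomeomorph.symm (z.1, (z.2 : ℝ)) ∈ L.punctured
  then ⟨_, h⟩ else d

/-- Trivialisations are linear on fibres, so a unit corresponds to a nonzero vector and the default
`d` is never taken over the base set. -/
theorem val_puncturedSymm (d : L.punctured) {x : S} {z : S × ℝˣ}
    (hz : z.1 ∈ (trivializationAt ℝ L.Fiber x).baseSet) : (L.puncturedSymm x z d).1 =
      (trivializationAt ℝ L.Fiber x).toOpenPartialHomeomorph.symm (z.1, (z.2 : ℝ)) := by
  set t := trivializationAt ℝ L.Fiber x with ht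
  have hmem : t.toOpenPartialHomeomorph.symm (z.1, (z.2 : ℝ)) ∈ L.punctured := by
    intro h0
    have h1 := t.apply_symm_apply (x := (z.1, (z.2 : ℝ))) (t.mem_target.2 hz)
    have hb : (t.toOpenPartialHomeomorph.symm (z.1, (z.2 : ℝ))).1 = z.1 := t.proj_symm_apply' hz
    have h2 := (t.continuousLinearEquivAt ℝ _ (hb ▸ hz)).map_zero
    have h3 : (t (t.toOpenPartialHomeomorph.symm (z.1, (z.2 : ℝ)))).2 = 0 := by
      refine Eq.trans ?_ h2
      rw [← h0]
      rfl
    rw [h1] at h3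
    exact z.2.ne_zero h3
  rw [puncturedSymm, dif_pos hmem]

theorem contMDiffOn_puncturedSymm [IsManifold (𝓡 n) ∞ S] (d : L.punctured) (x : S) :
    ContMDiffOn ((𝓡 n).prod 𝓘(ℝ, ℝ)) ((𝓡 n).prod 𝓘(ℝ, ℝ)) ∞ (fun z ↦ L.puncturedSymm x z d)
      ((trivializationAt ℝ L.Fiber x).baseSet ×ˢ univ) := by
  intro z hz
  rw [← ContMDiffWithinAt.subtypeVal_comp_iff]
  have h1 : ContMDiff ((𝓡 n).prod 𝓘(ℝ, ℝ)) ((𝓡 n).prod 𝓘(ℝ, ℝ)) ∞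
      (fun z : S × ℝˣ ↦ (z.1, (z.2 : ℝ))) :=
    contMDiff_fst.prodMk (Units.contMDiff_val.comp contMDiff_snd)
  have h2 := ((trivializationAt ℝ L.Fiber x).contMDiffOn_symm (IB := 𝓡 n) (n := ∞)).comp
    (h1.contMDiffOn (s := (trivializationAt ℝ L.Fiber x).baseSet ×ˢ univ))
    fun z hz ↦ (Trivialization.mem_target _).2 hz.1
  exact (h2 z hz).congr (fun y hy ↦ L.val_puncturedSymm d hy.1) (L.val_puncturedSymm d hz.1)

theorem contMDiffAt_snd_trivialization [IsManifold (𝓡 n) ∞ S] {p : L.punctured} {x : S}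
    (hp : p.1.1 ∈ (trivializationAt ℝ L.Fiber x).baseSet) :
    ContMDiffAt ((𝓡 n).prod 𝓘(ℝ, ℝ)) 𝓘(ℝ, ℝ) ∞
      (fun p : L.punctured ↦ unitOf (trivializationAt ℝ L.Fiber x p.1).2) p := by
  refine ContMDiffAt.unitOf ?_ (L.snd_trivialization_ne_zero p hp)
  have hs : p.1 ∈ (trivializationAt ℝ L.Fiber x).source := (Trivialization.mem_source _).2 hp
  have h1 := (trivializationAt ℝ L.Fiber x).contMDiffOn (IB := 𝓡 n) (n := ∞)
  exact ((h1.contMDiffAt ((trivializationAt ℝ L.Fiber x).open_source.mem_nhds hs)).comp p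
    (L.contMDiff_puncturedVal p)).snd

/-- The local trivializations of the punctured line bundle. -/
noncomputable def puncturedTrivialization [IsManifold (𝓡 n) ∞ S] (d : L.punctured) (x : S) :
    Trivialization ℝˣ L.puncturedProj where
  toFun p := (p.1.1, unitOf (trivializationAt ℝ L.Fiber x p.1).2)
  invFun z := L.puncturedSymm x z d
  source := L.puncturedProj ⁻¹' (trivializationAt ℝ L.Fiber x).baseSet
  target := (trivializationAt ℝ L.Fiber x).baseSet ×ˢ univ
  map_source' p hp := ⟨hp, mem_univ _⟩
  map_target' z hz := by
    rw [mem_preimage, puncturedProj, L.val_puncturedSymm d hz.1]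
    exact (Trivialization.proj_symm_apply' _ hz.1).symm ▸ hz.1
  left_inv' p hp := by
    refine Subtype.ext ?_
    rw [L.val_puncturedSymm d hp, val_unitOf (L.snd_trivialization_ne_zero p hp)]
    exact Trivialization.symm_apply_mk_proj _ ((Trivialization.mem_source _).2 hp)
  right_inv' z hz := by
    rw [L.val_puncturedSymm d hz.1, Trivialization.apply_symm_apply _
      ((Trivialization.mem_target _).2 hz.1), unitOf_val]
    exact Prod.ext (Trivialization.proj_symm_apply' _ hz.1) rfl
  open_source := (trivializationAt ℝ L.Fiber x).open_baseSet.preimage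
    L.contMDiff_puncturedProj.continuous
  open_target := (trivializationAt ℝ L.Fiber x).open_baseSet.prod isOpen_univ
  continuousOn_toFun := fun p hp ↦ (L.contMDiff_puncturedProj.continuous.continuousAt.prodMk
    (L.contMDiffAt_snd_trivialization hp).continuousAt).continuousWithinAt
  continuousOn_invFun := (L.contMDiffOn_puncturedSymm d x).continuousOn
  baseSet := (trivializationAt ℝ L.Fiber x).baseSet
  open_baseSet := (trivializationAt ℝ L.Fiber x).open_baseSet
  source_eq := rfl
  target_eq := rfl
  proj_toFun p _ := rfl

/-- A line bundle without its zero section is a principal `ℝˣ`-bundle. -/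
theorem isPrincipalRxBundle [IsManifold (𝓡 n) ∞ S] [T2Space L.Total]
    [SecondCountableTopology L.Total] :
    IsPrincipalRxBundle ((𝓡 n).prod 𝓘(ℝ, ℝ)) (𝓡 n) L.puncturedProj where
  t2 := inferInstance
  secondCountable := inferInstanceAs (SecondCountableTopology {p : L.Total // p ∈ L.punctured})
  isManifold := inferInstance
  smooth_smul := L.contMDiff_smul_punctured
  proj_smul a p := rfl
  locally_trivial x := by
    -- The nonzero vector serves only as the default value of `puncturedSymm`.
    obtain ⟨v, hv⟩ : ∃ v : L.Fiber x, v ≠ 0 := by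
      let t := (trivializationAt ℝ L.Fiber x).continuousLinearEquivAt ℝ x
        (mem_baseSet_trivializationAt ℝ L.Fiber x)
      exact ⟨t.symm 1, t.symm.map_ne_zero_iff.2 one_ne_zero⟩
    refine ⟨L.puncturedTrivialization ⟨⟨x, v⟩, hv⟩ x, mem_baseSet_trivializationAt ℝ L.Fiber x,
      fun p hp ↦ ?_, L.contMDiffOn_puncturedSymm _ x, fun p hp a ↦ ?_⟩
    · exact ((L.contMDiff_puncturedProj p).prodMk
        (L.contMDiffAt_snd_trivialization hp)).contMDiffWithinAt
    · refine Prod.ext rfl ?_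
      change unitOf (trivializationAt ℝ L.Fiber x ⟨p.1.1, (a : ℝ) • p.1.2⟩).2 = a * unitOf _
      rw [L.snd_trivialization_smul (a : ℝ) p.1 hp, unitOf_mul a
        (L.snd_trivialization_ne_zero p hp)]

end SmoothLineBundle

/-! ### The Carrollian structure on the punctured line bundle. -/

section Carrollian

variable {n : ℕ} {N : Type*} [TopologicalSpace N] [T2Space N] [SecondCountableTopology N]
  [ChartedSpace (EuclideanSpace ℝ (Fin (n + 1))) N] [IsManifold (𝓡 (n + 1)) ∞ N]
  {M : Type*} [TopologicalSpace M] [ChartedSpace (EuclideanSpace ℝ (Fin n)) M]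
  {S : Type*} [TopologicalSpace S] [ChartedSpace (EuclideanSpace ℝ (Fin n)) S]
  [IsManifold (𝓡 n) ∞ S]

/-- The pullback of a degenerate metric to the punctured line bundle of a linearisation is
Carrollian. -/
theorem exists_isCarrollianRxBundle {h : DegenerateMetric (𝓡 (n + 1)) N} {ρ : N → M}
    (hh : h.KernelEqVertical (𝓡 n) ρ) (hρ : ContMDiff (𝓡 (n + 1)) (𝓡 n) ∞ ρ)
    (L : SmoothLineBundle n S) (Φ : L.Total ≃ₘ^∞⟮(𝓡 n).prod 𝓘(ℝ, ℝ), 𝓡 (n + 1)⟯ N) {σ : S → M}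
    (hσ : ContMDiff (𝓡 n) (𝓡 n) ∞ σ) (hσ' : ∀ x, Injective (mfderiv (𝓡 n) (𝓡 n) σ x))
    (hσΦ : ∀ p : L.Total, ρ (Φ p) = σ p.1) :
    ∃ g : DegenerateMetric ((𝓡 n).prod 𝓘(ℝ, ℝ)) L.punctured, IsPullbackToPunctured h L Φ g ∧
      IsCarrollianRxBundle ((𝓡 n).prod 𝓘(ℝ, ℝ)) (𝓡 n) L.puncturedProj g ∧
      (h.PointwiseKernelEqVertical (𝓡 n) ρ →
        g.PointwiseKernelEqVertical (𝓡 n) L.puncturedProj) := by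
  have : T2Space L.Total := Φ.toHomeomorph.symm.t2Space
  have : SecondCountableTopology L.Total := Φ.toHomeomorph.secondCountableTopology
  set f : L.punctured → N := fun p ↦ Φ p.1 with hf_def
  have hf : ContMDiff ((𝓡 n).prod 𝓘(ℝ, ℝ)) (𝓡 (n + 1)) ∞ f :=
    Φ.contMDiff.comp L.contMDiff_puncturedVal
  refine ⟨h.pullback f hf, fun p v w ↦ rfl, ?_⟩
  -- The total function `k` below needs a default value `d`; if there is none, the claims are
  -- vacuous.
  rcases isEmpty_or_nonempty L.punctured with he | ⟨⟨d⟩⟩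
  · exact ⟨⟨L.isPrincipalRxBundle, fun X _ ↦ by simp⟩, fun _ p ↦ isEmptyElim p⟩
  set U : Set N := Φ.symm ⁻¹' L.punctured with hU_def
  have hU : IsOpen U := L.punctured.isOpen.preimage Φ.symm.continuous
  classical
  set k : N → L.punctured := fun y ↦ if hy : Φ.symm y ∈ L.punctured then ⟨_, hy⟩ else d with hk_def
  have hkval : ∀ y ∈ U, (k y).1 = Φ.symm y := fun y hy ↦ by
    rw [hk_def]
    simp only [dif_pos (show Φ.symm y ∈ L.punctured from hy)]
  have hfU : ∀ p, f p ∈ U := fun p ↦ by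
    change Φ.symm (Φ p.1) ∈ L.punctured
    rw [Φ.symm_apply_apply]
    exact p.2
  have hk : ContMDiffOn (𝓡 (n + 1)) ((𝓡 n).prod 𝓘(ℝ, ℝ)) ∞ k U := fun y hy ↦ by
    rw [← ContMDiffWithinAt.subtypeVal_comp_iff]
    exact (Φ.symm.contMDiff.contMDiffOn (s := U) y hy).congr hkval (hkval y hy)
  have hkf : ∀ p, k (f p) = p := fun p ↦ Subtype.ext (by
    rw [hkval _ (hfU p)]; exact Φ.symm_apply_apply p.1)
  have hfk : ∀ y ∈ U, f (k y) = y := fun y hy ↦ by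
    rw [hf_def]
    simp only [hkval y hy, Φ.apply_symm_apply]
  -- Differentiating `ρ ∘ f = σ ∘ puncturedProj`, with the derivative of `σ` injective, identifies
  -- the two notions of vertical vector.
  have hpr : ∀ p v, mfderiv ((𝓡 n).prod 𝓘(ℝ, ℝ)) (𝓡 n) L.puncturedProj p v = 0 ↔
      mfderiv (𝓡 (n + 1)) (𝓡 n) ρ (f p) (mfderiv ((𝓡 n).prod 𝓘(ℝ, ℝ)) (𝓡 (n + 1)) f p v) = 0 := by
    intro p v
    have h1 : ρ ∘ f = σ ∘ L.puncturedProj := funext fun p ↦ hσΦ p.1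
    have h2 := mfderiv_comp p ((hρ (f p)).mdifferentiableAt (by simp))
      ((hf p).mdifferentiableAt (by simp))
    have h3 := mfderiv_comp p ((hσ (L.puncturedProj p)).mdifferentiableAt (by simp))
      ((L.contMDiff_puncturedProj p).mdifferentiableAt (by simp))
    rw [h1] at h2
    have h4 := congrArg (fun L : EuclideanSpace ℝ (Fin n) × ℝ →L[ℝ] EuclideanSpace ℝ (Fin n) ↦ L v)
      (h3.symm.trans h2)
    have h5 := (injective_iff_map_eq_zero' _).1 (hσ' (L.puncturedProj p))
      (mfderiv ((𝓡 n).prod 𝓘(ℝ, ℝ)) (𝓡 n) L.puncturedProj p v)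
    rw [← h5]
    exact Eq.congr_left h4
  refine ⟨⟨L.isPrincipalRxBundle, hh.pullback hU hf hfU hk hkf hfk hpr⟩, fun hp p v ↦ ?_⟩
  rw [h.pullback_form_eq_zero hf (mfderiv_surjective_of_rightInverse
    ((hf p).mdifferentiableAt (by simp))
    ((hk.contMDiffAt (hU.mem_nhds (hfU p))).mdifferentiableAt (by simp)) (hkf p)
    (by filter_upwards [hU.mem_nhds (hfU p)] with y hy using hfk y hy)), hpr]
  exact hp _ _

end Carrollian

/-! ### Transversal slices and change of base. -/

section Slices

variable {E E' : Type*} [NormedAddCommGroup E] [NormedSpace ℝ E]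
  [NormedAddCommGroup E'] [NormedSpace ℝ E']
  {N S : Type*} [TopologicalSpace N] [ChartedSpace E N] [TopologicalSpace S] [ChartedSpace E' S]
  {q : N → S}

/-- The chart of `N` induced by a box, a chart of the base and an identification of the model
spaces. -/
def FlowBox.chart (e : FlowBox E E' q) (hq : ContMDiff 𝓘(ℝ, E) 𝓘(ℝ, E') ∞ q)
    (χ : OpenPartialHomeomorph S E') (B : (E' × ℝ) ≃L[ℝ] E) : OpenPartialHomeomorph N E where
  toFun p := B (χ (q p), e.coord p)
  invFun v := e.map (χ.symm (B.symm v).1, (B.symm v).2)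
  source := e.source ∩ q ⁻¹' χ.source
  target := B.symm ⁻¹' ((χ.target ∩ χ.symm ⁻¹' e.base) ×ˢ univ)
  map_source' p hp := by
    simp only [mem_preimage, B.symm_apply_apply, mem_prod, mem_univ, and_true]
    refine ⟨χ.map_source hp.2, ?_⟩
    rw [mem_preimage, χ.left_inv hp.2]
    exact e.proj_mem p hp.1
  map_target' v hv := by
    refine ⟨e.map_mem _ hv.1.2 _, ?_⟩
    rw [mem_preimage, e.proj_map _ hv.1.2]
    exact χ.map_target hv.1.1
  left_inv' p hp := by
    simp only [B.symm_apply_apply, χ.left_inv hp.2]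
    exact e.map_coord p hp.1
  right_inv' v hv := by
    have h1 : χ.symm (B.symm v).1 ∈ e.base := hv.1.2
    simp only [e.proj_map _ h1, e.coord_map _ h1, χ.right_inv hv.1.1]
    exact B.apply_symm_apply v
  open_source := e.isOpen_source.inter (χ.open_source.preimage hq.continuous)
  open_target := ((χ.isOpen_inter_preimage_symm e.isOpen_base).prod isOpen_univ).preimage
    B.symm.continuous
  continuousOn_toFun := B.continuous.comp_continuousOn
    ((χ.continuousOn.comp hq.continuous.continuousOn fun _ hp ↦ hp.2).prodMk
      (e.contMDiffOn_coord.continuousOn.mono inter_subset_left))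
  continuousOn_invFun := by
    refine e.contMDiffOn_map.continuousOn.comp ?_ fun v hv ↦ ⟨hv.1.2, mem_univ _⟩
    refine ContinuousOn.prodMk ?_ (continuous_snd.comp B.symm.continuous).continuousOn
    exact χ.symm.continuousOn.comp (continuous_fst.comp B.symm.continuous).continuousOn
      fun v hv ↦ hv.1.1

theorem FlowBox.chart_mem_maximalAtlas [IsManifold 𝓘(ℝ, E) ∞ N] (e : FlowBox E E' q)
    (hq : ContMDiff 𝓘(ℝ, E) 𝓘(ℝ, E') ∞ q) {χ : OpenPartialHomeomorph S E'}
    (hχ : χ ∈ IsManifold.maximalAtlas 𝓘(ℝ, E') ∞ S) (B : (E' × ℝ) ≃L[ℝ] E) :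
    e.chart hq χ B ∈ IsManifold.maximalAtlas 𝓘(ℝ, E) ∞ N := by
  refine (IsManifold.mem_maximalAtlas_iff_contMDiffOn _).2 ⟨?_, ?_⟩
  · have h1 : ContMDiffOn 𝓘(ℝ, E) 𝓘(ℝ, E' × ℝ) ∞ (fun p ↦ (χ (q p), e.coord p))
        (e.chart hq χ B).source :=
      ((contMDiffOn_of_mem_maximalAtlas hχ).comp hq.contMDiffOn fun _ hp ↦ hp.2).prodMk_space
        (e.contMDiffOn_coord.mono inter_subset_left)
    exact B.contDiff.contMDiff.comp_contMDiffOn h1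
  · have h1 : ContMDiff 𝓘(ℝ, E) 𝓘(ℝ, E') ∞ (fun v ↦ (B.symm v).1) :=
      (contDiff_fst.comp B.symm.contDiff).contMDiff
    have h2 : ContMDiff 𝓘(ℝ, E) 𝓘(ℝ, ℝ) ∞ (fun v ↦ (B.symm v).2) :=
      (contDiff_snd.comp B.symm.contDiff).contMDiff
    refine e.contMDiffOn_map.comp (ContMDiffOn.prodMk ?_ h2.contMDiffOn)
      fun v hv ↦ ⟨hv.1.2, mem_univ _⟩
    exact (contMDiffOn_symm_of_mem_maximalAtlas hχ).comp h1.contMDiffOn fun v hv ↦ hv.1.1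

/-- In the chart made from the box and a chart of the base, the section at level `0` is `v ↦ (v,
0)`. -/
theorem FlowBox.isImmersionAtOfComplement [IsManifold 𝓘(ℝ, E) ∞ N] [IsManifold 𝓘(ℝ, E') ∞ S]
    (e : FlowBox E E' q) (hq : ContMDiff 𝓘(ℝ, E) 𝓘(ℝ, E') ∞ q) (B : (E' × ℝ) ≃L[ℝ] E) {x : S}
    (hx : x ∈ e.base) :
    IsImmersionAtOfComplement ℝ 𝓘(ℝ, E') 𝓘(ℝ, E) ∞ (fun y ↦ e.map (y, 0)) x := by
  set χ := (chartAt E' x).restr e.base with hχ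
  have hχs : χ.source = (chartAt E' x).source ∩ e.base :=
    OpenPartialHomeomorph.restr_source' _ _ e.isOpen_base
  have hmem : χ ∈ IsManifold.maximalAtlas 𝓘(ℝ, E') ∞ S :=
    restr_mem_maximalAtlas _ (IsManifold.chart_mem_maximalAtlas x) e.isOpen_base
  have hmaps : ∀ y ∈ χ.source, e.map (y, 0) ∈ (e.chart hq χ B).source := fun y hy ↦ by
    have hyb : y ∈ e.base := (hχs ▸ hy).2
    refine ⟨e.map_mem y hyb 0, ?_⟩
    rw [mem_preimage, e.proj_map y hyb]
    exact hy
  have hxs : x ∈ χ.source := hχs ▸ ⟨mem_chart_source E' x, hx⟩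
  refine IsImmersionAtOfComplement.mk_of_charts B χ (e.chart hq χ B) hxs (hmaps x hxs) hmem
    (e.chart_mem_maximalAtlas hq hmem B) hmaps fun v hv ↦ ?_
  have hv' : v ∈ χ.target := by simpa using hv
  have hvb : χ.symm v ∈ e.base := (hχs ▸ χ.map_target hv').2
  change B (χ (q (e.map (χ.symm v, 0))), e.coord (e.map (χ.symm v, 0))) = B (v, 0)
  rw [e.proj_map _ hvb, e.coord_map _ hvb, χ.right_inv hv']

/-- The immersion property is local and read off in boxes; the continuous left inverse `q` makes it
a topological embedding. -/
theorem LinearAtlas.isSmoothEmbedding_zeroSection [IsManifold 𝓘(ℝ, E) ∞ N]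
    [IsManifold 𝓘(ℝ, E') ∞ S] (A : LinearAtlas E E' q) (hq : ContMDiff 𝓘(ℝ, E) 𝓘(ℝ, E') ∞ q)
    (B : (E' × ℝ) ≃L[ℝ] E) : IsSmoothEmbedding 𝓘(ℝ, E') 𝓘(ℝ, E) ∞ A.zeroSection := by
  refine ⟨IsImmersionOfComplement.isImmersion (F := ℝ) fun x ↦ ?_,
    IsEmbedding.of_leftInverse A.proj_zeroSection hq.continuous A.contMDiff_zeroSection.continuous⟩
  refine ((A.box x).isImmersionAtOfComplement hq B (A.mem_base x)).congr_of_eventuallyEq ?_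
  filter_upwards [(A.box x).isOpen_base.mem_nhds (A.mem_base x)] with y hy
    using (A.zeroSection_eq hy).symm

/-- A change of the base of a line fibration. -/
theorem IsLineFibration.comp_leftInverse {M : Type*} [TopologicalSpace M] [ChartedSpace E' M]
    {ρ : N → M} (h : IsLineFibration E E' ρ) {σ : S → M} {τ : M → S}
    (hσ : ContMDiff 𝓘(ℝ, E') 𝓘(ℝ, E') ∞ σ) (hτ : ContMDiff 𝓘(ℝ, E') 𝓘(ℝ, E') ∞ τ)
    (hτσ : LeftInverse τ σ) (hστ : RightInverse τ σ) : IsLineFibration E E' (τ ∘ ρ) := by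
  have hfib : ∀ x, τ ∘ ρ ⁻¹' {x} = ρ ⁻¹' {σ x} := fun x ↦ by
    ext p
    simp only [mem_preimage, comp_apply, mem_singleton_iff]
    exact ⟨fun h ↦ by rw [← h, hστ], fun h ↦ by rw [h, hτσ]⟩
  refine ⟨hτ.comp h.contMDiff, fun p W hW ↦ ?_, fun x ↦ hfib x ▸ h.isConnected _,
    fun x ↦ hfib x ▸ h.not_isCompact _⟩
  obtain ⟨e, hp, heW, he0⟩ := h.hasFlowBoxes p W hW
  exact ⟨{
    base := σ ⁻¹' e.base
    isOpen_base := e.isOpen_base.preimage hσ.continuous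
    source := e.source
    isOpen_source := e.isOpen_source
    coord := e.coord
    map := fun z ↦ e.map (σ z.1, z.2)
    proj_mem := fun p hp ↦ by
      rw [mem_preimage, comp_apply, hστ]
      exact e.proj_mem p hp
    map_mem := fun x hx t ↦ e.map_mem _ hx t
    proj_map := fun x hx t ↦ by rw [comp_apply, e.proj_map _ hx, hτσ]
    coord_map := fun x hx t ↦ e.coord_map _ hx t
    map_coord := fun p hp ↦ by
      simp only [comp_apply, hστ (ρ p)]
      exact e.map_coord p hp
    contMDiffOn_coord := e.contMDiffOn_coord
    contMDiffOn_map := e.contMDiffOn_map.comp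
      ((hσ.comp contMDiff_fst).prodMk contMDiff_snd).contMDiffOn
      fun z hz ↦ ⟨hz.1, mem_univ _⟩ }, hp, heW, he0⟩

/-- The inverse of a smooth bijection with injective derivatives is smooth. -/
theorem contMDiff_of_leftInverse [FiniteDimensional ℝ E'] {M : Type*} [TopologicalSpace M]
    [ChartedSpace E' M] [IsManifold 𝓘(ℝ, E') ∞ M] [IsManifold 𝓘(ℝ, E') ∞ S] {σ : S → M} {τ : M → S}
    (hσ : ContMDiff 𝓘(ℝ, E') 𝓘(ℝ, E') ∞ σ)
    (hσ' : ∀ x, Injective (mfderiv 𝓘(ℝ, E') 𝓘(ℝ, E') σ x))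
    (hτσ : LeftInverse τ σ) (hστ : RightInverse τ σ) : ContMDiff 𝓘(ℝ, E') 𝓘(ℝ, E') ∞ τ := by
  have : CompleteSpace E' := FiniteDimensional.complete ℝ E'
  intro y
  obtain ⟨x, rfl⟩ : ∃ x, σ x = y := ⟨τ y, hστ y⟩
  set φ := chartAt E' x
  set ψ := chartAt E' (σ x)
  set g : E' → E' := ψ ∘ σ ∘ φ.symm with hg_def
  have hg : ContDiffAt ℝ ∞ g (φ x) := by
    have := (contMDiffAt_iff.1 (hσ x)).2
    simpa [hg_def, mfld_simps, contDiffWithinAt_univ] using this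
  have hinj : Injective (fderiv ℝ g (φ x)) := by
    have := hσ' x
    rw [((hσ x).mdifferentiableAt (by simp)).mfderiv] at this
    simp only [mfld_simps, writtenInExtChartAt, fderivWithin_univ] at this
    exact this
  -- An injective endomorphism in finite dimension is invertible, so the inverse function theorem
  -- applies. Its local inverse must be `τ`, because `σ` is bijective.
  let D : E' ≃L[ℝ] E' :=
    (LinearEquiv.ofInjectiveEndo (fderiv ℝ g (φ x)).toLinearMap hinj).toContinuousLinearEquiv
  have hD : HasFDerivAt g (D : E' →L[ℝ] E') (φ x) := (hg.differentiableAt (by simp)).hasFDerivAt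
  have hgx : g (φ x) = ψ (σ x) := by
    simp only [hg_def, comp_apply, φ.left_inv (mem_chart_source E' x)]
  set G := hg.localInverse hD (by simp)
  have hG : ContDiffAt ℝ ∞ G (ψ (σ x)) := hgx ▸ hg.to_localInverse hD (by simp)
  have hGx : G (ψ (σ x)) = φ x := hgx ▸ hg.localInverse_apply_image hD (by simp)
  have hgG : ∀ᶠ z in 𝓝 (ψ (σ x)), g (G z) = z :=
    hgx ▸ (hg.hasStrictFDerivAt' hD (by simp)).eventually_right_inverse
  have hψx : σ x ∈ ψ.source := mem_chart_source E' (σ x)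
  have hψm : ContMDiffAt 𝓘(ℝ, E') 𝓘(ℝ, E') ∞ ψ (σ x) :=
    contMDiffAt_of_mem_maximalAtlas (IsManifold.chart_mem_maximalAtlas _) hψx
  have hφm : ContMDiffAt 𝓘(ℝ, E') 𝓘(ℝ, E') ∞ φ.symm (φ x) :=
    contMDiffAt_symm_of_mem_maximalAtlas (IsManifold.chart_mem_maximalAtlas _)
      (φ.map_source (mem_chart_source E' x))
  have hk : ContMDiffAt 𝓘(ℝ, E') 𝓘(ℝ, E') ∞ (fun y ↦ φ.symm (G (ψ y))) (σ x) :=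
    ContMDiffAt.comp_of_eq (g := φ.symm) (f := fun y ↦ G (ψ y)) hφm
      (hG.contMDiffAt.comp (σ x) hψm) hGx
  refine hk.congr_of_eventuallyEq ?_
  have hcont : ContinuousAt (fun y ↦ σ (φ.symm (G (ψ y)))) (σ x) :=
    hσ.continuous.continuousAt.comp hk.continuousAt
  have hsrc : ∀ᶠ y in 𝓝 (σ x), σ (φ.symm (G (ψ y))) ∈ ψ.source := by
    refine hcont.eventually_mem (ψ.open_source.mem_nhds ?_)
    simp only [hGx, φ.left_inv (mem_chart_source E' x)]
    exact hψx
  filter_upwards [hsrc, hψm.continuousAt.eventually hgG, ψ.open_source.mem_nhds hψx] with y h1 h2 h3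
  have h4 : σ (φ.symm (G (ψ y))) = y := ψ.injOn h1 h3 h2
  rw [← hτσ (φ.symm (G (ψ y))), h4]

end Slices

/-! ### The theorem on simple Carrollian manifolds. -/

theorem theorem3 {n : ℕ}
    {N : Type*} [TopologicalSpace N] [T2Space N] [SecondCountableTopology N]
    [ChartedSpace (EuclideanSpace ℝ (Fin (n + 1))) N] [IsManifold (𝓡 (n + 1)) ∞ N]
    {M : Type*} [TopologicalSpace M] [T2Space M] [SecondCountableTopology M]
    [ChartedSpace (EuclideanSpace ℝ (Fin n)) M] [IsManifold (𝓡 n) ∞ M]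
    (h : DegenerateMetric (𝓡 (n + 1)) N) (ρ : N → M)
    (hs : IsSimpleCarrollianManifold h ρ) :
    -- `N` is a fibre bundle over the leaf space with typical fibre `ℝ`
    IsRealFibreBundle (𝓡 (n + 1)) (𝓡 n) ρ ∧
    -- the leaf space embeds as a transversal slice
    (∃ ι : M → N, IsTransversalSlice n ρ ι ∧ ∀ y, ρ (ι y) = y) ∧
    -- every transversal slice `S` can serve as the base
    ∀ (S : Type*) [TopologicalSpace S] [T2Space S] [SecondCountableTopology S]
      [ChartedSpace (EuclideanSpace ℝ (Fin n)) S] [IsManifold (𝓡 n) ∞ S] (ι : S → N),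
      IsTransversalSlice n ρ ι →
      -- the projection `q` along the leaves onto the slice
      ∃ q : N → S, (∀ x, ρ (ι (q x)) = ρ x) ∧
        IsRealFibreBundle (𝓡 (n + 1)) (𝓡 n) q ∧
        (∃ s : S → N, ContMDiff (𝓡 n) (𝓡 (n + 1)) ∞ s ∧ ∀ x, q (s x) = x) ∧
        -- every section `s` gives a linearisation `L` and a Carrollian bundle on `L` without zero
        ∀ s : S → N, ContMDiff (𝓡 n) (𝓡 (n + 1)) ∞ s → (∀ x, q (s x) = x) →
          ∃ (L : SmoothLineBundle n S)
            (Φ : L.Total ≃ₘ^∞⟮(𝓡 n).prod 𝓘(ℝ, ℝ), 𝓡 (n + 1)⟯ N)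
            (g : DegenerateMetric ((𝓡 n).prod 𝓘(ℝ, ℝ)) L.punctured),
            (∀ p : L.Total, q (Φ p) = p.1) ∧
            (∀ x : S, Φ ⟨x, 0⟩ = s x) ∧
            IsPullbackToPunctured h L Φ g ∧
            IsCarrollianRxBundle ((𝓡 n).prod 𝓘(ℝ, ℝ)) (𝓡 n) L.puncturedProj g ∧
            (h.PointwiseKernelEqVertical (𝓡 n) ρ →
              g.PointwiseKernelEqVertical (𝓡 n) L.puncturedProj) := by
  have hρ : ContMDiff (𝓡 (n + 1)) (𝓡 n) ∞ ρ := hs.submersion.contMDiff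
  have hline : IsLineFibration (EuclideanSpace ℝ (Fin (n + 1))) (EuclideanSpace ℝ (Fin n)) ρ :=
    ⟨hρ, hasFlowBoxes_of_isSubmersion hs.submersion, hs.leaf_connected, hs.leaf_noncompact⟩
  refine ⟨isRealFibreBundle_of_flowBox hline.exists_full_flowBox hρ, ?_, ?_⟩
  -- The slice is the zero section of a linear atlas; it is transversal because differentiating `ρ ∘
  -- A.zeroSection = id` gives the identity.
  · obtain ⟨A⟩ := hline.exists_linearAtlas
    have B : (EuclideanSpace ℝ (Fin n) × ℝ) ≃L[ℝ] EuclideanSpace ℝ (Fin (n + 1)) :=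
      ContinuousLinearEquiv.ofFinrankEq (by simp [Module.finrank_prod])
    refine ⟨A.zeroSection, ⟨A.isSmoothEmbedding_zeroSection hρ B, fun x v hv ↦ ?_, fun y ↦
      ⟨y, A.proj_zeroSection y, fun x hx ↦ (A.proj_zeroSection x).symm.trans hx⟩⟩,
      A.proj_zeroSection⟩
    have h1 := mfderiv_comp x ((hρ (A.zeroSection x)).mdifferentiableAt (by simp))
      ((A.contMDiff_zeroSection x).mdifferentiableAt (by simp))
    rw [(funext A.proj_zeroSection : ρ ∘ A.zeroSection = id), mfderiv_id] at h1
    exact (congrArg (fun L : EuclideanSpace ℝ (Fin n) →L[ℝ] EuclideanSpace ℝ (Fin n) ↦ L v)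
      h1).trans hv
  · intro S _ _ _ _ _ ι hι
    have hιs : ContMDiff (𝓡 n) (𝓡 (n + 1)) ∞ ι := hι.embedding.contMDiff
    have hσ : ContMDiff (𝓡 n) (𝓡 n) ∞ (ρ ∘ ι) := hρ.comp hιs
    -- `τ` sends a leaf to the point where the slice meets it. It is the inverse of `ρ ∘ ι`, and the
    -- projection along the leaves is `τ ∘ ρ`.
    choose τ hτ hτ' using hι.meets_leaf
    have hστ : RightInverse τ (ρ ∘ ι) := hτ
    have hτσ : LeftInverse τ (ρ ∘ ι) := fun x ↦ (hτ' _ x rfl).symm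
    have hσ' : ∀ x, Injective (mfderiv (𝓡 n) (𝓡 n) (ρ ∘ ι) x) := fun x ↦ by
      rw [mfderiv_comp x ((hρ (ι x)).mdifferentiableAt (by simp))
        ((hιs x).mdifferentiableAt (by simp))]
      exact (injective_iff_map_eq_zero _).2 (hι.transversal x)
    have hline' := hline.comp_leftInverse hσ (contMDiff_of_leftInverse hσ hσ' hτσ hστ) hτσ hστ
    obtain ⟨A⟩ := hline'.exists_linearAtlas
    refine ⟨τ ∘ ρ, fun x ↦ hτ (ρ x), isRealFibreBundle_of_flowBox hline'.exists_full_flowBox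
      hline'.contMDiff, ⟨A.zeroSection, A.contMDiff_zeroSection, A.proj_zeroSection⟩,
      fun s hs' hqs ↦ ?_⟩
    obtain ⟨L, Φ, hΦ, hΦ0⟩ := exists_lineBundle_diffeomorph A hline'.contMDiff hs' hqs
    obtain ⟨g, hg, hc, hp⟩ := exists_isCarrollianRxBundle hs.kernel hρ L Φ hσ hσ' fun p ↦ by
      rw [← hΦ p]
      exact (hτ (ρ (Φ p))).symm
    exact ⟨L, Φ, g, hΦ, hΦ0, hg, hc, hp⟩
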